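/- For a finite simple undirected graph $G=(V,E)$ and $X\subseteq V$ let $N(X)=\bigcup_{v\in X}N(v)$. For $A\subseteq V$ put $\mathcal{UN}(A)=\{N(X)\cap(V\setminus A) : X\subseteq A\}$ and $\operatorname{boolDim}(A)=\log_2|\mathcal{UN}(A)|$. A decomposition tree of $G$ is a full binary tree $T$ together with a bijection $\delta$ from its leaves to $V$; for a node $w$, $\delta(w)$ denotes the set of vertices at the leaves below $w$. Its boolean-width is $\max_{w\in T}\operatorname{boolDim}(\delta(w))$. It is linear if every internal node has at least one leaf as a child. A linear ordering $\pi=(\pi_1,\dots,\pi_n)$ of $V$ defines a linear decomposition: the caterpillar whose $i$-th leaf is mapped to $\pi_i$ and whose internal nodes $w$ have $\delta(w)=\{\pi_1,\dots,\pi_i\}$, $2\le i\le n$. Theorem. There is an algorithm (a fixed program for the random access machine with addition, truncated subtraction, comparisons, bitwise and/or/xor, shifts and indirect addressing) that, given a graph $G$ on $n\ge 1$ vertices $0,\dots,n-1$, each neighborhood stored as a bitset, computes a linear ordering of the vertices whose linear decomposition has minimum boolean-width among all linear decompositions of $G$, in $O(2.7284^n)$ time and using $O(n\cdot 2^n)$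 bits of space. Here time is measured by the logarithmic cost criterion (each elementary operation costs the number of bits of its operands and its result, plus one), and space is the maximum over all steps of the number of bits of the addresses and contents of all nonzero memory cells plus the working space for evaluating expressions (bounded by the cost of evaluating them). The implied constants are absolute. -/

import Mathlib

/-! ### Boolean-width of linear decompositions -/

namespace BooleanWidth

variable {V : Type*}

/-- The neighborhood `N(X)`, the union of the neighborhoods of the vertices in `X`. -/
def nbhd (G : SimpleGraph V) (X : Set V) : Set V :=
  ⋃ v ∈ X, G.neighborSet v

/-- The unions of neighborhoods across the cut `(A, Aᶜ)`. -/
def UN (G : SimpleGraph V) (A : Set V) : Set (Set V) :=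
  {S | ∃ X : Set V, X ⊆ A ∧ S = nbhd G X ∩ Aᶜ}

/-- The boolean dimension `log₂ |UN(A)|`. -/
noncomputable def boolDim (G : SimpleGraph V) (A : Set V) : ℝ :=
  Real.logb 2 ((UN G A).ncard : ℝ)

/-- Full binary trees whose leaves are labelled by vertices; the labelling is the map `δ`. -/
inductive DecTree (V : Type*) where
  | leaf (v : V) : DecTree V
  | node (l r : DecTree V) : DecTree V

namespace DecTree

/-- The labels of the leaves, from left to right. -/
def leaves : DecTree V → List V
  | leaf v => [v]
  | node l r => l.leaves ++ r.leaves

/-- `δ(w)` for the root `w` of a (sub)tree: the set of vertices at its leaves. -/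
def verts (T : DecTree V) : Set V := {v | v ∈ T.leaves}

/-- `T` is a decomposition tree of a graph on `V`: the labelling is a bijection between
the leaves and `V`. -/
def IsDecomposition (T : DecTree V) : Prop :=
  T.leaves.Nodup ∧ ∀ v : V, v ∈ T.leaves

def IsLeaf : DecTree V → Prop
  | leaf _ => True
  | node _ _ => False

/-- Every internal node has at least one leaf as a child. -/
def IsCaterpillar : DecTree V → Prop
  | leaf _ => True
  | node l r => (l.IsLeaf ∨ r.IsLeaf) ∧ l.IsCaterpillar ∧ r.IsCaterpillar

/-- Linear decompositions of a graph on `V`. -/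
def IsLinearDecomposition (T : DecTree V) : Prop :=
  T.IsDecomposition ∧ T.IsCaterpillar

/-- The boolean-width of a decomposition: the maximum of `boolDim G (δ(w))` over all nodes `w`. -/
noncomputable def boolWidth (G : SimpleGraph V) : DecTree V → ℝ
  | leaf v => boolDim G (leaf v).verts
  | node l r => max (boolDim G (node l r).verts) (max (boolWidth G l) (boolWidth G r))

/-- The caterpillar tree given by a non-empty linear ordering `π₁, …, πₙ`: its `i`-th leaf is `πᵢ`,
and its internal nodes are the roots of the subtrees with leaves `π₁, …, πᵢ` for `2 ≤ i ≤ n`. -/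
def ofOrdering : (π : List V) → π ≠ [] → DecTree V
  | v :: l, _ => l.foldl (fun T u => node T (leaf u)) (leaf v)

end DecTree

end BooleanWidth

/-! ### Random access machines with logarithmic cost

A machine has a memory of cells, addressed by natural numbers and holding natural numbers,
almost all of which are zero.  Programs are structured programs with indirect addressing.  Time is
counted by the logarithmic cost criterion: every elementary operation is charged the total number
of bits of its operands and its result, plus one.  Space is counted in bits. -/

namespace RAM

/-- Memory contents. -/
abbrev Mem := ℕ →₀ ℕ

/-- The elementary binary operations on integers and bitsets. All of them can be carried out in time
linear in the number of bits of the operands and of the result. -/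
inductive BinOp where
  | add | sub | land | lor | xor | shl | shr | eq | lt

/-- Subtraction is truncated at zero; comparisons return `1` for true and `0` for false. -/
def BinOp.apply : BinOp → ℕ → ℕ → ℕ
  | add, a, b => a + b
  | sub, a, b => a - b
  | land, a, b => a &&& b
  | lor, a, b => a ||| b
  | xor, a, b => a ^^^ b
  | shl, a, b => a <<< b
  | shr, a, b => a >>> b
  | eq, a, b => if a = b then 1 else 0
  | lt, a, b => if a < b then 1 else 0

/-- Expressions: numerals, the content of the cell at a computed address, binary operations. -/
inductive Expr where
  | const (c : ℕ) : Expr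
  | read (e : Expr) : Expr
  | bin (o : BinOp) (e f : Expr) : Expr

/-- The value of an expression. -/
def Expr.val (M : Mem) : Expr → ℕ
  | const c => c
  | read e => M (e.val M)
  | bin o e f => o.apply (e.val M) (f.val M)

/-- The logarithmic cost of evaluating an expression (`Nat.size` is the number of bits). It
is also an upper bound for the number of bits of all intermediate results together. -/
def Expr.cost (M : Mem) : Expr → ℕ
  | const c => c.size + 1
  | read e => e.cost M + (e.val M).size + (M (e.val M)).size + 1
  | bin o e f => e.cost M + f.cost M +
      (e.val M).size + (f.val M).size + (o.apply (e.val M) (f.val M)).size + 1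

/-- The number of bits needed to store a memory: for every cell in use, the number
of bits of its address and of its content. -/
def Mem.bits (M : Mem) : ℕ := M.sum fun a v => a.size + v.size

/-- Programs. `write e f` stores the value of `f` in the cell at address `e`; `cond` and `loop`
test whether the value of `e` is nonzero. -/
inductive Program where
  | skip : Program
  | write (e f : Expr) : Program
  | seq (p q : Program) : Program
  | cond (e : Expr) (p q : Program) : Program
  | loop (e : Expr) (p : Program) : Program

/-- `Exec p M N t s`: the program `p`, started in memory `M`, terminates in memory `N`
after time `t`, and uses `s` bits of space, the maximum over all steps of the number of bits of
the memory plus the working space for the expressions evaluated in that step. -/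
inductive Exec : Program → Mem → Mem → ℕ → ℕ → Prop where
  | skip (M : Mem) : Exec .skip M M 1 M.bits
  | write (e f : Expr) (M : Mem) :
      Exec (.write e f) M (M.update (e.val M) (f.val M))
        (e.cost M + f.cost M + (e.val M).size + (f.val M).size + 1)
        (max M.bits (Mem.bits (M.update (e.val M) (f.val M))) + e.cost M + f.cost M)
  | seq {p q : Program} {M N K : Mem} {t₁ t₂ s₁ s₂ : ℕ} :
      Exec p M N t₁ s₁ → Exec q N K t₂ s₂ → Exec (.seq p q) M K (t₁ + t₂) (max s₁ s₂)
  | condTrue {e : Expr} {p q : Program} {M N : Mem} {t s : ℕ} :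
      e.val M ≠ 0 → Exec p M N t s →
        Exec (.cond e p q) M N (e.cost M + 1 + t) (max (M.bits + e.cost M) s)
  | condFalse {e : Expr} {p q : Program} {M N : Mem} {t s : ℕ} :
      e.val M = 0 → Exec q M N t s →
        Exec (.cond e p q) M N (e.cost M + 1 + t) (max (M.bits + e.cost M) s)
  | loopStop {e : Expr} {p : Program} {M : Mem} :
      e.val M = 0 → Exec (.loop e p) M M (e.cost M + 1) (M.bits + e.cost M)
  | loopStep {e : Expr} {p : Program} {M N K : Mem} {t₁ t₂ s₁ s₂ : ℕ} :
      e.val M ≠ 0 → Exec p M N t₁ s₁ → Exec (.loop e p) N K t₂ s₂ →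
        Exec (.loop e p) M K (e.cost M + 1 + t₁ + t₂) (max (M.bits + e.cost M) (max s₁ s₂))

open Classical in
/-- The neighborhood of `i` as a bitset: bit `j` is set if and only if `i` and `j` are adjacent. -/
noncomputable def row {n : ℕ} (G : SimpleGraph (Fin n)) (i : Fin n) : ℕ :=
  ∑ j : Fin n, if G.Adj i j then 2 ^ (j : ℕ) else 0

/-- The input: cell `0` holds the number of vertices, cell `i + 1` the neighborhood of vertex `i`
as a bitset, and all other cells are zero. -/
noncomputable def input {n : ℕ} (G : SimpleGraph (Fin n)) : Mem :=
  Finsupp.single 0 n + ∑ i : Fin n, Finsupp.single ((i : ℕ) + 1) (row G i)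

end RAM

/-! Every decomposition tree has all singletons among its leaf cuts, so only the prefix cuts
distinguish linear orderings. The logarithm is monotone, so it suffices to minimize the largest
value of `un`, the number of unions of neighborhoods. This is a dynamic program over vertex sets:
p(∅) = 0 and p(A) = max(un(A), min over v in A of p(A - v)). A caterpillar peels off one leaf at a
time, so `opt_le_boolWidth` bounds its width below by log p; the recorded minimizers give an
ordering that attains the bound (`exists_optimal_ordering`). The program takes O(n) steps for each
of the 2^n sets once all values `un` are known, so the difficulty lies in computing those.

A union across the cut with left side C corresponds to one closed pair (x, r): r consists of the
right vertices not adjacent to x, and x of the left vertices not adjacent to r. Fix a matching with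
m edges and vertex set W, let H be the rest, and write C = A ∪ B with A in H and B in W. The pair is
determined by R = r ∩ W, X = x ∩ W and Y, the part of x among the vertices of A with a neighbor in H
\ A: the other vertices of A lie in x exactly when they avoid N(R), and r ∩ H follows from x. For
fixed A, the sets B compatible with a label (R, X, Y) form an interval. A vertex of W outside R ∪ X
must be on the left if it is not adjacent to x, and may be there only if it is adjacent to r. Hence
un(A ∪ B) is the number of label intervals that contain B (`sum_match`).

The intervals are counted in a table indexed by pairs L ⊆ T ⊆ W, which has 9^m entries. An interval
with L ≠ T is split at an element w of T \ L into those B that contain w and those that do not;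
after all splits the entries [B, B] hold the answers. In a label, X avoids R and N(R). A matching
edge therefore allows 4 choices of X if it misses R, and one choice for each of the 3 ways of
meeting R, so there are at most 7^m pairs (R, X) (`Matched.sum_le`). Since `un` is invariant under
complement, only the A with the smaller active part need to be processed, and this leaves at most
2^((n - 2m)/2) choices of Y.

The matching is built greedily while 16m ≤ 5n. If it stops at this cap, the bound 2^(n-2m) (7^m
2^((n-2m)/2) + 9^m) is O(2.72^n); if it stops because it is maximal, H is independent and Y = ∅. The
cap also gives 9^m ≤ 2^n, because 9^5 < 2^16, so the table fits into the space. Only nonzero cells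
count, so the table may be addressed sparsely.

The machine is handled through the judgement `Env.Run`, which counts elementary steps. All words
have 2n + 20 bits and each step costs O(n); the remaining polynomial factors are absorbed between
2.72 and 2.7284. -/

namespace RAM

/-! ### Costs of expressions -/

/-- Left shifts occur only by constants or by the content of cell `0`. -/
def Expr.safe : Expr → Bool
  | const _ => true
  | read e => e.safe
  | bin .shl e (const _) => e.safe
  | bin .shl e (read (const 0)) => e.safe
  | bin .shl _ _ => false
  | bin _ e f => e.safe && f.safe

/-- A bound for the number of words of the value. -/
def Expr.width : Expr → ℕ
  | const c => c + 1
  | read _ => 1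
  | bin .shl e (const c) => e.width + c
  | bin .shl e _ => e.width + 1
  | bin _ e f => e.width + f.width

/-- A bound for the cost in words. -/
def Expr.weight : Expr → ℕ
  | const c => c + 1
  | read e => e.weight + e.width + 2
  | bin o e f => e.weight + f.weight + e.width + f.width + (bin o e f).width + 1

theorem Expr.one_le_width (e : Expr) : 1 ≤ e.width := by
  induction e with
  | const c => simp [width]
  | read e => simp [width]
  | bin o e f he hf => 
    unfold width
    split <;> simp_all <;> omega

theorem Expr.width_le_weight (e : Expr) : e.width ≤ e.weight := by
  cases e with
  | const c => simp [width, weight]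
  | read e => simp [width, weight]
  | bin o e f => simp only [weight]; omega

theorem size_le_of_lt {v k : ℕ} (h : v < 2 ^ k) : v.size ≤ k := Nat.size_le.2 h

theorem Expr.safe_shl {e f : Expr} (h : (bin .shl e f).safe = true) :
    e.safe = true ∧ ((∃ c, f = const c) ∨ f = read (const 0)) := by
  rcases f with c | (_ | c) | g
  · exact ⟨h, .inl ⟨c, rfl⟩⟩
  · rename_i c
    rcases c with _ | c
    · exact ⟨h, .inr rfl⟩
    · cases h
  · cases h
  · cases h
  · cases h

/-- Bit lengths at most add up under every operation except left shift. A safe left shift is by a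
constant or by cell `0`, whose content is at most `b`, so it adds a bounded number of words. -/
theorem Expr.val_lt {M : Mem} {b : ℕ} (h0 : M 0 ≤ b) (hM : ∀ x, M x < 2 ^ b) (e : Expr)
    (he : e.safe = true) : e.val M < 2 ^ (e.width * (b + 1)) := by
  have mono : ∀ {v i j : ℕ}, v < 2 ^ (i * (b + 1)) → i ≤ j → v < 2 ^ (j * (b + 1)) :=
    fun h hij => h.trans_le (Nat.pow_le_pow_right (by norm_num) (Nat.mul_le_mul_right _ hij))
  have shl : ∀ {v i : ℕ} (c k : ℕ), v < 2 ^ (i * (b + 1)) → c ≤ k * (b + 1) →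
      v <<< c < 2 ^ ((i + k) * (b + 1)) := by
    intro v i c k hv hc
    rw [Nat.shiftLeft_eq, add_mul, pow_add]
    exact Nat.mul_lt_mul_of_lt_of_le hv (Nat.pow_le_pow_right (by norm_num) hc) (by positivity)
  induction e with
  | const c =>
    simp only [val, width]
    calc c < 2 ^ c := Nat.lt_two_pow_self
      _ ≤ _ := Nat.pow_le_pow_right (by norm_num) (by nlinarith)
  | read e ih =>
    simp only [val, width]
    exact (hM _).trans_le (Nat.pow_le_pow_right (by norm_num) (by omega))
  | bin o e f he' hf' =>
    have h2 := one_le_width e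
    have h3 := one_le_width f
    have h1 : ∀ {e : Expr}, 1 ≤ e.width → 1 < 2 ^ (e.width * (b + 1)) := by
      intro e h
      exact Nat.one_lt_two_pow (by positivity)
    cases o with
    | shl =>
      obtain ⟨hs, ⟨c, rfl⟩ | rfl⟩ := safe_shl he
      · exact shl c c (he' hs) (by nlinarith)
      · exact shl _ 1 (he' hs) (by simp only [val]; omega)
    | add =>
      simp only [safe, Bool.and_eq_true] at he
      have ha := he' he.1
      have hb := hf' he.2
      simp only [val, width, BinOp.apply]
      have h4 := h1 h2
      have h5 := h1 h3
      rw [add_mul, pow_add]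
      nlinarith
    | sub =>
      simp only [safe, Bool.and_eq_true] at he
      simp only [val, width, BinOp.apply]
      exact (Nat.sub_le _ _).trans_lt (mono (he' he.1) (by omega))
    | land =>
      simp only [safe, Bool.and_eq_true] at he
      simp only [val, width, BinOp.apply]
      exact Nat.and_le_left.trans_lt (mono (he' he.1) (by omega))
    | lor =>
      simp only [safe, Bool.and_eq_true] at he
      simp only [val, width, BinOp.apply]
      exact Nat.or_lt_two_pow (mono (he' he.1) (by omega)) (mono (hf' he.2) (by omega))
    | xor =>
      simp only [safe, Bool.and_eq_true] at he
      simp only [val, width, BinOp.apply]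
      exact Nat.xor_lt_two_pow (mono (he' he.1) (by omega)) (mono (hf' he.2) (by omega))
    | shr =>
      simp only [safe, Bool.and_eq_true] at he
      simp only [val, width, BinOp.apply]
      exact (Nat.shiftRight_le _ _).trans_lt (mono (he' he.1) (by omega))
    | eq =>
      simp only [val, width, BinOp.apply]
      refine lt_of_le_of_lt ?_ (Nat.one_lt_two_pow (n := (e.width + f.width) * (b + 1)) (by positivity))
      split <;> simp
    | lt =>
      simp only [val, width, BinOp.apply]
      refine lt_of_le_of_lt ?_ (Nat.one_lt_two_pow (n := (e.width + f.width) * (b + 1)) (by positivity))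
      split <;> simp

theorem Expr.safe_of_safe_bin {o : BinOp} {e f : Expr} (h : (bin o e f).safe = true) :
    e.safe = true ∧ f.safe = true := by
  unfold safe at h
  split at h <;> simp_all [safe]

/-- The cost is a sum of bit lengths of subexpression values, each controlled by `Expr.val_lt`. A
fixed expression thus costs a constant number of words. -/
theorem Expr.cost_le {M : Mem} {b : ℕ} (h0 : M 0 ≤ b) (hM : ∀ x, M x < 2 ^ b) (e : Expr)
    (he : e.safe = true) : e.cost M ≤ e.weight * (b + 1) := by
  induction e with
  | const c =>
    simp only [cost, weight]
    have : c.size ≤ c := Nat.size_le.2 Nat.lt_two_pow_self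
    nlinarith
  | read e ih =>
    have hs : e.safe = true := by simpa only [safe] using he
    have h1 := ih hs
    have h2 := size_le_of_lt (val_lt h0 hM e hs)
    have h3 := size_le_of_lt (hM (e.val M))
    simp only [cost, weight, add_mul]
    omega
  | bin o e f ihe ihf =>
    obtain ⟨h1, h2⟩ := safe_of_safe_bin he
    have h3 := ihe h1
    have h4 := ihf h2
    have h5 := size_le_of_lt (val_lt h0 hM _ h1)
    have h6 := size_le_of_lt (val_lt h0 hM _ h2)
    have h7 := size_le_of_lt (val_lt h0 hM _ he)
    simp only [val] at h7
    simp only [cost, weight]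
    calc _ ≤ e.weight * (b + 1) + f.weight * (b + 1) + e.width * (b + 1) + f.width * (b + 1)
          + (bin o e f).width * (b + 1) + 1 := by omega
      _ ≤ _ := by nlinarith

/-! ### Interleaved arrays -/

/-- A store holds the contents of arrays: arrays `0, …, 31` of unbounded length, and array `32`, the
input. -/
abbrev Store := ℕ → ℕ → ℕ

/-- Writing into an array. -/
def upd (σ : Store) (a i v : ℕ) : Store := fun c j => if c = a ∧ j = i then v else σ c j

/-- The address of cell `i` of array `a`. -/
def addr (n a i : ℕ) : ℕ := if a < 32 then 32 * i + n + (a + 1) else i + 1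

/-- The cell at address `x` of the memory that holds the store `σ`. -/
def cell (n : ℕ) (σ : Store) (x : ℕ) : ℕ :=
  if x = 0 then n else if x ≤ n then σ 32 (x - 1) else σ ((x - n - 1) % 32) ((x - n - 1) / 32)

theorem cell_addr {n a i : ℕ} (σ : Store) (ha : a < 32) : cell n σ (32 * i + n + (a + 1)) = σ a i := by
  have h1 : 32 * i + n + (a + 1) - n - 1 = 32 * i + a := by omega
  have h2 : (32 * i + a) % 32 = a := by omega
  have h3 : (32 * i + a) / 32 = i := by omega
  rw [cell, if_neg (by omega), if_neg (by omega), h1, h2, h3]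

theorem cell_succ {n i : ℕ} (σ : Store) (hi : i < n) : cell n σ (i + 1) = σ 32 i := by
  rw [cell, if_neg (by omega), if_pos (by omega), Nat.add_sub_cancel]

/-- Expressions that refer to arrays. -/
inductive Tm where
  | lit (c : ℕ) : Tm
  | size : Tm
  | get (a : ℕ) (e : Tm) : Tm
  | inp (e : Tm) : Tm
  | bin (o : BinOp) (e f : Tm) : Tm
  | shift (e : Tm) : Tm

namespace Tm

/-- The address of cell `e` of array `a` as an expression. -/
def addrExpr (a : ℕ) (e : Expr) : Expr :=
  if a < 32 then .bin .add (.bin .add (.bin .shl e (.const 5)) (.read (.const 0))) (.const (a + 1))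
  else .bin .add e (.const 1)

def toExpr : Tm → Expr
  | lit c => .const c
  | size => .read (.const 0)
  | get a e => .read (addrExpr a e.toExpr)
  | inp e => .read (.bin .add e.toExpr (.const 1))
  | bin o e f => .bin o e.toExpr f.toExpr
  | shift e => .bin .shl e.toExpr (.read (.const 0))

/-- The value of an expression. -/
def ev (n : ℕ) (σ : Store) : Tm → ℕ
  | lit c => c
  | size => n
  | get a e => σ a (e.ev n σ)
  | inp e => cell n σ (e.ev n σ + 1)
  | bin o e f => o.apply (e.ev n σ) (f.ev n σ)
  | shift e => e.ev n σ * 2 ^ n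

/-- The input array is excluded from `get`: its address formula agrees with `cell` only for indices
below `n`. It is read through `inp`, whose value is defined by `cell` and is correct for every
index. -/
def wf : Tm → Bool
  | lit _ => true
  | size => true
  | get a e => decide (a < 32) && e.wf
  | inp e => e.wf
  | bin _ e f => e.wf && f.wf
  | shift e => e.wf

theorem val_addrExpr {n : ℕ} {σ : Store} {M : Mem} (h : ∀ x, M x = cell n σ x) (a : ℕ) (e : Expr) :
    (addrExpr a e).val M = addr n a (e.val M) := by
  have h0 : M 0 = n := by rw [h]; rfl
  unfold addrExpr addr
  split
  · simp only [Expr.val, BinOp.apply, h0, Nat.shiftLeft_eq]; ring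
  · simp only [Expr.val, BinOp.apply]

theorem val_toExpr {n : ℕ} {σ : Store} {M : Mem} (h : ∀ x, M x = cell n σ x) (e : Tm)
    (he : e.wf = true) : e.toExpr.val M = e.ev n σ := by
  have h0 : M 0 = n := by rw [h]; rfl
  induction e with
  | lit c => rfl
  | size => exact h0
  | get a e ih =>
    simp only [wf, Bool.and_eq_true, decide_eq_true_eq] at he
    simp only [toExpr, Expr.val, ev]
    rw [val_addrExpr h, ih he.2, h, addr, if_pos he.1, cell_addr σ he.1]
  | inp e ih =>
    simp only [wf] at he
    simp only [toExpr, Expr.val, ev, BinOp.apply, ih he, h]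
  | bin o e f ihe ihf =>
    simp only [wf, Bool.and_eq_true] at he
    simp only [toExpr, Expr.val, ev, ihe he.1, ihf he.2]
  | shift e ih =>
    simp only [wf] at he
    simp only [toExpr, Expr.val, ev, ih he, BinOp.apply, Nat.shiftLeft_eq, h0]

end Tm

/-! ### Program logic with bounds for time and space -/

/-- A bound for the weight of all expressions in use. -/
def maxWeight : ℕ := 20000

/-- A Boolean test of syntax alone, so that `decide` settles it for each concrete expression of the
program. -/
def Tm.chk (e : Tm) : Bool := e.wf && (e.toExpr.safe && decide (e.toExpr.weight ≤ maxWeight))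

/-- The number of vertices, a word length, and the cells of the arrays that may be in use. -/
structure Env where
  n : ℕ
  b : ℕ
  dom : ℕ → Finset ℕ
  hn : n ≤ b
  addr_lt : ∀ a ≤ 32, ∀ i ∈ dom a, addr n a i < 2 ^ b
  dom_input : ∀ i ∈ dom 32, i < n

namespace Env

variable (E : Env)

/-- All contents are words, and only admissible cells are in use. -/
def Fits (σ : Store) : Prop := ∀ a ≤ 32, ∀ i, σ a i < 2 ^ E.b ∧ (σ a i ≠ 0 → i ∈ E.dom a)

/-- The memory `M` holds the store `σ`. -/
def Rep (M : Mem) (σ : Store) : Prop := (∀ x, M x = cell E.n σ x) ∧ E.Fits σ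

/-- The time of an elementary step. -/
def unit : ℕ := 5 * maxWeight * (E.b + 1)

/-- The admissible addresses. -/
def addrs : Finset ℕ :=
  insert 0 ((Finset.range 33).biUnion fun a => (E.dom a).image (addr E.n a))

def space : ℕ := E.addrs.card * (2 * E.b) + E.unit

variable {E}

theorem lt_of_mem_addrs {x : ℕ} (h : x ∈ E.addrs) : x < 2 ^ E.b := by
  simp only [addrs, Finset.mem_insert, Finset.mem_biUnion, Finset.mem_range, Finset.mem_image] at h
  rcases h with rfl | ⟨a, ha, i, hi, rfl⟩
  · positivity
  · exact E.addr_lt a (by omega) i hi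

theorem cell_lt {σ : Store} (h : E.Fits σ) (x : ℕ) : cell E.n σ x < 2 ^ E.b := by
  unfold cell
  split
  · exact E.hn.trans_lt Nat.lt_two_pow_self
  · split
    · exact (h 32 le_rfl _).1
    · exact (h _ (by omega) _).1

theorem mem_addrs_of_cell {σ : Store} (h : E.Fits σ) {x : ℕ} (hx : cell E.n σ x ≠ 0) :
    x ∈ E.addrs := by
  simp only [addrs, Finset.mem_insert, Finset.mem_biUnion, Finset.mem_range, Finset.mem_image]
  unfold cell at hx
  split at hx
  · left; assumption
  · right
    split at hx
    · refine ⟨32, by norm_num, x - 1, (h 32 le_rfl _).2 hx, ?_⟩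
      rw [addr, if_neg (by omega)]; omega
    · have h1 : (x - E.n - 1) % 32 < 32 := Nat.mod_lt _ (by norm_num)
      refine ⟨_, by omega, _, (h _ h1.le _).2 hx, ?_⟩
      rw [addr, if_pos h1]; omega

theorem bits_le {M : Mem} (h1 : ∀ x, M x < 2 ^ E.b) (h2 : ∀ x, M x ≠ 0 → x ∈ E.addrs) :
    M.bits ≤ E.addrs.card * (2 * E.b) := by
  unfold Mem.bits Finsupp.sum
  calc _ ≤ M.support.card * (2 * E.b) := by
        rw [← smul_eq_mul]
        refine Finset.sum_le_card_nsmul _ _ _ fun x hx => ?_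
        have := size_le_of_lt (lt_of_mem_addrs (h2 x (Finsupp.mem_support_iff.1 hx)))
        have := size_le_of_lt (h1 x)
        beta_reduce
        omega
    _ ≤ _ := Nat.mul_le_mul_right _ (Finset.card_le_card fun x hx =>
        h2 x (Finsupp.mem_support_iff.1 hx))

theorem Rep.bits_le {M : Mem} {σ : Store} (h : E.Rep M σ) : M.bits ≤ E.addrs.card * (2 * E.b) :=
  Env.bits_le (fun x => h.1 x ▸ cell_lt h.2 x) fun x hx => mem_addrs_of_cell h.2 (h.1 x ▸ hx)

theorem Rep.cost_le {M : Mem} {σ : Store} (h : E.Rep M σ) {e : Expr} (he : e.safe = true)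
    (hw : e.weight ≤ maxWeight) : e.cost M ≤ maxWeight * (E.b + 1) :=
  (Expr.cost_le (by rw [h.1]; exact E.hn) (fun x => h.1 x ▸ cell_lt h.2 x) e he).trans
    (Nat.mul_le_mul_right _ hw)

theorem Rep.size_val_le {M : Mem} {σ : Store} (h : E.Rep M σ) {e : Expr} (he : e.safe = true)
    (hw : e.weight ≤ maxWeight) : (e.val M).size ≤ maxWeight * (E.b + 1) :=
  (size_le_of_lt (Expr.val_lt (by rw [h.1]; exact E.hn) (fun x => h.1 x ▸ cell_lt h.2 x) e he)).trans
    (Nat.mul_le_mul_right _ (e.width_le_weight.trans hw))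

variable (E) in
/-- The program `p` leads from `σ` to `τ` in at most `k` elementary steps. -/
def Run (p : Program) (σ τ : Store) (k : ℕ) : Prop :=
  ∀ M, E.Rep M σ → ∃ N t s, Exec p M N t s ∧ E.Rep N τ ∧ t ≤ k * E.unit ∧ s ≤ E.space

theorem Run.mono {p : Program} {σ τ : Store} {k l : ℕ} (h : E.Run p σ τ k) (hkl : k ≤ l) :
    E.Run p σ τ l := by
  intro M hM
  obtain ⟨N, t, s, h1, h2, h3, h4⟩ := h M hM
  exact ⟨N, t, s, h1, h2, h3.trans (Nat.mul_le_mul_right _ hkl), h4⟩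

theorem run_skip (σ : Store) : E.Run .skip σ σ 1 := by
  intro M hM
  refine ⟨M, 1, _, .skip M, hM, ?_, ?_⟩
  · simp only [unit, maxWeight]; omega
  · exact hM.bits_le.trans (Nat.le_add_right _ _)

theorem Run.seq {p q : Program} {σ τ υ : Store} {k l : ℕ} (hp : E.Run p σ τ k)
    (hq : E.Run q τ υ l) : E.Run (.seq p q) σ υ (k + l) := by
  intro M hM
  obtain ⟨N, t, s, h1, h2, h3, h4⟩ := hp M hM
  obtain ⟨K, t', s', h1', h2', h3', h4'⟩ := hq N h2
  exact ⟨K, _, _, .seq h1 h1', h2', by rw [add_mul]; omega, max_le h4 h4'⟩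

/-- Assignment to cell `e` of array `a`. -/
def set (a : ℕ) (e f : Tm) : Program := .write (Tm.addrExpr a e.toExpr) f.toExpr

def chkSet (a : ℕ) (e f : Tm) : Bool :=
  decide (a ≤ 32) && (e.wf && ((Tm.addrExpr a e.toExpr).safe &&
    (decide ((Tm.addrExpr a e.toExpr).weight ≤ maxWeight) && f.chk)))

/-- Addresses above `n` encode array and index by remainder and quotient modulo 32, and addresses 1
to `n` hold the input. The bound on `i` keeps writes to array 32 out of the interleaved region. -/
theorem addr_inj {n a i x : ℕ} (ha : a ≤ 32) (hi : a = 32 → i < n) (σ : Store) (v : ℕ) :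
    cell n (upd σ a i v) x = if x = addr n a i then v else cell n σ x := by
  unfold cell addr upd
  by_cases h0 : x = 0
  · subst h0
    simp only [if_true]
    split_ifs <;> first | omega | rfl | contradiction
  · rw [if_neg h0, if_neg h0]
    by_cases hx : x ≤ n
    · simp only [if_pos hx]
      split_ifs <;> first | rfl | omega
    · simp only [if_neg hx]
      split_ifs <;> first | rfl | omega

theorem run_set {a : ℕ} {e f : Tm} {σ : Store} (h : chkSet a e f = true)
    (hi : e.ev E.n σ ∈ E.dom a) (hv : f.ev E.n σ < 2 ^ E.b) :
    E.Run (set a e f) σ (upd σ a (e.ev E.n σ) (f.ev E.n σ)) 1 := by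
  intro M hM
  simp only [chkSet, Tm.chk, Bool.and_eq_true, decide_eq_true_eq] at h
  obtain ⟨ha, hwe, hse, hce, hwf, hsf, hcf⟩ := h
  have h1 : (Tm.addrExpr a e.toExpr).val M = addr E.n a (e.ev E.n σ) := by
    rw [Tm.val_addrExpr hM.1, Tm.val_toExpr hM.1 e hwe]
  have h2 := Tm.val_toExpr hM.1 f hwf
  have hrep : E.Rep (M.update ((Tm.addrExpr a e.toExpr).val M) (f.toExpr.val M))
      (upd σ a (e.ev E.n σ) (f.ev E.n σ)) := by
    constructor
    · intro x
      rw [addr_inj ha (fun h => E.dom_input _ (h ▸ hi)), h1, h2, Finsupp.coe_update,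
        Function.update_apply, hM.1]
    · intro c hc i
      unfold upd
      split_ifs with h
      · exact ⟨hv, fun _ => by rw [h.1, h.2]; exact hi⟩
      · exact hM.2 c hc i
  refine ⟨_, _, _, .write _ _ M, hrep, ?_, ?_⟩
  · have := hM.cost_le hse hce
    have := hM.cost_le hsf hcf
    have := hM.size_val_le hse hce
    have := hM.size_val_le hsf hcf
    -- This is the origin of the factor 5 in `unit`: two expression costs, the sizes of address and
    -- value, and the additional one.
    simp only [unit, one_mul, mul_assoc]
    have : 1 ≤ maxWeight * (E.b + 1) := by simp [maxWeight]; omega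
    omega
  · have := hM.cost_le hse hce
    have := hM.cost_le hsf hcf
    have := hM.bits_le
    have := hrep.bits_le
    simp only [space, unit, mul_assoc]
    omega

theorem run_ite {e : Tm} {p q : Program} {σ τ : Store} {k : ℕ} (h : e.chk = true)
    (ht : e.ev E.n σ ≠ 0 → E.Run p σ τ k) (hf : e.ev E.n σ = 0 → E.Run q σ τ k) :
    E.Run (.cond e.toExpr p q) σ τ (k + 1) := by
  intro M hM
  simp only [Tm.chk, Bool.and_eq_true, decide_eq_true_eq] at h
  obtain ⟨hwe, hse, hce⟩ := h
  have h1 := Tm.val_toExpr hM.1 e hwe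
  have h2 := hM.cost_le hse hce
  have h3 := hM.bits_le
  have h4 : 1 ≤ maxWeight * (E.b + 1) := by simp [maxWeight]; omega
  have h5 : E.unit = 5 * (maxWeight * (E.b + 1)) := by rw [unit, mul_assoc]
  by_cases hz : e.ev E.n σ = 0
  · obtain ⟨N, t, s, g1, g2, g3, g4⟩ := hf hz M hM
    refine ⟨N, _, _, .condFalse (h1.trans hz) g1, g2, ?_, max_le ?_ g4⟩
    · rw [add_mul]; omega
    · rw [space]; omega
  · obtain ⟨N, t, s, g1, g2, g3, g4⟩ := ht hz M hM
    refine ⟨N, _, _, .condTrue (h1.trans_ne hz) g1, g2, ?_, max_le ?_ g4⟩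
    · rw [add_mul]; omega
    · rw [space]; omega

theorem run_loop_stop {e : Tm} {p : Program} {σ : Store} (h : e.chk = true)
    (hz : e.ev E.n σ = 0) : E.Run (.loop e.toExpr p) σ σ 1 := by
  intro M hM
  simp only [Tm.chk, Bool.and_eq_true, decide_eq_true_eq] at h
  obtain ⟨hwe, hse, hce⟩ := h
  have h1 := Tm.val_toExpr hM.1 e hwe
  have h2 := hM.cost_le hse hce
  have h3 := hM.bits_le
  have h4 : 1 ≤ maxWeight * (E.b + 1) := by simp [maxWeight]; omega
  have h5 : E.unit = 5 * (maxWeight * (E.b + 1)) := by rw [unit, mul_assoc]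
  refine ⟨M, _, _, .loopStop (h1.trans hz), hM, ?_, ?_⟩
  · omega
  · rw [space]; omega

theorem run_loop_step {e : Tm} {p : Program} {σ τ υ : Store} {k l : ℕ} (h : e.chk = true)
    (hz : e.ev E.n σ ≠ 0) (hp : E.Run p σ τ k) (hl : E.Run (.loop e.toExpr p) τ υ l) :
    E.Run (.loop e.toExpr p) σ υ (k + l + 1) := by
  intro M hM
  simp only [Tm.chk, Bool.and_eq_true, decide_eq_true_eq] at h
  obtain ⟨hwe, hse, hce⟩ := h
  have h1 := Tm.val_toExpr hM.1 e hwe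
  have h2 := hM.cost_le hse hce
  have h3 := hM.bits_le
  have h4 : 1 ≤ maxWeight * (E.b + 1) := by simp [maxWeight]; omega
  have h5 : E.unit = 5 * (maxWeight * (E.b + 1)) := by rw [unit, mul_assoc]
  obtain ⟨N, t, s, g1, g2, g3, g4⟩ := hp M hM
  obtain ⟨K, t', s', g1', g2', g3', g4'⟩ := hl N g2
  refine ⟨K, _, _, .loopStep (h1.trans_ne hz) g1 g1', g2', ?_, max_le ?_ (max_le g4 g4')⟩
  · rw [add_mul, add_mul]; omega
  · rw [space]; omega

end Env
end RAM

namespace RAM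

/-! ### Bitsets -/

/-- The bitsets contained in `S`. -/
def subs (S : ℕ) : Finset ℕ := (Finset.range (S + 1)).filter fun s => s &&& S = s

theorem mem_subs {s S : ℕ} : s ∈ subs S ↔ s &&& S = s := by
  simp only [subs, Finset.mem_filter, Finset.mem_range, and_iff_right_iff_imp]
  intro h
  have : s ≤ S := h ▸ Nat.and_le_right
  omega

theorem mem_subs_iff {s S : ℕ} : s ∈ subs S ↔ ∀ i, s.testBit i = true → S.testBit i = true := by
  rw [mem_subs]
  constructor
  · intro h i hi
    rw [← h, Nat.testBit_and, Bool.and_eq_true] at hi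
    exact hi.2
  · intro h
    refine Nat.eq_of_testBit_eq fun i => ?_
    rw [Nat.testBit_and]
    by_cases hi : s.testBit i = true
    · rw [hi, h i hi]; rfl
    · rw [Bool.not_eq_true] at hi; rw [hi]; rfl

theorem le_of_mem_subs {s S : ℕ} (h : s ∈ subs S) : s ≤ S := by
  rw [mem_subs] at h
  exact h ▸ Nat.and_le_right

theorem self_mem_subs (S : ℕ) : S ∈ subs S := mem_subs.2 (Nat.and_self S)

theorem subs_trans {s t S : ℕ} (h : s ∈ subs t) (h' : t ∈ subs S) : s ∈ subs S := by
  rw [mem_subs_iff] at *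
  exact fun i hi => h' i (h i hi)

/-- The submask that follows `v` in the descending enumeration of submasks. -/
theorem le_pred_and {v S : ℕ} : ∀ {s : ℕ}, v ∈ subs S → s ∈ subs S → s < v → s ≤ (v - 1) &&& S := by
  -- Induction by deleting the lowest bit. If `v` is even, the borrow moves on to `v / 2` and the
  -- lowest bit of the result is that of `S`; if `v` is odd, only its lowest bit is cleared.
  have key : ∀ (v s S : ℕ), (∀ i, v.testBit i = true → S.testBit i = true) →
      (∀ i, s.testBit i = true → S.testBit i = true) → s < v → s ≤ (v - 1) &&& S := by
    intro v
    induction v using Nat.strong_induction_on with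
    | _ v ih =>
      intro s S hv hs hlt
      have hdiv : ((v - 1) &&& S) / 2 = (v - 1) / 2 &&& S / 2 := Nat.and_div_two
      have hmod : ((v - 1) &&& S) % 2 = ((v - 1) % 2 &&& S % 2) := by
        have := Nat.and_mod_two_pow (a := v - 1) (b := S) (n := 1)
        simpa using this
      have hv' : ∀ i, (v / 2).testBit i = true → (S / 2).testBit i = true := by
        intro i hi
        rw [Nat.testBit_div_two] at hi ⊢
        exact hv _ hi
      have hs' : ∀ i, (s / 2).testBit i = true → (S / 2).testBit i = true := by
        intro i hi
        rw [Nat.testBit_div_two] at hi ⊢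
        exact hs _ hi
      have hs0 : s % 2 = 1 → S % 2 = 1 := by
        intro h
        have := hs 0
        simp only [Nat.testBit_zero, decide_eq_true_eq] at this
        exact this h
      rcases Nat.mod_two_eq_zero_or_one v with hv2 | hv2
      · have h1 : (v - 1) / 2 = v / 2 - 1 := by omega
        have h2 : (v - 1) % 2 = 1 := by omega
        have h3 := ih (v / 2) (by omega) (s / 2) (S / 2) hv' hs' (by omega)
        rw [h1] at hdiv
        rw [h2] at hmod
        have h4 : s % 2 ≤ (1 &&& S % 2) := by
          rcases Nat.mod_two_eq_zero_or_one s with h | h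
          · omega
          · rw [h, hs0 h]; decide
        omega
      · have h1 : (v - 1) / 2 = v / 2 := by omega
        have h4 : v / 2 &&& S / 2 = v / 2 := mem_subs.1 (mem_subs_iff.2 hv')
        rw [h1, h4] at hdiv
        omega
  intro s hv hs hlt
  exact key v s S (mem_subs_iff.1 hv) (mem_subs_iff.1 hs) hlt

theorem pred_and_mem_subs (v S : ℕ) : (v - 1) &&& S ∈ subs S := by
  rw [mem_subs_iff]
  intro i hi
  rw [Nat.testBit_and, Bool.and_eq_true] at hi
  exact hi.2

theorem zero_mem_subs (S : ℕ) : 0 ∈ subs S := by rw [mem_subs]; simp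

/-- The bits of `s`. -/
def bitsOf (s : ℕ) : Finset ℕ := (Finset.range s).filter fun i => s.testBit i = true

theorem mem_bitsOf {s i : ℕ} : i ∈ bitsOf s ↔ s.testBit i = true := by
  simp only [bitsOf, Finset.mem_filter, Finset.mem_range, and_iff_right_iff_imp]
  intro h
  exact Nat.lt_two_pow_self.trans_le (Nat.ge_two_pow_of_testBit h)

theorem bitsOf_injective : Function.Injective bitsOf := by
  intro s t h
  refine Nat.eq_of_testBit_eq fun i => ?_
  have := congrArg (i ∈ ·) h
  simp only [mem_bitsOf, eq_iff_iff] at this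
  exact Bool.eq_iff_iff.2 this

/-- The number of elements of a bitset. -/
def pop (s : ℕ) : ℕ := (bitsOf s).card

theorem testBit_sum_two_pow (B : Finset ℕ) (i : ℕ) : (∑ j ∈ B, 2 ^ j).testBit i = true ↔ i ∈ B := by
  induction B using Finset.induction_on_max with
  | empty => simp
  | insert a B hB ih =>
    have hlt : ∑ j ∈ B, 2 ^ j < 2 ^ a := by
      calc ∑ j ∈ B, 2 ^ j ≤ ∑ j ∈ Finset.range a, 2 ^ j :=
            Finset.sum_le_sum_of_subset fun j hj => Finset.mem_range.2 (hB j hj)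
        _ < 2 ^ a := Nat.geomSum_lt (le_refl 2) (fun k hk => Finset.mem_range.1 hk)
    rw [Finset.sum_insert fun h => lt_irrefl _ (hB a h), Finset.mem_insert]
    rcases lt_trichotomy i a with h | h | h
    · rw [Nat.testBit_two_pow_add_gt h, ih]
      constructor
      · exact Or.inr
      · rintro (rfl | h')
        · omega
        · exact h'
    · subst h
      rw [Nat.testBit_two_pow_add_eq, Nat.testBit_lt_two_pow hlt]
      simp
    · rw [Nat.testBit_lt_two_pow (lt_of_lt_of_le (by rw [pow_succ]; omega :
        2 ^ a + ∑ j ∈ B, 2 ^ j < 2 ^ (a + 1)) (Nat.pow_le_pow_right (by norm_num) h))]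
      simp only [Bool.false_eq_true, false_iff, not_or]
      exact ⟨by omega, fun h' => by have := hB i h'; omega⟩

theorem bitsOf_sum (B : Finset ℕ) : bitsOf (∑ j ∈ B, 2 ^ j) = B := by
  ext i; rw [mem_bitsOf, testBit_sum_two_pow]

theorem sum_bitsOf (s : ℕ) : ∑ j ∈ bitsOf s, 2 ^ j = s := bitsOf_injective (bitsOf_sum _)

theorem mem_subs_iff_bitsOf {s S : ℕ} : s ∈ subs S ↔ bitsOf s ⊆ bitsOf S := by
  simp only [mem_subs_iff, Finset.subset_iff, mem_bitsOf]

theorem image_bitsOf_subs (S : ℕ) : (subs S).image bitsOf = (bitsOf S).powerset := by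
  ext B
  simp only [Finset.mem_image, Finset.mem_powerset, mem_subs_iff_bitsOf]
  constructor
  · rintro ⟨s, hs, rfl⟩; exact hs
  · intro h; exact ⟨_, by rwa [bitsOf_sum], bitsOf_sum B⟩

theorem sum_subs {α : Type*} [AddCommMonoid α] (S : ℕ) (f : ℕ → α) :
    ∑ s ∈ subs S, f (bitsOf s).card = ∑ B ∈ (bitsOf S).powerset, f B.card := by
  rw [← image_bitsOf_subs, Finset.sum_image fun x _ y _ h => bitsOf_injective h]

theorem card_subs (S : ℕ) : (subs S).card = 2 ^ pop S := by
  rw [pop, ← Finset.card_powerset, ← image_bitsOf_subs, Finset.card_image_of_injective _ bitsOf_injective]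

/-- The pairs `L ⊆ T ⊆ S`. -/
theorem sum_two_pow_pop (S : ℕ) : ∑ s ∈ subs S, 2 ^ pop s = 3 ^ pop S := by
  simp only [pop]
  rw [sum_subs S (fun k => 2 ^ k)]
  have := Finset.sum_pow_mul_eq_add_pow (R := ℕ) 2 1 (bitsOf S)
  simpa using this

/-- `m &&& (m - 1)` is `m` without its lowest set bit, so the difference isolates that bit. The
program picks an element of a set in this way. -/
theorem exists_eq_sub_and {m : ℕ} (hm : m ≠ 0) :
    ∃ k, m.testBit k = true ∧ m - (m &&& (m - 1)) = 2 ^ k := by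
  induction m using Nat.strong_induction_on with
  | _ m ih =>
    have hdiv : (m &&& (m - 1)) / 2 = m / 2 &&& (m - 1) / 2 := Nat.and_div_two
    have hmod : (m &&& (m - 1)) % 2 = (m % 2 &&& (m - 1) % 2) := by
      have := Nat.and_mod_two_pow (a := m) (b := m - 1) (n := 1)
      simpa using this
    rcases Nat.mod_two_eq_zero_or_one m with h | h
    · obtain ⟨k, hk, hk'⟩ := ih (m / 2) (by omega) (by omega)
      refine ⟨k + 1, by rw [Nat.testBit_succ]; exact hk, ?_⟩
      have h1 : (m - 1) / 2 = m / 2 - 1 := by omega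
      rw [h1] at hdiv
      rw [h, Nat.zero_and] at hmod
      rw [pow_succ]
      omega
    · refine ⟨0, by simp [h], ?_⟩
      have h1 : (m - 1) / 2 = m / 2 := by omega
      have h2 : (m - 1) % 2 = 0 := by omega
      rw [h1, Nat.and_self] at hdiv
      rw [h2, Nat.and_zero] at hmod
      simp only [pow_zero]
      omega

/-- Disjoint bitsets add without carries. -/
theorem add_eq_or {s t : ℕ} (h : s &&& t = 0) : s + t = s ||| t := by
  have hd : Disjoint (bitsOf s) (bitsOf t) := by
    rw [Finset.disjoint_left]
    intro i hs ht
    rw [mem_bitsOf] at hs ht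
    have := congrArg (fun x => x.testBit i) h
    simp [Nat.testBit_and, hs, ht] at this
  have hu : bitsOf (s ||| t) = bitsOf s ∪ bitsOf t := by
    ext i
    simp only [mem_bitsOf, Finset.mem_union, Nat.testBit_or, Bool.or_eq_true]
  rw [← sum_bitsOf (s ||| t), hu, Finset.sum_union hd, sum_bitsOf, sum_bitsOf]

/-- Difference of bitsets. -/
theorem testBit_sub_and (s t i : ℕ) :
    (s - (s &&& t)).testBit i = (s.testBit i && !t.testBit i) := by
  have h : (s &&& t) + (s ^^^ (s &&& t)) = s := by
    rw [add_eq_or]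
    · refine Nat.eq_of_testBit_eq fun i => ?_
      simp only [Nat.testBit_or, Nat.testBit_and, Nat.testBit_xor]
      cases s.testBit i <;> cases t.testBit i <;> rfl
    · refine Nat.eq_of_testBit_eq fun i => ?_
      simp only [Nat.testBit_and, Nat.testBit_xor, Nat.zero_testBit]
      cases s.testBit i <;> cases t.testBit i <;> rfl
  have h2 : s - (s &&& t) = s ^^^ (s &&& t) := by omega
  rw [h2]
  simp only [Nat.testBit_and, Nat.testBit_xor]
  cases s.testBit i <;> cases t.testBit i <;> rfl

theorem testBit_sub_of_mem_subs {s t : ℕ} (h : t ∈ subs s) (i : ℕ) :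
    (s - t).testBit i = (s.testBit i && !t.testBit i) := by
  rw [mem_subs, Nat.and_comm] at h
  conv_lhs => rw [← h]
  exact testBit_sub_and s t i

theorem testBit_ext {s t : ℕ} (h : ∀ i, s.testBit i = true ↔ t.testBit i = true) : s = t :=
  Nat.eq_of_testBit_eq fun i => Bool.eq_iff_iff.2 (h i)

theorem testBit_two_pow_iff {i j : ℕ} : (2 ^ i).testBit j = true ↔ i = j := by
  rw [Nat.testBit_two_pow]; simp

theorem and_two_pow_ne_zero {s i : ℕ} : s &&& 2 ^ i ≠ 0 ↔ s.testBit i = true := by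
  constructor
  · intro h
    by_contra h'
    refine h (testBit_ext fun j => ?_)
    simp only [Nat.testBit_and, Bool.and_eq_true, testBit_two_pow_iff, Nat.zero_testBit]
    constructor
    · rintro ⟨h1, rfl⟩; exact absurd h1 h'
    · simp
  · intro h h'
    have := congrArg (fun x => x.testBit i) h'
    simp only [Nat.testBit_and, Nat.zero_testBit, h, Bool.true_and] at this
    rw [testBit_two_pow_iff.2 rfl] at this
    cases this

theorem two_pow_mem_subs {s i : ℕ} (h : s.testBit i = true) : 2 ^ i ∈ subs s := by
  rw [mem_subs_iff]
  intro j hj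
  rw [testBit_two_pow_iff] at hj
  exact hj ▸ h

theorem testBit_sub_two_pow {s i : ℕ} (h : s.testBit i = true) (j : ℕ) :
    (s - 2 ^ i).testBit j = true ↔ s.testBit j = true ∧ i ≠ j := by
  rw [testBit_sub_of_mem_subs (two_pow_mem_subs h), Bool.and_eq_true, Bool.not_eq_true',
    ← Bool.not_eq_true, testBit_two_pow_iff]

theorem lt_two_pow_iff {s n : ℕ} : s < 2 ^ n ↔ ∀ i, s.testBit i = true → i < n := by
  constructor
  · intro h i hi
    by_contra hin
    rw [Nat.testBit_lt_two_pow (h.trans_le (Nat.pow_le_pow_right (by norm_num) (by omega)))] at hi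
    cases hi
  · intro h
    refine Nat.lt_pow_two_of_testBit _ fun i hi => ?_
    by_contra h'
    exact absurd (h i (by simpa using h')) (by omega)

theorem testBit_full {n i : ℕ} : (2 ^ n - 1).testBit i = true ↔ i < n := by
  rw [Nat.testBit_two_pow_sub_one, decide_eq_true_eq]

theorem mem_subs_full {n s : ℕ} : s ∈ subs (2 ^ n - 1) ↔ s < 2 ^ n := by
  rw [mem_subs_iff, lt_two_pow_iff]
  simp only [testBit_full]

/-! ### Loops -/

/-- The content of the first cell of an array. -/
def Tm.sc (a : ℕ) : Tm := .get a (.lit 0)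

open Tm BinOp

theorem upd_apply (σ : Store) (a i v c j : ℕ) :
    upd σ a i v c j = if c = a ∧ j = i then v else σ c j := rfl

theorem upd_of_ne {σ : Store} {a i v c : ℕ} (h : c ≠ a) : upd σ a i v c = σ c := by
  funext j; rw [upd_apply, if_neg fun h' => h h'.1]

@[simp] theorem upd_same (σ : Store) (a i v : ℕ) : upd σ a i v a i = v := by simp [upd_apply]

/-- The stores agree on all arrays but those in `S`. -/
def Agree (S : Finset ℕ) (σ τ : Store) : Prop := ∀ a, a ∉ S → τ a = σ a

theorem Agree.refl (S : Finset ℕ) (σ : Store) : Agree S σ σ := fun _ _ => rfl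

theorem Agree.trans {S : Finset ℕ} {σ τ υ : Store} (h : Agree S σ τ) (h' : Agree S τ υ) :
    Agree S σ υ := fun a ha => (h' a ha).trans (h a ha)

theorem Agree.mono {S S' : Finset ℕ} {σ τ : Store} (h : Agree S σ τ) (hS : S ⊆ S') :
    Agree S' σ τ := fun a ha => h a fun h' => ha (hS h')

theorem Agree.upd {S : Finset ℕ} {σ τ : Store} (h : Agree S σ τ) {a : ℕ} (ha : a ∈ S) (i v : ℕ) :
    Agree S σ (RAM.upd τ a i v) := fun c hc => by
  rw [upd_of_ne fun h' => hc (by rwa [h'])]; exact h c hc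

namespace Env

variable {E : Env}

/-- `J j` is the invariant after `j` rounds; the loop test must hold before each of the `N` rounds
and fail afterwards. Each round pays for its body and one test, and the final test costs one more.
-/
theorem run_iter {e : Tm} {body : Program} (he : e.chk = true) (N : ℕ) (J : ℕ → Store → Prop)
    (c : ℕ → ℕ) (step : ∀ j < N, ∀ σ, J j σ →
      e.ev E.n σ ≠ 0 ∧ ∃ τ, E.Run body σ τ (c j) ∧ J (j + 1) τ)
    (halt : ∀ σ, J N σ → e.ev E.n σ = 0) (σ : Store) (h0 : J 0 σ) :
    ∃ τ, E.Run (.loop e.toExpr body) σ τ (∑ j ∈ Finset.range N, (c j + 1) + 1) ∧ J N τ := by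
  have key : ∀ d j, j + d = N → ∀ σ, J j σ →
      ∃ τ, E.Run (.loop e.toExpr body) σ τ (∑ i ∈ Finset.range d, (c (j + i) + 1) + 1) ∧ J N τ := by
    intro d
    induction d with
    | zero =>
      intro j hj σ hσ
      obtain rfl : j = N := by omega
      exact ⟨σ, by simpa using run_loop_stop he (halt σ hσ), hσ⟩
    | succ d ih =>
      intro j hj σ hσ
      obtain ⟨hne, τ, hr, hτ⟩ := step j (by omega) σ hσ
      obtain ⟨υ, hr', hυ⟩ := ih (j + 1) (by omega) τ hτ
      refine ⟨υ, (run_loop_step he hne hr hr').mono ?_, hυ⟩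
      rw [Finset.sum_range_succ']
      have : ∑ i ∈ Finset.range d, (c (j + 1 + i) + 1) = ∑ i ∈ Finset.range d, (c (j + (i + 1)) + 1) :=
        Finset.sum_congr rfl fun i _ => by rw [show j + 1 + i = j + (i + 1) by ring]
      rw [this]
      simp only [add_zero]
      omega
  simpa using key N 0 (by omega) σ h0

/-- A loop over `i = 0, …, n - 1` with `p = 2 ^ i`. -/
def forBits (i p : ℕ) (body : Program) : Program :=
  .seq (set i (lit 0) (lit 0)) (.seq (set p (lit 0) (lit 1))
    (.loop (bin lt (sc i) size).toExpr
      (.seq body (.seq (set i (lit 0) (bin add (sc i) (lit 1)))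
        (set p (lit 0) (bin add (sc p) (sc p)))))))

def chkBits (i p : ℕ) : Bool :=
  chkSet i (lit 0) (lit 0) && (chkSet p (lit 0) (lit 1) && ((bin lt (sc i) size).chk &&
    (chkSet i (lit 0) (bin add (sc i) (lit 1)) && chkSet p (lit 0) (bin add (sc p) (sc p)))))

/-- The power is maintained by doubling, which avoids shifts by a variable. The invariant is
demanded for all stores that agree off the two counters, so that it survives their update. The
counter `p` ends at `2 ^ n`, hence the strict bound on the word length. -/
theorem run_forBits {i p : ℕ} {body : Program} (hc : chkBits i p = true) (hip : i ≠ p)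
    (hnb : E.n < E.b) (hi : 0 ∈ E.dom i) (hp : 0 ∈ E.dom p) (I : ℕ → Store → Prop) (k : ℕ)
    (step : ∀ j < E.n, ∀ σ, I j σ → σ i 0 = j → σ p 0 = 2 ^ j →
      ∃ τ, E.Run body σ τ k ∧ τ i 0 = j ∧ τ p 0 = 2 ^ j ∧ ∀ υ, Agree {i, p} τ υ → I (j + 1) υ)
    (σ : Store) (h0 : ∀ υ, Agree {i, p} σ υ → I 0 υ) :
    ∃ τ, E.Run (forBits i p body) σ τ (E.n * (k + 3) + 3) ∧ I E.n τ ∧ τ p 0 = 2 ^ E.n := by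
  simp only [chkBits, Bool.and_eq_true] at hc
  obtain ⟨c1, c2, c3, c4, c5⟩ := hc
  have hlt : ∀ j ≤ E.n, 2 ^ j < 2 ^ E.b := fun j hj =>
    Nat.pow_lt_pow_right (by norm_num) (by omega)
  have r1 := run_set (σ := σ) c1 hi (by simp [ev])
  have r2 := run_set (σ := upd σ i 0 0) c2 hp (by
    simpa [ev] using hlt 0 (by omega))
  simp only [ev] at r1 r2
  obtain ⟨τ, hτ, h1, h2, h3⟩ := run_iter (E := E) (body := .seq body (.seq
      (set i (lit 0) (bin add (sc i) (lit 1))) (set p (lit 0) (bin add (sc p) (sc p))))) c3 E.n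
    (fun j σ => I j σ ∧ σ i 0 = j ∧ σ p 0 = 2 ^ j) (fun _ => k + 2)
    (by
      rintro j hj σ ⟨h1, h2, h3⟩
      refine ⟨by simp [ev, sc, BinOp.apply, h2, hj], ?_⟩
      obtain ⟨τ, hr, g1, g2, g3⟩ := step j hj σ h1 h2 h3
      have r3 := run_set (σ := τ) c4 hi (by
        simp only [ev, sc, BinOp.apply, g1]
        exact lt_of_le_of_lt hj (Nat.lt_two_pow_self.trans (hlt E.n le_rfl)))
      simp only [ev, sc, BinOp.apply, g1] at r3
      have g2' : upd τ i 0 (j + 1) p 0 = 2 ^ j := by rw [upd_of_ne hip.symm, g2]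
      have e2 : 2 ^ j + 2 ^ j = 2 ^ (j + 1) := by ring
      have r4 := run_set (σ := upd τ i 0 (j + 1)) c5 hp (by
        simp only [ev, sc, BinOp.apply, g2', e2]
        exact hlt _ hj)
      simp only [ev, sc, BinOp.apply, g2', e2] at r4
      refine ⟨upd (upd τ i 0 (j + 1)) p 0 (2 ^ (j + 1)), (hr.seq (r3.seq r4)).mono (by omega), g3 _ ?_, ?_, ?_⟩
      · exact ((Agree.refl _ _).upd (by simp) _ _).upd (by simp) _ _
      · rw [upd_of_ne hip, upd_same]
      · rw [upd_same])
    (by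
      rintro σ ⟨-, h, -⟩
      simp [ev, sc, BinOp.apply, h]) (upd (upd σ i 0 0) p 0 1)
    ⟨h0 _ (((Agree.refl _ _).upd (by simp) _ _).upd (by simp) _ _), by
      rw [upd_of_ne hip, upd_same], by rw [upd_same, pow_zero]⟩
  refine ⟨τ, (r1.seq (r2.seq hτ)).mono ?_, h1, h3⟩
  simp only [Finset.sum_const, Finset.card_range, smul_eq_mul]
  have : k + 2 + 1 = k + 3 := rfl
  rw [this]; omega

/-- A loop over `s = 0, 1, …` below a bound. -/
def forRange (s : ℕ) (bound : Tm) (body : Program) : Program :=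
  .seq (set s (lit 0) (lit 0)) (.loop (bin lt (sc s) bound).toExpr
      (.seq body (set s (lit 0) (bin add (sc s) (lit 1)))))

def chkRange (s : ℕ) (bound : Tm) : Bool :=
  chkSet s (lit 0) (lit 0) && ((bin lt (sc s) bound).chk &&
    chkSet s (lit 0) (bin add (sc s) (lit 1)))

theorem run_forRange {s : ℕ} {bound : Tm} {body : Program} (hc : chkRange s bound = true)
    (hs : 0 ∈ E.dom s) (B : ℕ) (hB : B < 2 ^ E.b) (I : ℕ → Store → Prop) (k : ℕ)
    (hbound : ∀ j σ, I j σ → bound.ev E.n σ = B)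
    (step : ∀ j < B, ∀ σ, I j σ → σ s 0 = j →
      ∃ τ, E.Run body σ τ k ∧ τ s 0 = j ∧ ∀ υ, Agree {s} τ υ → I (j + 1) υ)
    (σ : Store) (h0 : ∀ υ, Agree {s} σ υ → I 0 υ) :
    ∃ τ, E.Run (forRange s bound body) σ τ (B * (k + 2) + 2) ∧ I B τ := by
  simp only [chkRange, Bool.and_eq_true] at hc
  obtain ⟨c1, c2, c3⟩ := hc
  have r1 := run_set (σ := σ) c1 hs (by simp [ev])
  simp only [ev] at r1
  obtain ⟨τ, hτ, h1, h2⟩ := run_iter (E := E) (body := .seq body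
      (set s (lit 0) (bin add (sc s) (lit 1)))) c2 B
    (fun j σ => I j σ ∧ σ s 0 = j) (fun _ => k + 1)
    (by
      rintro j hj σ ⟨h1, h2⟩
      refine ⟨by simp [ev, sc, BinOp.apply, h2, hj, hbound j σ h1], ?_⟩
      obtain ⟨τ, hr, g1, g3⟩ := step j hj σ h1 h2
      have r3 := run_set (σ := τ) c3 hs (by
        simp only [ev, sc, BinOp.apply, g1]
        omega)
      simp only [ev, sc, BinOp.apply, g1] at r3
      exact ⟨_, hr.seq r3, g3 _ ((Agree.refl _ _).upd (by simp) _ _), by rw [upd_same]⟩)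
    (by
      rintro σ ⟨h', h⟩
      simp [ev, sc, BinOp.apply, h, hbound B σ h']) (upd σ s 0 0)
    ⟨h0 _ ((Agree.refl _ _).upd (by simp) _ _), by rw [upd_same]⟩
  refine ⟨τ, (r1.seq hτ).mono ?_, h1⟩
  simp only [Finset.sum_const, Finset.card_range, smul_eq_mul]
  have : k + 1 + 1 = k + 2 := rfl
  rw [this]; omega

/-- A loop over the submasks `v` of `S`, in descending order. -/
def forSub (v u m : ℕ) (S : Tm) (body : Program) : Program :=
  .seq (set m (lit 0) S) (.seq (set u (lit 0) (bin add (sc m) (lit 1)))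
    (.loop (sc u).toExpr (.seq (set v (lit 0) (bin sub (sc u) (lit 1))) (.seq body
      (.cond (sc v).toExpr
        (set u (lit 0) (bin add (bin land (bin sub (sc v) (lit 1)) (sc m)) (lit 1)))
        (set u (lit 0) (lit 0)))))))

def chkSub (v u m : ℕ) (S : Tm) : Bool :=
  chkSet m (lit 0) S && (chkSet u (lit 0) (bin add (sc m) (lit 1)) && ((sc u).chk &&
    (chkSet v (lit 0) (bin sub (sc u) (lit 1)) && ((sc v).chk &&
      (chkSet u (lit 0) (bin add (bin land (bin sub (sc v) (lit 1)) (sc m)) (lit 1)) &&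
        chkSet u (lit 0) (lit 0))))))

/-- The cell `u` holds the next submask plus one, so that 0 can signal the end although 0 is itself
a submask. The invariant is indexed by the set of submasks already treated; when `s` is reached
these are exactly the larger ones. Later proofs depend on this descending order. -/
theorem run_forSub {v u m : ℕ} {S : Tm} {body : Program} (hc : chkSub v u m S = true)
    (hvm : v ≠ m) (hum : u ≠ m)
    (hv : 0 ∈ E.dom v) (hu : 0 ∈ E.dom u) (hm : 0 ∈ E.dom m) (s₀ : ℕ)
    (hs₀ : s₀ + 1 < 2 ^ E.b) (Q : Finset ℕ → Store → Prop) (k : ℕ → ℕ) (σ : Store)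
    (hS : S.ev E.n σ = s₀)
    (step : ∀ s ∈ subs s₀, ∀ σ, Q ((subs s₀).filter (s < ·)) σ → σ v 0 = s → σ m 0 = s₀ →
      ∃ τ, E.Run body σ τ (k s) ∧ τ v 0 = s ∧ τ m 0 = s₀ ∧
        ∀ υ, Agree {v, u} τ υ → Q (insert s ((subs s₀).filter (s < ·))) υ)
    (h0 : ∀ υ, Agree {v, u, m} σ υ → Q ∅ υ)
    (hQ : ∀ D τ υ, Q D τ → Agree {v, u} τ υ → Q D υ) :
    ∃ τ, E.Run (forSub v u m S body) σ τ (∑ s ∈ subs s₀, (k s + 4) + 3) ∧ Q (subs s₀) τ := by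
  simp only [chkSub, Bool.and_eq_true] at hc
  obtain ⟨c1, c2, c3, c4, c5, c6, c7⟩ := hc
  have r1 := run_set (σ := σ) c1 hm (by rw [hS]; omega)
  simp only [ev, hS] at r1
  have r2 := run_set (σ := upd σ m 0 s₀) c2 hu (by simpa [ev, sc, BinOp.apply] using hs₀)
  simp only [ev, sc, BinOp.apply, upd_same] at r2
  -- Here `t` is the content of `u`: the submasks not below `t` are done, and the cost of those
  -- below `t` remains to be paid.
  have key : ∀ t, (t = 0 ∨ t - 1 ∈ subs s₀) → ∀ σ, Q ((subs s₀).filter (t ≤ ·)) σ →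
      σ u 0 = t → σ m 0 = s₀ →
      ∃ τ, E.Run (.loop (sc u).toExpr (.seq (set v (lit 0) (bin sub (sc u) (lit 1))) (.seq body
        (.cond (sc v).toExpr
          (set u (lit 0) (bin add (bin land (bin sub (sc v) (lit 1)) (sc m)) (lit 1)))
          (set u (lit 0) (lit 0))))))
        σ τ (∑ s ∈ (subs s₀).filter (· < t), (k s + 4) + 1) ∧ Q (subs s₀) τ := by
    intro t
    induction t using Nat.strong_induction_on with
    | _ t ih =>
      intro ht σ hq hut hms
      rcases Nat.eq_zero_or_pos t with rfl | hpos
      · refine ⟨σ, ?_, ?_⟩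
        · simpa using run_loop_stop c3 (by simpa [ev, sc] using hut)
        · simpa using hq
      · replace ht : t - 1 ∈ subs s₀ := ht.resolve_left (by omega)
        have hle := le_of_mem_subs ht
        have r3 := run_set (σ := σ) c4 hv (by
          simp only [ev, sc, BinOp.apply, hut]; omega)
        simp only [ev, sc, BinOp.apply, hut] at r3
        have hfil : (subs s₀).filter (t ≤ ·) = (subs s₀).filter (t - 1 < ·) :=
          Finset.filter_congr fun x _ => by omega
        rw [hfil] at hq
        obtain ⟨τ, hr, g1, g2, g3⟩ := step (t - 1) ht (upd σ v 0 (t - 1))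
          (hQ _ _ _ hq ((Agree.refl _ _).upd (by simp) _ _)) (upd_same _ _ _ _)
          (by rw [upd_of_ne hvm.symm, hms])
        have hins : ∀ t' ≤ t - 1, (∀ x ∈ subs s₀, x < t - 1 → x < t') →
            insert (t - 1) ((subs s₀).filter (t - 1 < ·)) = (subs s₀).filter (t' ≤ ·) := by
          intro t' ht' hx
          ext x
          simp only [Finset.mem_insert, Finset.mem_filter]
          constructor
          · rintro (rfl | ⟨h1, h2⟩)
            · exact ⟨ht, ht'⟩
            · exact ⟨h1, by omega⟩
          · rintro ⟨h1, h2⟩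
            by_contra hcon
            push Not at hcon
            have := hx x h1 (by have := hcon.2 h1; omega)
            omega
        have hsum : ∀ t' ≤ t - 1, (∀ x ∈ subs s₀, x < t - 1 → x < t') →
            ∑ s ∈ (subs s₀).filter (· < t), (k s + 4) =
            (k (t - 1) + 4) + ∑ s ∈ (subs s₀).filter (· < t'), (k s + 4) := by
          intro t' ht' hx
          rw [← Finset.sum_insert (f := fun s => k s + 4) (a := t - 1)
            (s := (subs s₀).filter (· < t'))
            (fun h => by have := (Finset.mem_filter.1 h).2; omega)]
          refine Finset.sum_congr ?_ fun _ _ => rfl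
          ext x
          simp only [Finset.mem_insert, Finset.mem_filter]
          constructor
          · rintro ⟨h1, h2⟩
            rcases Nat.lt_or_ge x (t - 1) with h | h
            · exact .inr ⟨h1, hx x h1 h⟩
            · exact .inl (by omega)
          · rintro (rfl | ⟨h1, h2⟩)
            · exact ⟨ht, by omega⟩
            · exact ⟨h1, by omega⟩
        by_cases hz : t - 1 = 0
        · have r4 := run_set (σ := τ) c7 hu (by simp [ev])
          simp only [ev] at r4
          have r5 := run_ite (p := (set u (lit 0) (bin add (bin land (bin sub (sc v) (lit 1))
            (sc m)) (lit 1)))) c5 (fun h => absurd (show (sc v).ev E.n τ = 0 by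
              simp only [ev, sc, g1, hz]) h) (fun _ => r4)
          obtain ⟨υ, hr', hυ⟩ := ih 0 hpos (.inl rfl) (upd τ u 0 0)
            (hins 0 (by omega) (fun x _ h => by omega) ▸ g3 _ ((Agree.refl _ _).upd (by simp) _ _))
            (upd_same _ _ _ _) (by rw [upd_of_ne hum.symm, g2])
          refine ⟨υ, (run_loop_step c3 (by simp only [ev, sc]; omega)
            (r3.seq (hr.seq r5)) hr').mono ?_, hυ⟩
          rw [hsum 0 (by omega) (fun x _ h => by omega)]
          omega
        · have hlt : (t - 1 - 1) &&& s₀ ≤ t - 1 - 1 := Nat.and_le_left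
          have r4 := run_set (σ := τ) c6 hu (by
            simp only [ev, sc, BinOp.apply, g1, g2]; omega)
          simp only [ev, sc, BinOp.apply, g1, g2] at r4
          have r5 := run_ite (q := set u (lit 0) (lit 0)) c5 (fun _ => r4)
            (fun h => absurd h (by simpa only [ev, sc, g1] using hz))
          have hx : ∀ x ∈ subs s₀, x < t - 1 → x < ((t - 1 - 1) &&& s₀) + 1 := fun x h1 h2 => by
            have := le_pred_and ht h1 h2; omega
          obtain ⟨υ, hr', hυ⟩ := ih (((t - 1 - 1) &&& s₀) + 1) (by omega)
            (.inr (by rw [Nat.add_sub_cancel]; exact pred_and_mem_subs _ _))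
            (upd τ u 0 (((t - 1 - 1) &&& s₀) + 1))
            (hins _ (by omega) hx ▸ g3 _ ((Agree.refl _ _).upd (by simp) _ _))
            (upd_same _ _ _ _) (by rw [upd_of_ne hum.symm, g2])
          refine ⟨υ, (run_loop_step c3 (by simp only [ev, sc]; omega)
            (r3.seq (hr.seq r5)) hr').mono ?_, hυ⟩
          rw [hsum _ (by omega) hx]
          omega
  obtain ⟨τ, hr, hτ⟩ := key (s₀ + 1) (.inr (self_mem_subs _)) (upd (upd σ m 0 s₀) u 0 (s₀ + 1))
    (by
      have : (subs s₀).filter (s₀ + 1 ≤ ·) = ∅ := Finset.filter_eq_empty_iff.2 fun x hx => by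
        have := le_of_mem_subs hx; omega
      rw [this]
      exact h0 _ (((Agree.refl _ _).upd (by simp) _ _).upd (by simp) _ _))
    (upd_same _ _ _ _) (by rw [upd_of_ne hum.symm, upd_same])
  refine ⟨τ, (r1.seq (r2.seq hr)).mono ?_, hτ⟩
  rw [Finset.filter_true_of_mem fun x hx => by have := le_of_mem_subs hx; omega]
  omega

end Env
end RAM

namespace RAM

open BooleanWidth

/-! ### Unions of neighborhoods as bitsets -/

/-- The bitset of all `j < n` with `P j`. -/
noncomputable def mask (n : ℕ) (P : ℕ → Prop) : ℕ :=
  haveI := Classical.decPred P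
  ∑ j ∈ (Finset.range n).filter P, 2 ^ j

theorem testBit_mask {n : ℕ} {P : ℕ → Prop} {j : ℕ} :
    (mask n P).testBit j = true ↔ j < n ∧ P j := by
  rw [mask, testBit_sum_two_pow, @Finset.mem_filter _ _ (Classical.decPred P), Finset.mem_range]

variable {n : ℕ} (G : SimpleGraph (Fin n))

/-- Adjacency of numbers. -/
def adj (i j : ℕ) : Prop := ∃ (hi : i < n) (hj : j < n), G.Adj ⟨i, hi⟩ ⟨j, hj⟩

variable {G} in
theorem adj.symm {i j : ℕ} (h : adj G i j) : adj G j i := by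
  obtain ⟨hi, hj, h⟩ := h; exact ⟨hj, hi, h.symm⟩

theorem not_adj_self (i : ℕ) : ¬ adj G i i := fun ⟨_, _, h⟩ => G.loopless.irrefl _ h

/-- The neighborhood of a bitset. -/
noncomputable def nb (s : ℕ) : ℕ := mask n fun j => ∃ i, s.testBit i = true ∧ adj G i j

theorem testBit_nb {s j : ℕ} : (nb G s).testBit j = true ↔ ∃ i, s.testBit i = true ∧ adj G i j := by
  rw [nb, testBit_mask, and_iff_right_iff_imp]
  rintro ⟨i, -, -, h, -⟩
  exact h

/-- Difference of bitsets. -/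
def dif (s t : ℕ) : ℕ := s - (s &&& t)

theorem testBit_dif {s t i : ℕ} :
    (dif s t).testBit i = true ↔ s.testBit i = true ∧ ¬ t.testBit i = true := by
  rw [dif, testBit_sub_and]; simp

theorem testBit_lor {s t i : ℕ} :
    (s ||| t).testBit i = true ↔ s.testBit i = true ∨ t.testBit i = true := by
  rw [Nat.testBit_or, Bool.or_eq_true]

theorem testBit_land {s t i : ℕ} :
    (s &&& t).testBit i = true ↔ s.testBit i = true ∧ t.testBit i = true := by
  rw [Nat.testBit_and, Bool.and_eq_true]

theorem eq_zero_iff {s : ℕ} : s = 0 ↔ ∀ i, ¬ s.testBit i = true := by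
  constructor
  · rintro rfl i; simp
  · intro h; exact testBit_ext fun i => by simp [h i]

theorem dif_eq_zero {s t : ℕ} : dif s t = 0 ↔ s ∈ subs t := by
  rw [eq_zero_iff, mem_subs_iff]
  simp only [testBit_dif, not_and, not_not]

/-- The set of vertices of a bitset. -/
def vset (n : ℕ) (s : ℕ) : Set (Fin n) := {i | s.testBit i = true}

theorem mem_vset {s : ℕ} {i : Fin n} : i ∈ vset n s ↔ s.testBit i = true := Iff.rfl

theorem nbhd_vset (s : ℕ) : nbhd G (vset n s) = vset n (nb G s) := by
  ext j
  simp only [nbhd, Set.mem_iUnion, SimpleGraph.mem_neighborSet, mem_vset, exists_prop, testBit_nb]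
  constructor
  · rintro ⟨i, hi, h⟩; exact ⟨i, hi, i.2, j.2, h⟩
  · rintro ⟨i, hi, h1, h2, h⟩; exact ⟨⟨i, h1⟩, hi, h⟩

/-- The number of unions of neighborhoods across the cut given by a bitset. -/
noncomputable def un (s : ℕ) : ℕ := (UN G (vset n s)).ncard

theorem un_le (s : ℕ) : un G s ≤ 2 ^ n := by
  unfold un
  calc _ ≤ (Set.univ : Set (Set (Fin n))).ncard := Set.ncard_le_ncard (Set.subset_univ _)
    _ = _ := by rw [Set.ncard_univ, Nat.card_eq_fintype_card, Fintype.card_set, Fintype.card_fin]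

/-- The map `S ↦ N(Aᶜ \ S) ∩ A` is injective on `UN G A`. Removing its value from `A` leaves the
largest `X ⊆ A` whose neighborhood outside `A` lies in `S`, and this `X` generates `S` again. -/
theorem ncard_UN_le_compl {V : Type*} [Finite V] (G : SimpleGraph V) (A : Set V) :
    (UN G A).ncard ≤ (UN G Aᶜ).ncard := by
  refine Set.ncard_le_ncard_of_injOn (fun S => nbhd G (Aᶜ \ S) ∩ A) ?_ ?_
  · intro S _
    exact ⟨Aᶜ \ S, Set.sdiff_subset, by rw [compl_compl]⟩
  · have key : ∀ S ∈ UN G A, S = nbhd G (A \ (nbhd G (Aᶜ \ S) ∩ A)) ∩ Aᶜ := by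
      rintro S ⟨X, hX, rfl⟩
      ext j
      simp only [nbhd, Set.mem_inter_iff, Set.mem_iUnion, SimpleGraph.mem_neighborSet, exists_prop,
        Set.mem_sdiff, Set.mem_compl_iff, not_and, not_not]
      constructor
      · rintro ⟨⟨i, hi, h⟩, hj⟩
        refine ⟨⟨i, ⟨hX hi, ?_⟩, h⟩, hj⟩
        rintro ⟨k, ⟨hk, hk'⟩, hki⟩
        exact fun _ => hk (hk' ⟨i, hi, hki.symm⟩)
      · rintro ⟨⟨i, ⟨hi, hi'⟩, h⟩, hj⟩
        refine ⟨?_, hj⟩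
        by_contra hcon
        exact hi' ⟨j, ⟨hj, fun ⟨k, hk⟩ => absurd ⟨k, hk⟩ hcon⟩, h.symm⟩ hi
    intro S hS S' hS' h
    simp only at h
    rw [key S hS, key S' hS', h]

theorem un_dif_full (s : ℕ) : un G (dif (2 ^ n - 1) s) = un G s := by
  have h : vset n (dif (2 ^ n - 1) s) = (vset n s)ᶜ := by
    ext i
    simp [mem_vset, testBit_dif]
  unfold un
  rw [h]
  refine le_antisymm ?_ (ncard_UN_le_compl G _)
  conv_rhs => rw [← compl_compl (vset n s)]
  exact ncard_UN_le_compl G _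

/-! ### Counting unions of neighborhoods by partial labellings

The vertices are split into `W` and `H`, and `A` is the part of the left side of a cut in `H`. The
labelling is given by the vertices `R` of `W` on the right side outside the union, the
vertices `X` of `W` on the left side not adjacent to the complement of the union, and the
set `Y` of vertices of the latter kind in `H` that have neighbors in `H` on the right side. -/

/-- The vertices on the left side with neighbors in `H` on the right side. -/
noncomputable def act (H A : ℕ) : ℕ := A &&& nb G (dif H A)

/-- The part of x in `H`. A vertex of `A` outside `act` has no neighbor in `H` on the right side, so
only `R` can exclude it from x. -/
noncomputable def xH (H A R Y : ℕ) : ℕ := Y ||| dif (dif A (act G H A)) (nb G R)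

noncomputable def xT (H A R X Y : ℕ) : ℕ := X ||| xH G H A R Y

/-- The whole right half r of the closed pair, just as `xT` is the left half: within `H`, r is
forced to be everything on the right that is not adjacent to x. -/
noncomputable def rT (H A R X Y : ℕ) : ℕ := R ||| dif (dif H A) (nb G (xT G H A R X Y))

/-- The vertices of `W` that have to be on the left side. -/
noncomputable def lo (W H A R X Y : ℕ) : ℕ := X ||| dif (dif W (R ||| X)) (nb G (xT G H A R X Y))

/-- The vertices of `W` that may be on the left side. -/
noncomputable def hi (W H A R X Y : ℕ) : ℕ := X ||| (dif W (R ||| X) &&& nb G (rT G H A R X Y))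

/-- The closure conditions that do not involve `B`: no vertex of `R` is adjacent to x, each vertex
of `A` left out of x is adjacent to r, and the interval for `B` is nonempty. -/
def Valid (W H A R X Y : ℕ) : Prop :=
  R &&& nb G (xT G H A R X Y) = 0 ∧
    dif (dif A (xH G H A R Y)) (nb G (rT G H A R X Y)) = 0 ∧
    dif (lo G W H A R X Y) (hi G W H A R X Y) = 0

/-- The possible choices of `X`. -/
noncomputable def free (W R : ℕ) : ℕ := dif W (R ||| nb G R)

/-- A label that describes a closed pair for the cut with left side `A ∪ B`. The choice of `B`
enters only through the two interval conditions. -/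
structure Match (W H A B R X Y : ℕ) : Prop where
  hR : R ∈ subs W
  hX : X ∈ subs (free G W R)
  hY : Y ∈ subs (act G H A)
  valid : Valid G W H A R X Y
  lo : lo G W H A R X Y ∈ subs B
  hi : B ∈ subs (hi G W H A R X Y)

section

variable {G} {W H A B : ℕ} (hW : W < 2 ^ n) (hH : H = dif (2 ^ n - 1) W) (hA : A ∈ subs H)
  (hB : B ∈ subs W)

include hW hH hA hB in
-- A label decodes to a closed pair and can be read off from it again. On `W`, the lower bound on
-- `B` says that right vertices not adjacent to x are in r, and the upper bound that left vertices
-- not adjacent to r are in x.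
theorem Match.spec {R X Y : ℕ} (h : Match G W H A B R X Y) :
    (∀ i, (xT G H A R X Y).testBit i = true ↔ (A ||| B).testBit i = true ∧
      ¬ (nb G (rT G H A R X Y)).testBit i = true) ∧
    (∀ i, (rT G H A R X Y).testBit i = true ↔ i < n ∧ ¬ (A ||| B).testBit i = true ∧
      ¬ (nb G (xT G H A R X Y)).testBit i = true) ∧
    R = rT G H A R X Y &&& W ∧ X = xT G H A R X Y &&& W ∧ Y = xT G H A R X Y &&& act G H A := by
  obtain ⟨hR, hX, hY, ⟨v1, v2, -⟩, hlo, hhi⟩ := h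
  set x := xT G H A R X Y with hx
  set r := rT G H A R X Y with hr
  have hx' : ∀ i, x.testBit i = true ↔ X.testBit i = true ∨ (xH G H A R Y).testBit i = true :=
    fun i => by rw [hx, xT, testBit_lor]
  have hr' : ∀ i, r.testBit i = true ↔ R.testBit i = true ∨
      ((H.testBit i = true ∧ ¬ A.testBit i = true) ∧ ¬ (nb G x).testBit i = true) :=
    fun i => by rw [hr, rT, testBit_lor, testBit_dif, testBit_dif]
  have hxH : ∀ i, (xH G H A R Y).testBit i = true ↔ Y.testBit i = true ∨
      ((A.testBit i = true ∧ ¬ (act G H A).testBit i = true) ∧ ¬ (nb G R).testBit i = true) :=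
    fun i => by rw [xH, testBit_lor, testBit_dif, testBit_dif]
  have hact : ∀ i, (act G H A).testBit i = true ↔ A.testBit i = true ∧
      (nb G (dif H A)).testBit i = true := fun i => by rw [act, testBit_land]
  have hlo' : ∀ i, X.testBit i = true ∨ ((W.testBit i = true ∧ ¬ (R.testBit i = true ∨
      X.testBit i = true)) ∧ ¬ (nb G x).testBit i = true) → B.testBit i = true := fun i h => by
    refine mem_subs_iff.1 hlo i ?_
    rwa [RAM.lo, testBit_lor, testBit_dif, testBit_dif, testBit_lor]
  have hhi' : ∀ i, B.testBit i = true → X.testBit i = true ∨ ((W.testBit i = true ∧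
      ¬ (R.testBit i = true ∨ X.testBit i = true)) ∧ (nb G r).testBit i = true) := fun i h => by
    have := mem_subs_iff.1 hhi i h
    rwa [RAM.hi, testBit_lor, testBit_land, testBit_dif, testBit_lor] at this
  have hX' : ∀ i, X.testBit i = true → W.testBit i = true ∧ ¬ (R.testBit i = true ∨
      (nb G R).testBit i = true) := fun i h => by
    have := mem_subs_iff.1 hX i h
    rwa [free, testBit_dif, testBit_lor] at this
  have hR' := mem_subs_iff.1 hR
  have hY' := mem_subs_iff.1 hY
  have hA' := mem_subs_iff.1 hA
  have hB' := mem_subs_iff.1 hB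
  have hH' : ∀ i, H.testBit i = true ↔ i < n ∧ ¬ W.testBit i = true := fun i => by
    rw [hH, testBit_dif, testBit_full]
  have v1' : ∀ i, R.testBit i = true → ¬ (nb G x).testBit i = true := fun i h h' =>
    (eq_zero_iff.1 v1 i) (testBit_land.2 ⟨h, h'⟩)
  have v2' : ∀ i, A.testBit i = true → ¬ (xH G H A R Y).testBit i = true →
      (nb G r).testBit i = true := fun i h h' =>
    mem_subs_iff.1 (dif_eq_zero.1 v2) i (testBit_dif.2 ⟨h, h'⟩)
  have hxHA : ∀ i, (xH G H A R Y).testBit i = true → A.testBit i = true := fun i h => by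
    rcases (hxH i).1 h with h | h
    · exact ((hact i).1 (hY' i h)).1
    · exact h.1.1
  -- no edge between x and r
  have hxr : ∀ i, x.testBit i = true → ¬ (nb G r).testBit i = true := by
    intro i hi hn
    obtain ⟨j, hj, hadj⟩ := (testBit_nb G).1 hn
    have : ¬ (nb G x).testBit j = true := by
      rcases (hr' j).1 hj with h | h
      · exact v1' j h
      · exact h.2
    exact this ((testBit_nb G).2 ⟨i, hi, hadj.symm⟩)
  have c1 : ∀ i, x.testBit i = true ↔ (A ||| B).testBit i = true ∧ ¬ (nb G r).testBit i = true := by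
    intro i
    rw [testBit_lor]
    constructor
    · intro hi
      refine ⟨?_, hxr i hi⟩
      rcases (hx' i).1 hi with h | h
      · exact .inr (hlo' i (.inl h))
      · exact .inl (hxHA i h)
    · rintro ⟨h1 | h1, h2⟩
      · by_contra hcon
        exact h2 (v2' i h1 fun h => hcon ((hx' i).2 (.inr h)))
      · rcases hhi' i h1 with h | h
        · exact (hx' i).2 (.inl h)
        · exact absurd h.2 h2
  have c2 : ∀ i, r.testBit i = true ↔ i < n ∧ ¬ (A ||| B).testBit i = true ∧
      ¬ (nb G x).testBit i = true := by
    intro i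
    rw [testBit_lor]
    constructor
    · intro hi
      rcases (hr' i).1 hi with h | h
      · have hw := hR' i h
        refine ⟨lt_two_pow_iff.1 hW i hw, ?_, v1' i h⟩
        · rintro (h' | h')
          · exact ((hH' i).1 (hA' i h')).2 hw
          · rcases hhi' i h' with h'' | h''
            · exact (hX' i h'').2 (.inl h)
            · exact h''.1.2 (.inl h)
      · refine ⟨((hH' i).1 h.1.1).1, ?_, h.2⟩
        rintro (h' | h')
        · exact h.1.2 h'
        · exact ((hH' i).1 h.1.1).2 (hB' i h')
    · rintro ⟨h1, h2, h3⟩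
      push Not at h2
      by_cases hw : W.testBit i = true
      · by_contra hcon
        refine h2.2 (hlo' i (.inr ⟨⟨hw, ?_⟩, h3⟩))
        rintro (h | h)
        · exact hcon ((hr' i).2 (.inl h))
        · exact h2.2 (hlo' i (.inl h))
      · exact (hr' i).2 (.inr ⟨⟨(hH' i).2 ⟨h1, hw⟩, h2.1⟩, h3⟩)
  refine ⟨c1, c2, testBit_ext fun i => ?_, testBit_ext fun i => ?_, testBit_ext fun i => ?_⟩
  · rw [testBit_land, hr']
    constructor
    · intro h; exact ⟨.inl h, hR' i h⟩
    · rintro ⟨h | h, hw⟩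
      · exact h
      · exact absurd hw ((hH' i).1 h.1.1).2
  · rw [testBit_land, hx']
    constructor
    · intro h; exact ⟨.inl h, (hX' i h).1⟩
    · rintro ⟨h | h, hw⟩
      · exact h
      · exact absurd hw ((hH' i).1 (hA' i (hxHA i h))).2
  · rw [testBit_land, hx']
    constructor
    · intro h; exact ⟨.inr ((hxH i).2 (.inl h)), hY' i h⟩
    · rintro ⟨h | h, hw⟩
      · exact absurd (hX' i h).1 ((hH' i).1 (hA' i ((hact i).1 hw).1)).2
      · rcases (hxH i).1 h with h | h
        · exact h
        · exact absurd hw h.1.2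

theorem mem_UN_iff {C : ℕ} {S : Set (Fin n)} :
    S ∈ UN G (vset n C) ↔ ∃ x ∈ subs C, S = vset n (dif (nb G x) C) := by
  have h1 : ∀ x, vset n (dif (nb G x) C) = nbhd G (vset n x) ∩ (vset n C)ᶜ := fun x => by
    rw [nbhd_vset]
    ext i
    simp only [mem_vset, testBit_dif, Set.mem_inter_iff, Set.mem_compl_iff]
  constructor
  · rintro ⟨X, hX, rfl⟩
    have h2 : vset n (mask n fun j => ∃ h : j < n, (⟨j, h⟩ : Fin n) ∈ X) = X := by
      ext i
      rw [mem_vset, testBit_mask]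
      simp
    refine ⟨mask n fun j => ∃ h : j < n, (⟨j, h⟩ : Fin n) ∈ X, ?_, ?_⟩
    · rw [mem_subs_iff]
      intro i hi
      obtain ⟨-, hi, h⟩ := testBit_mask.1 hi
      exact hX h
    · rw [h1, h2]
  · rintro ⟨x, hx, rfl⟩
    exact ⟨vset n x, fun i hi => mem_subs_iff.1 hx i hi, h1 x⟩

theorem vset_inj {s t : ℕ} (hs : s < 2 ^ n) (ht : t < 2 ^ n) (h : vset n s = vset n t) : s = t := by
  refine testBit_ext fun i => ?_
  by_cases hi : i < n
  · exact Set.ext_iff.1 h ⟨i, hi⟩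
  · exact ⟨fun h => absurd (lt_two_pow_iff.1 hs i h) hi, fun h => absurd (lt_two_pow_iff.1 ht i h) hi⟩

theorem nb_lt (s : ℕ) : nb G s < 2 ^ n := by
  rw [lt_two_pow_iff]
  intro i h
  obtain ⟨j, -, -, h, -⟩ := (testBit_nb G).1 h
  exact h

include hW hH hA hB in
-- Closing x gives a pair `(t, r)` with the same union: r is the right side without N(x), and t the
-- left side without N(r). Its restrictions to `W` and to the active vertices are the label.
theorem exists_match {x : ℕ} (hx : x ∈ subs (A ||| B)) : ∃ R X Y, Match G W H A B R X Y ∧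
    dif (nb G (xT G H A R X Y)) (A ||| B) = dif (nb G x) (A ||| B) := by
  set C := A ||| B
  set r := dif (dif (2 ^ n - 1) C) (nb G x) with hr
  set t := dif C (nb G r) with ht
  have hCb : ∀ i, C.testBit i = true ↔ A.testBit i = true ∨ B.testBit i = true := fun i =>
    testBit_lor
  have hA' := mem_subs_iff.1 hA
  have hB' := mem_subs_iff.1 hB
  have hx' := mem_subs_iff.1 hx
  have hWn := lt_two_pow_iff.1 hW
  have hH' : ∀ i, H.testBit i = true ↔ i < n ∧ ¬ W.testBit i = true := fun i => by
    rw [hH, testBit_dif, testBit_full]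
  have hrb : ∀ i, r.testBit i = true ↔ (i < n ∧ ¬ C.testBit i = true) ∧
      ¬ (nb G x).testBit i = true := fun i => by rw [hr, testBit_dif, testBit_dif, testBit_full]
  have htb : ∀ i, t.testBit i = true ↔ C.testBit i = true ∧ ¬ (nb G r).testBit i = true :=
    fun i => by rw [ht, testBit_dif]
  clear_value t r C
  have hrt : ∀ i j, r.testBit i = true → t.testBit j = true → ¬ adj G i j := fun i j hi hj h =>
    ((htb j).1 hj).2 ((testBit_nb G).2 ⟨i, hi, h⟩)
  have hxt : ∀ i, x.testBit i = true → t.testBit i = true := fun i hi => by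
    refine (htb i).2 ⟨hx' i hi, fun h => ?_⟩
    obtain ⟨j, hj, h⟩ := (testBit_nb G).1 h
    exact ((hrb j).1 hj).2 ((testBit_nb G).2 ⟨i, hi, h.symm⟩)
  -- Passing from `x` to the larger `t` does not change the union: on the right side, N(t) is the
  -- complement of `r`, and so is N(x).
  have hnr : ∀ i, ¬ C.testBit i = true → i < n → ((nb G t).testBit i = true ↔ ¬ r.testBit i = true) := by
    intro i h1 h2
    constructor
    · intro h h3
      obtain ⟨j, hj, h⟩ := (testBit_nb G).1 h
      exact hrt i j h3 hj h.symm
    · intro h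
      have : (nb G x).testBit i = true := by
        by_contra h3
        exact h ((hrb i).2 ⟨⟨h2, h1⟩, h3⟩)
      obtain ⟨j, hj, h⟩ := (testBit_nb G).1 this
      exact (testBit_nb G).2 ⟨j, hxt j hj, h⟩
  have hact : ∀ i, (act G H A).testBit i = true ↔ A.testBit i = true ∧
      (nb G (dif H A)).testBit i = true := fun i => by rw [act, testBit_land]
  have hAC : ∀ i, A.testBit i = true ↔ C.testBit i = true ∧ ¬ W.testBit i = true := fun i => by
    rw [hCb]
    exact ⟨fun h => ⟨.inl h, ((hH' i).1 (hA' i h)).2⟩, fun h => h.1.resolve_right fun h' =>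
      h.2 (hB' i h')⟩
  have hBC : ∀ i, B.testBit i = true ↔ C.testBit i = true ∧ W.testBit i = true := fun i => by
    rw [hCb]
    exact ⟨fun h => ⟨.inr h, hB' i h⟩, fun h => h.1.resolve_left fun h' =>
      ((hH' i).1 (hA' i h')).2 h.2⟩
  -- the three parts of the labelling
  have eH : ∀ i, (xH G H A (r &&& W) (t &&& act G H A)).testBit i = true ↔
      t.testBit i = true ∧ A.testBit i = true := by
    intro i
    rw [xH, testBit_lor, testBit_land, testBit_dif, testBit_dif]
    constructor
    · rintro (h | ⟨⟨h1, h2⟩, h3⟩)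
      · exact ⟨h.1, ((hact i).1 h.2).1⟩
      · refine ⟨(htb i).2 ⟨(hAC i).1 h1 |>.1, fun h => ?_⟩, h1⟩
        obtain ⟨j, hj, h⟩ := (testBit_nb G).1 h
        by_cases hj' : W.testBit j = true
        · exact h3 ((testBit_nb G).2 ⟨j, testBit_land.2 ⟨hj, hj'⟩, h⟩)
        · refine h2 ((hact i).2 ⟨h1, (testBit_nb G).2 ⟨j, testBit_dif.2 ⟨(hH' j).2 ⟨?_, hj'⟩, ?_⟩, h⟩⟩)
          · exact ((hrb j).1 hj).1.1
          · intro h'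
            exact ((hrb j).1 hj).1.2 ((hAC j).1 h').1
    · rintro ⟨h1, h2⟩
      by_cases h : (act G H A).testBit i = true
      · exact .inl ⟨h1, h⟩
      · refine .inr ⟨⟨h2, h⟩, fun h3 => ?_⟩
        obtain ⟨j, hj, h3⟩ := (testBit_nb G).1 h3
        exact hrt j i (testBit_land.1 hj).1 h1 h3
  have eT : xT G H A (r &&& W) (t &&& W) (t &&& act G H A) = t := testBit_ext fun i => by
    rw [xT, testBit_lor, eH, testBit_land]
    constructor
    · rintro (h | h)
      · exact h.1
      · exact h.1
    · intro h
      by_cases hw : W.testBit i = true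
      · exact .inl ⟨h, hw⟩
      · exact .inr ⟨h, (hAC i).2 ⟨((htb i).1 h).1, hw⟩⟩
  have eR : rT G H A (r &&& W) (t &&& W) (t &&& act G H A) = r := testBit_ext fun i => by
    rw [rT, eT, testBit_lor, testBit_land, testBit_dif, testBit_dif]
    constructor
    · rintro (h | ⟨⟨h1, h2⟩, h3⟩)
      · exact h.1
      · have hC' : ¬ C.testBit i = true := fun h => h2 ((hAC i).2 ⟨h, ((hH' i).1 h1).2⟩)
        by_contra h
        exact h3 ((hnr i hC' ((hH' i).1 h1).1).2 h)
    · intro h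
      have h' := (hrb i).1 h
      by_cases hw : W.testBit i = true
      · exact .inl ⟨h, hw⟩
      · exact .inr ⟨⟨(hH' i).2 ⟨h'.1.1, hw⟩, fun h2 => h'.1.2 ((hAC i).1 h2).1⟩,
          fun h3 => ((hnr i h'.1.2 h'.1.1).1 h3) h⟩
  have eL : ∀ i, (lo G W H A (r &&& W) (t &&& W) (t &&& act G H A)).testBit i = true →
      B.testBit i = true := by
    intro i
    rw [lo, eT, testBit_lor, testBit_land, testBit_dif, testBit_dif, testBit_lor, testBit_land,
      testBit_land, hBC]
    rintro (h | ⟨⟨h1, h2⟩, h3⟩)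
    · exact ⟨((htb i).1 h.1).1, h.2⟩
    · refine ⟨?_, h1⟩
      by_contra h
      exact h3 ((hnr i h (hWn i h1)).2 fun h4 => h2 (.inl ⟨h4, h1⟩))
  have eU : ∀ i, B.testBit i = true →
      (hi G W H A (r &&& W) (t &&& W) (t &&& act G H A)).testBit i = true := by
    intro i hi
    rw [hBC] at hi
    rw [RAM.hi, eR, testBit_lor, testBit_land, testBit_land, testBit_dif, testBit_lor, testBit_land,
      testBit_land]
    by_cases h : t.testBit i = true
    · exact .inl ⟨h, hi.2⟩
    · refine .inr ⟨⟨hi.2, ?_⟩, ?_⟩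
      · rintro (h' | h')
        · exact ((hrb i).1 h'.1).1.2 hi.1
        · exact h h'.1
      · by_contra h'
        exact h ((htb i).2 ⟨hi.1, h'⟩)
  refine ⟨r &&& W, t &&& W, t &&& act G H A, ⟨?_, ?_, ?_, ⟨?_, ?_, ?_⟩, ?_, ?_⟩, ?_⟩
  · exact mem_subs_iff.2 fun i h => (testBit_land.1 h).2
  · refine mem_subs_iff.2 fun i h => ?_
    rw [testBit_land] at h
    rw [free, testBit_dif, testBit_lor, testBit_land]
    refine ⟨h.2, ?_⟩
    rintro (h' | h')
    · exact ((hrb i).1 h'.1).1.2 ((htb i).1 h.1).1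
    · obtain ⟨j, hj, h'⟩ := (testBit_nb G).1 h'
      exact hrt j i (testBit_land.1 hj).1 h.1 h'
  · exact mem_subs_iff.2 fun i h => (testBit_land.1 h).2
  · rw [eT, eq_zero_iff]
    intro i h
    rw [testBit_land, testBit_land] at h
    obtain ⟨j, hj, h'⟩ := (testBit_nb G).1 h.2
    exact hrt i j h.1.1 hj h'.symm
  · rw [eR, dif_eq_zero, mem_subs_iff]
    intro i h
    rw [testBit_dif, eH] at h
    by_contra h'
    exact h.2 ⟨(htb i).2 ⟨((hAC i).1 h.1).1, h'⟩, h.1⟩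
  · rw [dif_eq_zero, mem_subs_iff]
    exact fun i h => eU i (eL i h)
  · exact mem_subs_iff.2 eL
  · exact mem_subs_iff.2 eU
  · rw [eT]
    refine testBit_ext fun i => ?_
    rw [testBit_dif, testBit_dif]
    refine and_congr_left fun h => ?_
    by_cases hi : i < n
    · rw [hnr i h hi, hrb]
      constructor
      · intro h'
        by_contra h2
        exact h' ⟨⟨hi, h⟩, h2⟩
      · exact fun h2 h' => h'.2 h2
    · exact ⟨fun h => absurd (lt_two_pow_iff.1 (nb_lt t) i h) hi,
        fun h => absurd (lt_two_pow_iff.1 (nb_lt x) i h) hi⟩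

-- Labels matching `B` correspond bijectively to unions across the cut. Surjectivity is
-- `exists_match`, injectivity comes from `Match.spec`. The right-hand side is one count for each
-- `B`, whereas the labels and their intervals depend on `A` only.
open Classical in
include hW hH hA hB in
theorem sum_match : ∑ R ∈ subs W, ∑ X ∈ subs (free G W R), ∑ Y ∈ subs (act G H A),
    (if Valid G W H A R X Y ∧ lo G W H A R X Y ∈ subs B ∧ B ∈ subs (hi G W H A R X Y) then 1 else 0)
      = un G (A ||| B) := by
  set T : Finset (Σ _ : ℕ, Σ _ : ℕ, ℕ) := (subs W).sigma fun R => (subs (free G W R)).sigma fun X =>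
    (subs (act G H A)).filter fun Y => Valid G W H A R X Y ∧ lo G W H A R X Y ∈ subs B ∧
      B ∈ subs (hi G W H A R X Y) with hT
  have hcard : T.card = ∑ R ∈ subs W, ∑ X ∈ subs (free G W R), ∑ Y ∈ subs (act G H A),
      (if Valid G W H A R X Y ∧ lo G W H A R X Y ∈ subs B ∧ B ∈ subs (hi G W H A R X Y)
        then 1 else 0) := by
    rw [hT, Finset.card_sigma]
    refine Finset.sum_congr rfl fun R _ => ?_
    rw [Finset.card_sigma]
    refine Finset.sum_congr rfl fun X _ => ?_
    rw [Finset.card_filter]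
  have hmem : ∀ t : Σ _ : ℕ, Σ _ : ℕ, ℕ, t ∈ T ↔ Match G W H A B t.1 t.2.1 t.2.2 := by
    intro t
    simp only [hT, Finset.mem_sigma, Finset.mem_filter]
    exact ⟨fun h => ⟨h.1, h.2.1, h.2.2.1, h.2.2.2.1, h.2.2.2.2.1, h.2.2.2.2.2⟩,
      fun h => ⟨h.1, h.2, h.3, h.4, h.5, h.6⟩⟩
  rw [← hcard, un, ← Set.ncard_coe_finset]
  have hlt : ∀ x, dif (nb G x) (A ||| B) < 2 ^ n := fun x => (Nat.sub_le _ _).trans_lt (nb_lt x)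
  refine Set.ncard_congr (fun t _ => vset n (dif (nb G (xT G H A t.1 t.2.1 t.2.2)) (A ||| B))) ?_ ?_ ?_
  · intro t ht
    have hs := ((hmem t).1 ht).spec hW hH hA hB
    exact mem_UN_iff.2 ⟨_, mem_subs_iff.2 fun i h => ((hs.1 i).1 h).1, rfl⟩
  -- The union determines r as the rest of the right side, r determines x, and both together
  -- determine the label.
  · rintro ⟨R, X, Y⟩ ⟨R', X', Y'⟩ ht ht' h
    have hs := ((hmem _).1 ht).spec hW hH hA hB
    have hs' := ((hmem _).1 ht').spec hW hH hA hB
    have h := vset_inj (hlt _) (hlt _) h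
    simp only at h hs hs'
    have hr : rT G H A R X Y = rT G H A R' X' Y' := testBit_ext fun i => by
      rw [hs.2.1, hs'.2.1]
      refine and_congr_right fun _ => and_congr_right fun hi => not_congr ?_
      have : (dif (nb G (xT G H A R X Y)) (A ||| B)).testBit i = true ↔
        (dif (nb G (xT G H A R' X' Y')) (A ||| B)).testBit i = true := by rw [h]
      rw [testBit_dif, testBit_dif] at this
      exact ⟨fun h => (this.1 ⟨h, hi⟩).1, fun h => (this.2 ⟨h, hi⟩).1⟩
    have hx : xT G H A R X Y = xT G H A R' X' Y' := testBit_ext fun i => by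
      rw [hs.1, hs'.1, hr]
    rw [hs.2.2.1.trans ((congrArg (· &&& W) hr).trans hs'.2.2.1.symm),
      hs.2.2.2.1.trans ((congrArg (· &&& W) hx).trans hs'.2.2.2.1.symm),
      hs.2.2.2.2.trans ((congrArg (· &&& act G H A) hx).trans hs'.2.2.2.2.symm)]
  · intro S hS
    obtain ⟨x, hx, rfl⟩ := mem_UN_iff.1 hS
    obtain ⟨R, X, Y, h1, h2⟩ := exists_match hW hH hA hB hx
    exact ⟨⟨R, X, Y⟩, (hmem _).2 h1, by rw [h2]⟩

end
end RAM

namespace RAM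

open Tm BinOp

/-! ### The program

Arrays `0` to `6` hold the unions of neighborhoods of all bitsets, their cardinalities, the table of
intervals, the numbers of unions of neighborhoods across all cuts, the optimal values for
all sets of vertices, and the last vertices and remaining sets of optimal orderings. The
other arrays are scalars: `7` is the number of bitsets, `8` and `9` are the two parts `W` and `H` of
the vertices. -/

/-- Difference of bitsets. -/
def Tm.dif (e f : Tm) : Tm := bin sub e (bin land e f)

namespace Env

/-- Tabulates the neighborhoods and cardinalities of all bitsets. -/
def tables : Program :=
  forBits 11 12 (forRange 15 (sc 12)
    (.seq (set 0 (bin add (sc 12) (sc 15)) (bin lor (get 0 (sc 15)) (inp (sc 11))))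
      (set 1 (bin add (sc 12) (sc 15)) (bin add (get 1 (sc 15)) (lit 1)))))

/-- Adds an edge to the matching with vertex set `W`. -/
def matchStep : Program :=
  .cond (bin lor (bin lor (bin land (sc 8) (sc 12)) (bin land (sc 8) (sc 14)))
      (bin lor (bin eq (bin land (get 0 (sc 12)) (sc 14)) (lit 0))
        (bin lt (bin add (bin add size size) (bin add size (bin add size size)))
          (bin add (sc 10) (lit 16))))).toExpr
    .skip
    (.seq (set 8 (lit 0) (bin add (bin add (sc 8) (sc 12)) (sc 14)))
      (set 10 (lit 0) (bin add (sc 10) (lit 16))))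

/-- Computes a matching that is maximal or large enough. -/
def matching : Program := forBits 11 12 (forBits 13 14 matchStep)

/-- Enters a labelling into the table of intervals. -/
def enter : Program :=
  .seq (set 31 (lit 0) (bin lor (sc 25) (Tm.dif (Tm.dif (sc 16) (sc 28)) (get 0 (sc 19)))))
  (.seq (set 29 (lit 0) (bin lor (sc 22) (sc 31)))
  (.seq (set 30 (lit 0) (bin lor (sc 19) (Tm.dif (sc 10) (get 0 (sc 29)))))
  (.seq (set 13 (lit 0) (Tm.dif (sc 8) (bin lor (sc 19) (sc 22))))
  (.seq (set 14 (lit 0) (bin lor (sc 22) (Tm.dif (sc 13) (get 0 (sc 29)))))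
  (.seq (set 11 (lit 0) (bin lor (sc 22) (bin land (sc 13) (get 0 (sc 30)))))
  (.cond (bin lor (bin land (sc 19) (get 0 (sc 29)))
        (bin lor (Tm.dif (Tm.dif (sc 16) (sc 31)) (get 0 (sc 30))) (Tm.dif (sc 14) (sc 11)))).toExpr
    .skip
    (set 2 (bin add (shift (sc 11)) (sc 14))
      (bin add (get 2 (bin add (shift (sc 11)) (sc 14))) (lit 1)))))))))

/-- Enters all labellings into the table of intervals. -/
def collect : Program :=
  forSub 19 20 21 (sc 8) (forSub 22 23 24 (Tm.dif (sc 8) (bin lor (sc 19) (get 0 (sc 19))))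
    (forSub 25 26 27 (sc 28) enter))

/-- Splits an interval into two, or reads off the result. -/
def split : Program :=
  .seq (set 29 (lit 0) (bin sub (sc 19) (sc 22)))
  (.seq (set 30 (lit 0) (bin add (shift (sc 19)) (sc 29)))
  (.seq (set 31 (lit 0) (get 2 (sc 30)))
  (.seq (set 2 (sc 30) (lit 0))
  (.cond (sc 22).toExpr
    (.seq (set 13 (lit 0) (bin sub (sc 22) (bin land (sc 22) (bin sub (sc 22) (lit 1)))))
    (.seq (set 30 (lit 0) (bin add (shift (sc 19)) (bin add (sc 29) (sc 13))))
    (.seq (set 2 (sc 30) (bin add (get 2 (sc 30)) (sc 31)))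
    (.seq (set 30 (lit 0) (bin add (shift (bin sub (sc 19) (sc 13))) (sc 29)))
    (set 2 (sc 30) (bin add (get 2 (sc 30)) (sc 31)))))))
    (.seq (set 13 (lit 0) (bin lor (sc 16) (sc 19)))
    (.seq (set 3 (sc 13) (sc 31))
    (set 3 (Tm.dif (bin sub (sc 7) (lit 1)) (sc 13)) (sc 31))))))))

def distribute : Program := forSub 19 20 21 (sc 8) (forSub 22 23 24 (sc 19) split)

/-- Computes the numbers of unions of neighborhoods across all cuts. -/
def count : Program :=
  .seq (set 9 (lit 0) (Tm.dif (bin sub (sc 7) (lit 1)) (sc 8)))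
  (forSub 16 17 18 (sc 9)
    (.seq (set 10 (lit 0) (Tm.dif (sc 9) (sc 16)))
    (.seq (set 28 (lit 0) (bin land (sc 16) (get 0 (sc 10))))
    (.seq (set 14 (lit 0) (bin land (sc 10) (get 0 (sc 16))))
    (.cond (bin lt (get 1 (sc 14)) (get 1 (sc 28))).toExpr .skip (.seq collect distribute))))))

/-- Cell 28 holds the smallest value found so far, cell 29 the vertex removed, and cell 30 the
remaining set. -/
def relax : Program :=
  .cond (bin land (sc 15) (sc 12)).toExpr
    (.cond (bin lt (get 4 (bin sub (sc 15) (sc 12))) (sc 28)).toExpr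
      (.seq (set 28 (lit 0) (get 4 (bin sub (sc 15) (sc 12))))
      (.seq (set 29 (lit 0) (sc 11))
      (set 30 (lit 0) (bin sub (sc 15) (sc 12)))))
      .skip)
    .skip

/-- Computes optimal orderings of all sets of vertices. -/
def optimize : Program :=
  forRange 15 (sc 7) (.cond (sc 15).toExpr
    (.seq (set 28 (lit 0) (bin add (sc 7) (lit 1)))
    (.seq (forBits 11 12 relax)
    (.seq (.cond (bin lt (get 3 (sc 15)) (sc 28)).toExpr
      (set 4 (sc 15) (sc 28)) (set 4 (sc 15) (get 3 (sc 15))))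
    (.seq (set 5 (sc 15) (sc 29)) (set 6 (sc 15) (sc 30))))))
    .skip)

/-- Writes the optimal ordering, except for its first vertex. -/
def output : Program :=
  .seq (set 15 (lit 0) (bin sub (sc 7) (lit 1)))
  (.seq (set 11 (lit 0) (bin sub size (lit 1)))
  (.loop (sc 11).toExpr
    (.seq (set 32 (bin sub (sc 11) (lit 1)) (get 5 (sc 15)))
    (.seq (set 15 (lit 0) (get 6 (sc 15)))
    (set 11 (lit 0) (bin sub (sc 11) (lit 1)))))))

/-! ### The memory of the program -/

/-- Admissible entries of the table of intervals. -/
def keys (n W : ℕ) : Finset ℕ :=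
  (Finset.range (4 ^ n)).filter fun k => k / 2 ^ n ∈ subs W ∧ k % 2 ^ n ∈ subs (k / 2 ^ n)

/-- Indices of the interval table range up to `4 ^ n`, but only the cells in `K` may become nonzero;
this keeps the space small. -/
def doms (n : ℕ) (K : Finset ℕ) (a : ℕ) : Finset ℕ :=
  if a = 2 then K else if a ≤ 6 then Finset.range (2 ^ n) else
    if a = 32 then Finset.range n else {0}

/-- The environment in which the table of intervals uses the cells `K`. -/
def std (n : ℕ) (K : Finset ℕ) (hK : ∀ k ∈ K, k < 4 ^ n) : Env where
  n := n
  -- Indices of the interval table need `2 * n` bits; the 20 further bits cover the factor 32 and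
  -- the offset of the interleaving, and leave room for sums.
  b := 2 * n + 20
  dom := doms n K
  hn := by omega
  addr_lt := by
    intro a ha i hi
    have h1 : n < 2 ^ n := Nat.lt_two_pow_self
    have h2 : 2 ^ (2 * n + 20) = 4 ^ n * 2 ^ 20 := by rw [pow_add, pow_mul]; norm_num
    have h3 : 2 ^ n ≤ 4 ^ n := Nat.pow_le_pow_left (by norm_num) n
    have h4 : 1 ≤ 2 ^ n := Nat.one_le_two_pow
    have h5 : i < 4 ^ n := by
      unfold doms at hi
      split_ifs at hi
      · exact hK i hi
      · exact (Finset.mem_range.1 hi).trans_le h3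
      · exact (Finset.mem_range.1 hi).trans (h1.trans_le h3)
      · rw [Finset.mem_singleton.1 hi]; positivity
    rw [addr, h2]
    split <;> omega
  dom_input := by
    intro i hi
    simpa [doms] using hi

theorem step_set {E : Env} {a : ℕ} {e f : Tm} {q : Program} {σ τ : Store} {i v k : ℕ}
    (h : chkSet a e f = true) (he : e.ev E.n σ = i) (hf : f.ev E.n σ = v)
    (hi : i ∈ E.dom a) (hv : v < 2 ^ E.b) (hq : E.Run q (upd σ a i v) τ k) :
    E.Run (.seq (set a e f) q) σ τ (k + 1) := by
  subst he hf
  exact ((run_set h hi hv).seq hq).mono (by omega)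

theorem last_set {E : Env} {a : ℕ} {e f : Tm} {σ : Store} {i v : ℕ}
    (h : chkSet a e f = true) (he : e.ev E.n σ = i) (hf : f.ev E.n σ = v)
    (hi : i ∈ E.dom a) (hv : v < 2 ^ E.b) : E.Run (set a e f) σ (upd σ a i v) 1 := by
  subst he hf
  exact run_set h hi hv

theorem ite_pos {E : Env} {e : Tm} {p q : Program} {σ τ : Store} {k : ℕ} (h : e.chk = true)
    (he : e.ev E.n σ ≠ 0) (hp : E.Run p σ τ k) : E.Run (.cond e.toExpr p q) σ τ (k + 1) :=
  run_ite h (fun _ => hp) fun h => absurd h he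

theorem ite_neg {E : Env} {e : Tm} {p q : Program} {σ τ : Store} {k : ℕ} (h : e.chk = true)
    (he : e.ev E.n σ = 0) (hq : E.Run q σ τ k) : E.Run (.cond e.toExpr p q) σ τ (k + 1) :=
  run_ite h (fun h => absurd he h) fun _ => hq

theorem mem_dom {n : ℕ} {K : Finset ℕ} {hK : ∀ k ∈ K, k < 4 ^ n} {a : ℕ} (h2 : a ≠ 2 := by decide)
    (h32 : a ≠ 32 := by decide) : 0 ∈ (std n K hK).dom a := by
  change 0 ∈ doms n K a
  unfold doms
  rw [if_neg h2, if_neg h32]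
  split_ifs <;> simp

theorem mem_dom_table {n : ℕ} {K : Finset ℕ} {hK : ∀ k ∈ K, k < 4 ^ n} {a i : ℕ} (hi : i < 2 ^ n)
    (h2 : a ≠ 2 := by decide) (h6 : a ≤ 6 := by decide) : i ∈ (std n K hK).dom a := by
  change i ∈ doms n K a
  rw [doms, if_neg h2, if_pos h6, Finset.mem_range]
  exact hi

theorem lt_word {n : ℕ} {K : Finset ℕ} {hK : ∀ k ∈ K, k < 4 ^ n} {v : ℕ} (h : v < 2 ^ n * 2 ^ 20) :
    v < 2 ^ (std n K hK).b := by
  refine h.trans_le ?_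
  rw [← pow_add]
  exact Nat.pow_le_pow_right (by norm_num) (by simp only [std]; omega)

end Env
end RAM

namespace RAM

open Tm BinOp

theorem apply_lor_eq_zero (a b : ℕ) : lor.apply a b = 0 ↔ a = 0 ∧ b = 0 := Nat.or_eq_zero_iff

theorem apply_eq_eq_zero (a b : ℕ) : BinOp.eq.apply a b = 0 ↔ ¬ a = b := by
  simp only [BinOp.apply, ite_eq_right_iff, one_ne_zero, imp_false]

theorem apply_lt_eq_zero (a b : ℕ) : BinOp.lt.apply a b = 0 ↔ b ≤ a := by
  simp only [BinOp.apply, ite_eq_right_iff, one_ne_zero, imp_false, not_lt]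

theorem nb_or {n : ℕ} (G : SimpleGraph (Fin n)) (s t : ℕ) : nb G (s ||| t) = nb G s ||| nb G t := by
  refine testBit_ext fun i => ?_
  simp only [testBit_lor, testBit_nb]
  constructor
  · rintro ⟨j, h | h, h'⟩
    · exact .inl ⟨j, h, h'⟩
    · exact .inr ⟨j, h, h'⟩
  · rintro (⟨j, h, h'⟩ | ⟨j, h, h'⟩)
    · exact ⟨j, .inl h, h'⟩
    · exact ⟨j, .inr h, h'⟩

theorem nb_zero {n : ℕ} (G : SimpleGraph (Fin n)) : nb G 0 = 0 :=
  eq_zero_iff.2 fun i h => by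
    obtain ⟨j, hj, -⟩ := (testBit_nb G).1 h
    simp at hj

theorem pop_zero : pop 0 = 0 := rfl

theorem two_pow_add {i s : ℕ} (h : ¬ s.testBit i = true) : 2 ^ i + s = s ||| 2 ^ i := by
  rw [add_comm]
  refine add_eq_or ?_
  by_contra h'
  exact h (and_two_pow_ne_zero.1 h')

theorem pop_add {i s : ℕ} (h : ¬ s.testBit i = true) : pop (2 ^ i + s) = pop s + 1 := by
  have : bitsOf (2 ^ i + s) = insert i (bitsOf s) := by
    ext j
    rw [Finset.mem_insert, mem_bitsOf, mem_bitsOf, two_pow_add h, testBit_lor, testBit_two_pow_iff,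
      or_comm, eq_comm]
  rw [pop, this, Finset.card_insert_of_notMem (by rwa [mem_bitsOf]), pop]

theorem pop_le {n s : ℕ} (h : s < 2 ^ n) : pop s ≤ n := by
  have : bitsOf s ⊆ Finset.range n := fun i hi =>
    Finset.mem_range.2 (lt_two_pow_iff.1 h i (mem_bitsOf.1 hi))
  exact (Finset.card_le_card this).trans (Finset.card_range n).le

theorem not_testBit_of_lt {i s : ℕ} (h : s < 2 ^ i) : ¬ s.testBit i = true := fun h' =>
  lt_irrefl _ (lt_two_pow_iff.1 h i h')

theorem nb_testBit {n : ℕ} (G : SimpleGraph (Fin n)) (i j : ℕ) :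
    (nb G (2 ^ i)).testBit j = true ↔ adj G i j := by
  rw [testBit_nb]
  simp only [testBit_two_pow_iff]
  exact ⟨fun ⟨k, h, h'⟩ => h ▸ h', fun h => ⟨i, rfl, h⟩⟩

/-- The graph stored as a matching with vertex set `W` and `m` edges. -/
inductive Matched {n : ℕ} (G : SimpleGraph (Fin n)) : ℕ → ℕ → Prop
  | zero : Matched G 0 0
  | step {W m i j : ℕ} : Matched G W m → adj G i j → ¬ W.testBit i = true → ¬ W.testBit j = true →
      Matched G (W + 2 ^ i + 2 ^ j) (m + 1)

namespace Env

/-- The tables of neighborhoods and cardinalities are filled. -/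
def Tab {n : ℕ} (G : SimpleGraph (Fin n)) (σ : Store) : Prop :=
  ∀ s < 2 ^ n, σ 0 s = nb G s ∧ σ 1 s = pop s

variable {n : ℕ} {G : SimpleGraph (Fin n)} {K : Finset ℕ} {hK : ∀ k ∈ K, k < 4 ^ n}

@[simp] theorem std_n : (std n K hK).n = n := rfl

theorem std_lt : (std n K hK).n < (std n K hK).b := by simp only [std]; omega

attribute [simp] Tm.ev Tm.sc BinOp.apply upd_apply

@[simp] theorem ev_dif (e f : Tm) (σ : Store) : (Tm.dif e f).ev n σ = RAM.dif (e.ev n σ) (f.ev n σ) :=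
  rfl

theorem run_tables (σ : Store) (hin : ∀ i < n, σ 32 i = nb G (2 ^ i)) (h0 : σ 0 0 = 0)
    (h1 : σ 1 0 = 0) : ∃ τ, (std n K hK).Run tables σ τ (n * (2 ^ n * 4 + 5) + 3) ∧ Tab G τ ∧
      τ 12 0 = 2 ^ n ∧ Agree {0, 1, 11, 12, 15} σ τ := by
  obtain ⟨τ, h1, h2, h3⟩ := run_forBits (E := std n K hK) (i := 11) (p := 12)
    (body := forRange 15 (sc 12)
    (.seq (set 0 (bin add (sc 12) (sc 15)) (bin lor (get 0 (sc 15)) (inp (sc 11))))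
      (set 1 (bin add (sc 12) (sc 15)) (bin add (get 1 (sc 15)) (lit 1)))))
    (by decide) (by decide) std_lt mem_dom mem_dom
    (fun j υ => Agree {0, 1, 11, 12, 15} σ υ ∧ ∀ s < 2 ^ j, υ 0 s = nb G s ∧ υ 1 s = pop s)
    (2 ^ n * 4 + 2) (by
      rintro j hj υ ⟨ha, ht⟩ h11 h12
      have hj' : j < n := hj
      have hjn : 2 ^ (j + 1) ≤ 2 ^ n := Nat.pow_le_pow_right (by norm_num) hj
      rw [pow_succ] at hjn
      have hjp := Nat.two_pow_pos j
      obtain ⟨φ, g1, g2, g3⟩ := run_forRange (E := std n K hK) (s := 15) (bound := sc 12)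
        (body := (.seq (set 0 (bin add (sc 12) (sc 15)) (bin lor (get 0 (sc 15)) (inp (sc 11))))
          (set 1 (bin add (sc 12) (sc 15)) (bin add (get 1 (sc 15)) (lit 1)))))
        (by decide) mem_dom (2 ^ j) (lt_word (by omega))
        (fun s φ => Agree {0, 1, 15} υ φ ∧ ∀ t < 2 ^ j + s, φ 0 t = nb G t ∧ φ 1 t = pop t) 2
        (fun s φ h => by simp [h.1 12 (by decide), h12])
        (by
          rintro s hs φ ⟨hb, hu⟩ h15
          have e11 : φ 11 0 = j := by rw [hb 11 (by decide), h11]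
          have e12 : φ 12 0 = 2 ^ j := by rw [hb 12 (by decide), h12]
          have e32 : φ 32 j = nb G (2 ^ j) := by
            rw [hb 32 (by decide), ha 32 (by decide), hin j hj']
          have hs' := not_testBit_of_lt hs
          have es := hu s (by omega)
          -- The tables double in each round: a set with largest element `j` is `2 ^ j + s` with `s`
          -- already tabulated.
          have e0 : nb G s ||| nb G (2 ^ j) = nb G (2 ^ j + s) := by
            rw [two_pow_add hs', nb_or]
          have e1 := pop_add hs'
          have hlt : 2 ^ j + s < 2 ^ n := by omega
          refine ⟨upd (upd φ 0 (2 ^ j + s) (nb G (2 ^ j + s))) 1 (2 ^ j + s) (pop (2 ^ j + s)),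
            step_set (by decide) (by simp [e12, h15])
              (by simp [h15, es.1, e11, cell_succ φ hj', e32, e0]) (mem_dom_table hlt)
              (lt_word ((nb_lt _).trans_le (by omega)))
              (last_set (by decide) (by simp [e12, h15]) (by simp [h15, es.2, e1])
                (mem_dom_table hlt) (lt_word (by have := pop_le hlt; have := @Nat.lt_two_pow_self n; omega))),
            by simp [h15], fun ψ hψ => ⟨?_, ?_⟩⟩
          · refine (((hb.upd (by decide) _ _).upd (by decide) _ _).trans (hψ.mono (by decide)))
          · intro t ht
            rw [hψ 0 (by decide), hψ 1 (by decide)]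
            rcases Nat.lt_or_ge t (2 ^ j + s) with h | h
            · have := hu t h
              simp [this, h.ne]
            · obtain rfl : t = 2 ^ j + s := by omega
              simp) υ
        (fun φ hφ => ⟨hφ.mono (by decide), fun t ht => by
          rw [hφ 0 (by decide), hφ 1 (by decide)]; exact ‹∀ s < 2 ^ j, υ 0 s = nb G s ∧ υ 1 s = pop s› t (by omega)⟩)
      exact ⟨φ, g1.mono (by omega), (congrFun (g2 11 (by decide)) 0).trans h11,
        (congrFun (g2 12 (by decide)) 0).trans h12,
        fun ψ hψ => ⟨ha.trans ((g2.mono (by decide)).trans (hψ.mono (by decide))), fun t ht => by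
          rw [hψ 0 (by decide), hψ 1 (by decide)]
          exact g3 t (by rw [pow_succ] at ht; omega)⟩⟩) σ
    (fun υ hυ => ⟨hυ.mono (by decide), fun s hs => by
      obtain rfl : s = 0 := by simpa using hs
      rw [hυ 0 (by decide), hυ 1 (by decide), h0, h1, nb_zero, pop_zero]
      exact ⟨rfl, rfl⟩⟩)
  exact ⟨τ, h1, h2.2, h3, h2.1⟩

/-- Cell 10 holds `16 * m`, so the cap is tested with additions only. If an edge is still uncovered
after the step, it was rejected because of the cap. -/
theorem run_matchStep {σ : Store} (ht : Tab G σ) {i j W m : ℕ} (hi : i < n) (hj : j < n)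
    (h12 : σ 12 0 = 2 ^ i) (h14 : σ 14 0 = 2 ^ j) (h8 : σ 8 0 = W) (h10 : σ 10 0 = 16 * m)
    (hW : Matched G W m) (hm : 16 * m ≤ 5 * n) (hWn : W < 2 ^ n) :
    ∃ τ W' m', (std n K hK).Run matchStep σ τ 3 ∧ Agree {8, 10} σ τ ∧ τ 8 0 = W' ∧
      τ 10 0 = 16 * m' ∧ Matched G W' m' ∧ 16 * m' ≤ 5 * n ∧ W ∈ subs W' ∧ m ≤ m' ∧
      (adj G i j → W'.testBit i = true ∨ W'.testBit j = true ∨ 5 * n < 16 * m' + 16) := by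
  have hn0 := @Nat.lt_two_pow_self n
  have e1 : σ 0 (2 ^ i) = nb G (2 ^ i) := (ht _ (Nat.pow_lt_pow_right (by norm_num) hi)).1
  have c1 : σ 8 0 &&& σ 12 0 = 0 ↔ ¬ W.testBit i = true := by
    rw [h8, h12, ← not_iff_not, not_not]; exact and_two_pow_ne_zero
  have c2 : σ 8 0 &&& σ 14 0 = 0 ↔ ¬ W.testBit j = true := by
    rw [h8, h14, ← not_iff_not, not_not]; exact and_two_pow_ne_zero
  have c3 : σ 0 (σ 12 0) &&& σ 14 0 = 0 ↔ ¬ adj G i j := by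
    rw [h12, e1, h14, ← not_iff_not, not_not, ← nb_testBit]
    exact and_two_pow_ne_zero
  have key : (bin lor (bin lor (bin land (sc 8) (sc 12)) (bin land (sc 8) (sc 14)))
      (bin lor (bin eq (bin land (get 0 (sc 12)) (sc 14)) (lit 0))
        (bin lt (bin add (bin add size size) (bin add size (bin add size size)))
          (bin add (sc 10) (lit 16))))).ev (std n K hK).n σ = 0 ↔
      (¬ W.testBit i = true ∧ ¬ W.testBit j = true) ∧ adj G i j ∧ 16 * m + 16 ≤ 5 * n := by
    simp only [Tm.ev, Tm.sc, apply_lor_eq_zero, apply_eq_eq_zero, apply_lt_eq_zero]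
    simp only [BinOp.apply, c1, c2, c3, std_n, h10]
    refine and_congr_right fun _ => and_congr ?_ ?_
    · exact not_not
    · omega
  by_cases hc : (¬ W.testBit i = true ∧ ¬ W.testBit j = true) ∧ adj G i j ∧ 16 * m + 16 ≤ 5 * n
  · obtain ⟨⟨d1, d2⟩, d3, d4⟩ := hc
    have hWi : (W + 2 ^ i) = 2 ^ i ||| W := by rw [add_comm, two_pow_add d1, Nat.lor_comm]
    have hij : i ≠ j := by
      rintro rfl; exact not_adj_self G i d3
    have d2' : ¬ (W + 2 ^ i).testBit j = true := by
      rw [hWi, testBit_lor, testBit_two_pow_iff]; tauto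
    have hWij : ∀ l, (W + 2 ^ i + 2 ^ j).testBit l = true ↔ W.testBit l = true ∨ i = l ∨ j = l := by
      intro l
      rw [add_comm, two_pow_add d2', testBit_lor, hWi, testBit_lor, testBit_two_pow_iff,
        testBit_two_pow_iff]
      tauto
    have hlt : W + 2 ^ i + 2 ^ j < 2 ^ n := by
      rw [lt_two_pow_iff]
      intro l hl
      rcases (hWij l).1 hl with h | rfl | rfl
      · exact lt_two_pow_iff.1 hWn l h
      · exact hi
      · exact hj
    refine ⟨upd (upd σ 8 0 (W + 2 ^ i + 2 ^ j)) 10 0 (16 * (m + 1)), _, _,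
      ite_neg (by decide) (key.2 ⟨⟨d1, d2⟩, d3, d4⟩)
        (step_set (by decide) rfl (by simp [h8, h12, h14]) mem_dom (lt_word (by omega))
        (last_set (by decide) rfl (by simp [h10]; ring) mem_dom (lt_word (by omega)))),
      ((Agree.refl _ _).upd (by decide) _ _).upd (by decide) _ _, by simp, by simp,
      hW.step d3 d1 d2, by omega, mem_subs_iff.2 fun l hl => (hWij l).2 (.inl hl), by omega, fun _ =>
        .inl ((hWij i).2 (.inr (.inl rfl)))⟩
  · refine ⟨σ, W, m, (ite_pos (by decide) (fun h => hc (key.1 h)) (run_skip σ)).mono (by omega),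
      Agree.refl _ _, h8, h10, hW, hm, self_mem_subs _, le_rfl, fun ha => ?_⟩
    by_contra hcon
    push Not at hcon
    exact hc ⟨⟨by simp [hcon.1], by simp [hcon.2.1]⟩, ha, by omega⟩

theorem _root_.RAM.Matched.lt {W m : ℕ} (h : Matched G W m) : W < 2 ^ n := by
  rw [lt_two_pow_iff]
  induction h with
  | zero => intro i h; simp at h
  | @step W m i j h hij hi hj ih =>
    have hWi : (W + 2 ^ i) = 2 ^ i ||| W := by rw [add_comm, two_pow_add hi, Nat.lor_comm]
    have hij' : i ≠ j := by
      rintro rfl; exact not_adj_self G i hij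
    have d2' : ¬ (W + 2 ^ i).testBit j = true := by
      rw [hWi, testBit_lor, testBit_two_pow_iff]; tauto
    obtain ⟨hi', hj', -⟩ := hij
    intro l hl
    rw [add_comm, two_pow_add d2', testBit_lor, hWi, testBit_lor, testBit_two_pow_iff,
      testBit_two_pow_iff] at hl
    rcases hl with (rfl | hl) | rfl
    · exact hi'
    · exact ih l hl
    · exact hj'

theorem run_matching (σ : Store) (ht : Tab G σ) (h8 : σ 8 0 = 0) (h10 : σ 10 0 = 0) :
    ∃ τ W m, (std n K hK).Run matching σ τ (n * (n * 6 + 6) + 3) ∧ Agree {8, 10, 11, 12, 13, 14} σ τ ∧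
      τ 8 0 = W ∧ Matched G W m ∧ 16 * m ≤ 5 * n ∧
      (5 * n < 16 * m + 16 ∨ ∀ i j, adj G i j → W.testBit i = true ∨ W.testBit j = true) := by
  -- the pairs before `(i, j)` are covered
  set I : ℕ → ℕ → Store → Prop := fun i j τ => Agree {8, 10, 11, 12, 13, 14} σ τ ∧ ∃ W m,
    τ 8 0 = W ∧ τ 10 0 = 16 * m ∧ Matched G W m ∧ 16 * m ≤ 5 * n ∧ (5 * n < 16 * m + 16 ∨
      ∀ i' j', adj G i' j' → (i' < i ∨ i' = i ∧ j' < j) → W.testBit i' = true ∨ W.testBit j' = true)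
    with hI
  have hagree : ∀ i j τ υ, I i j τ → Agree {11, 12, 13, 14} τ υ → I i j υ := by
    rintro i j τ υ ⟨h1, W, m, h2, h3, h4⟩ h
    exact ⟨h1.trans (h.mono (by decide)), W, m, (congrFun (h 8 (by decide)) 0).trans h2,
      (congrFun (h 10 (by decide)) 0).trans h3, h4⟩
  have hnext : ∀ i τ, I i n τ → I (i + 1) 0 τ := by
    rintro i τ ⟨h1, W, m, h2, h3, h4, h5, h6⟩
    refine ⟨h1, W, m, h2, h3, h4, h5, h6.imp_right fun h i' j' ha hlt => h i' j' ha ?_⟩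
    obtain ⟨-, hj', -⟩ := ha
    omega
  obtain ⟨τ, h1, h2, -⟩ := run_forBits (E := std n K hK) (i := 11) (p := 12)
    (body := forBits 13 14 matchStep) (by decide) (by decide) std_lt mem_dom mem_dom
    (fun i υ => I i 0 υ) (n * 6 + 3) (by
      intro i hi υ hυ h11 h12
      obtain ⟨φ, g1, g2, -⟩ := run_forBits (E := std n K hK) (i := 13) (p := 14)
        (body := matchStep) (by decide) (by decide) std_lt mem_dom mem_dom
        (fun j υ => I i j υ ∧ υ 11 0 = i ∧ υ 12 0 = 2 ^ i) 3 (by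
          rintro j hj φ ⟨⟨ha, W, m, q1, q2, q3, q4, q5⟩, q6, q7⟩ h13 h14
          have htab : Tab G φ := fun s hs => by
            rw [ha 0 (by decide), ha 1 (by decide)]; exact ht s hs
          obtain ⟨ψ, W', m', p1, p2, p3, p4, p5, p6, p7, p8, p9⟩ := run_matchStep (K := K) (hK := hK)
            htab hi hj q7 h14 q1 q2 q3 q4 q3.lt
          refine ⟨ψ, p1, (congrFun (p2 13 (by decide)) 0).trans h13,
            (congrFun (p2 14 (by decide)) 0).trans h14, fun χ hχ => ⟨hagree _ _ ψ _
            ⟨ha.trans (p2.mono (by decide)), W', m', p3, p4, p5, p6, ?_⟩ (hχ.mono (by decide)), ?_, ?_⟩⟩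
          · by_cases hcon : 5 * n < 16 * m' + 16
            · exact .inl hcon
            · have h := q5.resolve_left (by omega)
              refine .inr fun i' j' hadj hlt => ?_
              have hsub := mem_subs_iff.1 p7
              by_cases hlt' : i' < i ∨ i' = i ∧ j' < j
              · exact (h i' j' hadj hlt').imp (hsub _) (hsub _)
              · obtain ⟨rfl, rfl⟩ : i' = i ∧ j' = j := by omega
                have := p9 hadj
                tauto
          · rw [hχ 11 (by decide), p2 11 (by decide), q6]
          · rw [hχ 12 (by decide), p2 12 (by decide), q7]) υ
        (fun φ hφ => ⟨hagree _ _ _ _ hυ (hφ.mono (by decide)), by rw [hφ 11 (by decide), h11],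
          by rw [hφ 12 (by decide), h12]⟩)
      exact ⟨φ, g1, g2.2.1, g2.2.2, fun χ hχ => hagree _ _ _ _ (hnext _ _ g2.1) (hχ.mono (by decide))⟩)
    σ (fun υ hυ => ⟨hυ.mono (by decide), 0, 0, by rw [hυ 8 (by decide), h8],
      by rw [hυ 10 (by decide), h10], .zero, by omega, .inr fun i' j' _ h => by omega⟩)
  obtain ⟨h3, W, m, h4, h5, h6, h7, h8⟩ := h2
  refine ⟨τ, W, m, h1, h3, h4, h6, h7, h8.imp_right fun h i j ha => h i j ha ?_⟩
  obtain ⟨hi, -⟩ := ha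
  exact .inl hi

end Env
end RAM

/-! ### Entering all labels into the table of intervals -/

namespace RAM

open Tm BinOp

theorem dif_le (s t : ℕ) : dif s t ≤ s := Nat.sub_le _ _

theorem dif_mem_subs (s t : ℕ) : dif s t ∈ subs s := mem_subs_iff.2 fun _ h => (testBit_dif.1 h).1

theorem lor_mem_subs {s t u : ℕ} (hs : s ∈ subs u) (ht : t ∈ subs u) : s ||| t ∈ subs u :=
  mem_subs_iff.2 fun i h => (testBit_lor.1 h).elim (mem_subs_iff.1 hs i) (mem_subs_iff.1 ht i)

theorem land_mem_subs_left (s t : ℕ) : s &&& t ∈ subs s := mem_subs_iff.2 fun _ h => (testBit_land.1 h).1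

theorem lt_of_mem_subs {s t k : ℕ} (hs : s ∈ subs t) (ht : t < k) : s < k :=
  (le_of_mem_subs hs).trans_lt ht

theorem pair_div {n T L : ℕ} (hL : L < 2 ^ n) : (T * 2 ^ n + L) / 2 ^ n = T := by
  rw [Nat.mul_comm, Nat.mul_add_div (by positivity), Nat.div_eq_of_lt hL, add_zero]

theorem pair_mod {n T L : ℕ} (hL : L < 2 ^ n) : (T * 2 ^ n + L) % 2 ^ n = L := by
  rw [Nat.mul_comm, Nat.mul_add_mod, Nat.mod_eq_of_lt hL]

namespace Env

variable {n : ℕ} {G : SimpleGraph (Fin n)}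

theorem keys_lt {W : ℕ} : ∀ k ∈ keys n W, k < 4 ^ n := fun _ hk =>
  Finset.mem_range.1 (Finset.mem_filter.1 hk).1

theorem pair_mem_keys {W T L : ℕ} (hW : W < 2 ^ n) (hT : T ∈ subs W) (hL : L ∈ subs T) :
    T * 2 ^ n + L ∈ keys n W := by
  have hT' := lt_of_mem_subs hT hW
  have hL' := lt_of_mem_subs hL hT'
  rw [keys, Finset.mem_filter, Finset.mem_range, pair_div hL', pair_mod hL']
  refine ⟨?_, hT, hL⟩
  have : 4 ^ n = 2 ^ n * 2 ^ n := by rw [← mul_pow]; norm_num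
  rw [this]
  nlinarith

theorem exists_of_mem_keys {W k : ℕ} (hk : k ∈ keys n W) :
    ∃ T ∈ subs W, ∃ L ∈ subs T, k = T * 2 ^ n + L := by
  obtain ⟨-, h1, h2⟩ := Finset.mem_filter.1 hk
  exact ⟨_, h1, _, h2, by rw [Nat.div_add_mod']⟩

/-- What is known about the memory while the cuts with left side `A` in `H` are processed. -/
structure Ctx (G : SimpleGraph (Fin n)) (W H A : ℕ) (σ : Store) : Prop where
  tab : Tab G σ
  hP : σ 7 0 = 2 ^ n
  hW : σ 8 0 = W
  hH : σ 9 0 = H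
  hA : σ 16 0 = A
  hB : σ 10 0 = RAM.dif H A
  hact : σ 28 0 = act G H A

/-- The arrays that change while a left side is processed. -/
def scratch : Finset ℕ := {2, 3, 11, 13, 14, 19, 20, 21, 22, 23, 24, 25, 26, 27, 29, 30, 31}

theorem Ctx.agree {W H A : ℕ} {σ τ : Store} (h : Ctx G W H A σ) (hs : Agree scratch σ τ) :
    Ctx G W H A τ := by
  have e : ∀ a, a ∉ scratch → τ a = σ a := hs
  refine ⟨fun s hs => ?_, ?_, ?_, ?_, ?_, ?_, ?_⟩
  · rw [e 0 (by decide), e 1 (by decide)]; exact h.tab s hs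
  · rw [e 7 (by decide), h.hP]
  · rw [e 8 (by decide), h.hW]
  · rw [e 9 (by decide), h.hH]
  · rw [e 16 (by decide), h.hA]
  · rw [e 10 (by decide), h.hB]
  · rw [e 28 (by decide), h.hact]

open Classical in
/-- The contribution of a labelling to an entry of the table of intervals. -/
noncomputable def hit (G : SimpleGraph (Fin n)) (W H A R X Y k : ℕ) : ℕ :=
  if Valid G W H A R X Y ∧ k = hi G W H A R X Y * 2 ^ n + lo G W H A R X Y then 1 else 0

theorem hi_mem_subs {W H A R X Y : ℕ} (hX : X ∈ subs (free G W R)) : hi G W H A R X Y ∈ subs W :=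
  lor_mem_subs (subs_trans hX (dif_mem_subs _ _))
    (subs_trans (land_mem_subs_left _ _) (dif_mem_subs _ _))

theorem lo_mem_subs {W H A R X Y : ℕ} (hX : X ∈ subs (free G W R)) : lo G W H A R X Y ∈ subs W :=
  lor_mem_subs (subs_trans hX (dif_mem_subs _ _))
    (subs_trans (dif_mem_subs _ _) (dif_mem_subs _ _))

theorem run_enter {W H A R X Y : ℕ} (hWn : W < 2 ^ n) (hHn : H < 2 ^ n) (hAH : A ∈ subs H)
    (hR : R ∈ subs W) (hX : X ∈ subs (free G W R)) (hY : Y ∈ subs (act G H A)) {σ : Store}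
    (hc : Ctx G W H A σ) (h19 : σ 19 0 = R) (h22 : σ 22 0 = X) (h25 : σ 25 0 = Y)
    (hb : ∀ k ∈ keys n W, σ 2 k + hit G W H A R X Y k < 2 ^ (2 * n + 20)) :
    ∃ τ, (std n (keys n W) keys_lt).Run enter σ τ 8 ∧ Agree {2, 11, 13, 14, 29, 30, 31} σ τ ∧
      ∀ k, τ 2 k = σ 2 k + hit G W H A R X Y k := by
  have hAn := lt_of_mem_subs hAH hHn
  have hRn := lt_of_mem_subs hR hWn
  have hXW : X ∈ subs W := subs_trans hX (dif_mem_subs _ _)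
  have hXn := lt_of_mem_subs hXW hWn
  have hYn := lt_of_mem_subs (subs_trans hY (land_mem_subs_left _ _)) hAn
  have hxH : xH G H A R Y < 2 ^ n :=
    Nat.or_lt_two_pow hYn ((dif_le _ _).trans_lt ((dif_le _ _).trans_lt hAn))
  have hxT : xT G H A R X Y < 2 ^ n := Nat.or_lt_two_pow hXn hxH
  have hrT : rT G H A R X Y < 2 ^ n :=
    Nat.or_lt_two_pow hRn ((dif_le _ _).trans_lt ((dif_le _ _).trans_lt hHn))
  have hlo := lo_mem_subs (H := H) (A := A) (Y := Y) hX
  have hhi := hi_mem_subs (H := H) (A := A) (Y := Y) hX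
  have hlon := lt_of_mem_subs hlo hWn
  have hhin := lt_of_mem_subs hhi hWn
  have hw : ∀ v, v < 2 ^ n → v < 2 ^ (std n (keys n W) keys_lt).b := fun v hv =>
    lt_word (by omega)
  have t1 := (hc.tab R hRn).1
  have t2 := (hc.tab _ hxT).1
  have t3 := (hc.tab _ hrT).1
  set τ := upd (upd (upd (upd (upd (upd σ 31 0 (xH G H A R Y)) 29 0 (xT G H A R X Y)) 30 0
    (rT G H A R X Y)) 13 0 (RAM.dif W (R ||| X))) 14 0 (lo G W H A R X Y)) 11 0 (hi G W H A R X Y)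
    with hτ
  have hag : Agree {2, 11, 13, 14, 29, 30, 31} σ τ :=
    ((((((Agree.refl _ _).upd (by decide) _ _).upd (by decide) _ _).upd (by decide) _ _).upd
      (by decide) _ _).upd (by decide) _ _).upd (by decide) _ _
  have hval : (bin lor (bin land (sc 19) (get 0 (sc 29)))
        (bin lor (Tm.dif (Tm.dif (sc 16) (sc 31)) (get 0 (sc 30))) (Tm.dif (sc 14) (sc 11)))).ev
      (std n (keys n W) keys_lt).n τ = 0 ↔ Valid G W H A R X Y := by
    have e : (bin lor (bin land (sc 19) (get 0 (sc 29)))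
        (bin lor (Tm.dif (Tm.dif (sc 16) (sc 31)) (get 0 (sc 30))) (Tm.dif (sc 14) (sc 11)))).ev
        (std n (keys n W) keys_lt).n τ = (R &&& nb G (xT G H A R X Y)) |||
          (RAM.dif (RAM.dif A (xH G H A R Y)) (nb G (rT G H A R X Y)) |||
            RAM.dif (lo G W H A R X Y) (hi G W H A R X Y)) := by
      simp [hτ, h19, t2, t3, hc.hA]
    rw [e, Nat.or_eq_zero_iff, Nat.or_eq_zero_iff, Valid]
  have start : ∀ {p υ}, (std n (keys n W) keys_lt).Run p τ υ 2 →
      (std n (keys n W) keys_lt).Run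
      (.seq (set 31 (lit 0) (bin lor (sc 25) (Tm.dif (Tm.dif (sc 16) (sc 28)) (get 0 (sc 19)))))
      (.seq (set 29 (lit 0) (bin lor (sc 22) (sc 31)))
      (.seq (set 30 (lit 0) (bin lor (sc 19) (Tm.dif (sc 10) (get 0 (sc 29)))))
      (.seq (set 13 (lit 0) (Tm.dif (sc 8) (bin lor (sc 19) (sc 22))))
      (.seq (set 14 (lit 0) (bin lor (sc 22) (Tm.dif (sc 13) (get 0 (sc 29)))))
      (.seq (set 11 (lit 0) (bin lor (sc 22) (bin land (sc 13) (get 0 (sc 30)))))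
      p)))))) σ υ 8 := fun h =>
    step_set (by decide) rfl (by simp [h19, h25, hc.hA, hc.hact, t1, xH]) mem_dom (hw _ hxH) <|
    step_set (by decide) rfl (by simp [h22, xT]) mem_dom (hw _ hxT) <|
    step_set (by decide) rfl (by simp [h19, hc.hB, t2, rT]) mem_dom (hw _ hrT) <|
    step_set (by decide) rfl (by simp [h19, h22, hc.hW]) mem_dom
      (hw _ ((dif_le _ _).trans_lt hWn)) <|
    step_set (by decide) rfl (by simp [h22, t2, lo]) mem_dom (hw _ hlon) <|
    step_set (by decide) rfl (by simp [h22, t3, hi]) mem_dom (hw _ hhin) h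
  have hpair : (bin add (shift (sc 11)) (sc 14)).ev (std n (keys n W) keys_lt).n τ =
      hi G W H A R X Y * 2 ^ n + lo G W H A R X Y := by simp [hτ]
  by_cases hv : Valid G W H A R X Y
  -- The last clause of validity, `lo ⊆ hi`, places the entry among the admissible cells. Without it
  -- the write could leave the allotted space.
  · have hk : hi G W H A R X Y * 2 ^ n + lo G W H A R X Y ∈ keys n W :=
      pair_mem_keys hWn hhi (dif_eq_zero.1 hv.2.2)
    have h2 : τ 2 = σ 2 := by simp [hτ, upd_of_ne]
    have hb' := hb _ hk
    rw [hit, if_pos ⟨hv, rfl⟩] at hb'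
    refine ⟨upd τ 2 (hi G W H A R X Y * 2 ^ n + lo G W H A R X Y)
      (σ 2 (hi G W H A R X Y * 2 ^ n + lo G W H A R X Y) + 1), start (ite_neg (by decide) (hval.2 hv)
        (last_set (by decide) hpair ?_ hk hb')), hag.upd (by decide) _ _, fun k => ?_⟩
    · rw [Tm.ev, Tm.ev, Tm.ev, hpair, h2, BinOp.apply]
    · rw [upd_apply, hit, h2]
      by_cases h : k = hi G W H A R X Y * 2 ^ n + lo G W H A R X Y
      · rw [if_pos ⟨rfl, h⟩, if_pos ⟨hv, h⟩, h]
      · rw [if_neg fun h' => h h'.2, if_neg fun h' => h h'.2, add_zero]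
  · refine ⟨τ, start (ite_pos (by decide) (mt hval.1 hv) (run_skip τ)), hag, fun k => ?_⟩
    rw [hit, if_neg fun h' => hv h'.1]
    simp [hτ]

/-- A loop over submasks whose body adds to the entries of an array. -/
theorem run_forSub_add {E : Env} {v u m : ℕ} {S : Tm} {body : Program} (hc : chkSub v u m S = true)
    (hvm : v ≠ m) (hum : u ≠ m) (hv : 0 ∈ E.dom v) (hu : 0 ∈ E.dom u) (hm : 0 ∈ E.dom m) (D D' : Finset ℕ)
    (hvD : v ∉ D) (hmD : m ∉ D) (hD : D ⊆ D') (hvD' : {v, u, m} ⊆ D') (h2 : 2 ∉ ({v, u, m} : Finset ℕ))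
    (s₀ : ℕ) (hs₀ : s₀ + 1 < 2 ^ E.b) (f : ℕ → ℕ → ℕ) (k : ℕ → ℕ) (K : Finset ℕ) (B : ℕ) (σ : Store)
    (hS : S.ev E.n σ = s₀) (hb : ∀ x ∈ K, σ 2 x + ∑ s ∈ subs s₀, f s x < B)
    (step : ∀ s ∈ subs s₀, ∀ φ, Agree D' σ φ → φ v 0 = s → (∀ x ∈ K, φ 2 x + f s x < B) →
      ∃ τ, E.Run body φ τ (k s) ∧ Agree D φ τ ∧ ∀ x, τ 2 x = φ 2 x + f s x) :
    ∃ τ, E.Run (forSub v u m S body) σ τ (∑ s ∈ subs s₀, (k s + 4) + 3) ∧ Agree D' σ τ ∧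
      ∀ x, τ 2 x = σ 2 x + ∑ s ∈ subs s₀, f s x := by
  have h2' : 2 ∉ ({v, u} : Finset ℕ) := fun h => h2 (by simp at h ⊢; tauto)
  have hvu : ({v, u} : Finset ℕ) ⊆ D' := fun x hx => hvD' (by simp at hx ⊢; tauto)
  refine run_forSub hc hvm hum hv hu hm s₀ hs₀
    (fun P φ => Agree D' σ φ ∧ ∀ x, φ 2 x = σ 2 x + ∑ s ∈ P, f s x) k σ hS ?_ ?_ ?_
  · rintro s hs φ ⟨h3, h4⟩ h5 h6
    have hns : s ∉ (subs s₀).filter (s < ·) := by simp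
    -- No overflow in between: the contributions of the treated submasks and of `s` are part of the
    -- total, which is bounded by hypothesis.
    obtain ⟨τ, g1, g2, g3⟩ := step s hs φ h3 h5 (fun x hx => by
      have e1 := Finset.sum_insert (f := fun s => f s x) hns
      have e2 := Finset.sum_le_sum_of_subset (f := fun s => f s x)
        (Finset.insert_subset hs (Finset.filter_subset (s < ·) (subs s₀)))
      have e3 := hb x hx
      have e4 := h4 x
      omega)
    refine ⟨τ, g1, by rw [g2 v hvD, h5], by rw [g2 m hmD, h6], fun υ hυ => ⟨?_, fun x => ?_⟩⟩
    · exact h3.trans ((g2.mono hD).trans (hυ.mono hvu))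
    · rw [hυ 2 h2', g3, h4, Finset.sum_insert hns]; ring
  · intro υ hυ
    exact ⟨hυ.mono hvD', fun x => by rw [hυ 2 h2, Finset.sum_empty, add_zero]⟩
  · rintro P φ υ ⟨h3, h4⟩ h
    exact ⟨h3.trans (h.mono hvu), fun x => by rw [h 2 h2', h4]⟩

/-- The entry `k` of the table of intervals after all labellings are entered. -/
noncomputable def hits (G : SimpleGraph (Fin n)) (W H A k : ℕ) : ℕ :=
  ∑ R ∈ subs W, ∑ X ∈ subs (free G W R), ∑ Y ∈ subs (act G H A), hit G W H A R X Y k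

/-- A bound for the running time of `collect`. -/
noncomputable def collectTime (G : SimpleGraph (Fin n)) (W H A : ℕ) : ℕ :=
  ∑ R ∈ subs W, (∑ _X ∈ subs (free G W R), (∑ _Y ∈ subs (act G H A), (8 + 4) + 3 + 4) + 3 + 4) + 3

/-- The three nested submask loops are instances of `run_forSub_add`. The increments accumulate to a
triple sum, and the only quantity to be bounded is the final content of each entry. -/
theorem run_collect {W H A : ℕ} (hWn : W < 2 ^ n) (hHn : H < 2 ^ n) (hAH : A ∈ subs H) {σ : Store}
    (hc : Ctx G W H A σ) (hb : ∀ k ∈ keys n W, σ 2 k + hits G W H A k < 2 ^ (2 * n + 20)) :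
    ∃ τ, (std n (keys n W) keys_lt).Run collect σ τ (collectTime G W H A) ∧ Agree (scratch.erase 3) σ τ ∧
      ∀ k, τ 2 k = σ 2 k + hits G W H A k := by
  have hAn := lt_of_mem_subs hAH hHn
  have hw : ∀ v, v < 2 ^ n → v + 1 < 2 ^ (std n (keys n W) keys_lt).b := fun v hv =>
    lt_word (by omega)
  obtain ⟨τ, h1, h2, h3⟩ := run_forSub_add (E := std n (keys n W) keys_lt) (v := 19) (u := 20) (m := 21)
    (S := sc 8) (body := forSub 22 23 24 (Tm.dif (sc 8) (bin lor (sc 19) (get 0 (sc 19))))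
      (forSub 25 26 27 (sc 28) enter)) (by decide) (by decide) (by decide) mem_dom mem_dom mem_dom
    {2, 11, 13, 14, 22, 23, 24, 25, 26, 27, 29, 30, 31}
    {2, 11, 13, 14, 19, 20, 21, 22, 23, 24, 25, 26, 27, 29, 30, 31}
    (by decide) (by decide) (by decide) (by decide) (by decide) W (hw W hWn)
    (fun R k => ∑ X ∈ subs (free G W R), ∑ Y ∈ subs (act G H A), hit G W H A R X Y k)
    (fun R => ∑ _X ∈ subs (free G W R), (∑ _Y ∈ subs (act G H A), (8 + 4) + 3 + 4) + 3)
    (keys n W) _ σ (by simp [hc.hW]) hb (by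
      intro R hR φ hφ h19 hb'
      have hcφ := hc.agree (hφ.mono (by decide))
      have hRn := lt_of_mem_subs hR hWn
      exact run_forSub_add (E := std n (keys n W) keys_lt) (v := 22) (u := 23) (m := 24)
        (S := Tm.dif (sc 8) (bin lor (sc 19) (get 0 (sc 19))))
        (body := forSub 25 26 27 (sc 28) enter) (by decide) (by decide) (by decide)
        mem_dom mem_dom mem_dom {2, 11, 13, 14, 25, 26, 27, 29, 30, 31}
        {2, 11, 13, 14, 22, 23, 24, 25, 26, 27, 29, 30, 31}
        (by decide) (by decide) (by decide) (by decide) (by decide) (free G W R)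
        (hw _ ((dif_le _ _).trans_lt hWn))
        (fun X k => ∑ Y ∈ subs (act G H A), hit G W H A R X Y k)
        (fun X => ∑ _Y ∈ subs (act G H A), (8 + 4) + 3)
        (keys n W) _ φ (by simp [hcφ.hW, h19, (hcφ.tab R hRn).1, free]) hb' (by
          intro X hX ψ hψ h22 hb''
          have hcψ := hcφ.agree (hψ.mono (by decide))
          have h19' : ψ 19 0 = R := by rw [hψ 19 (by decide), h19]
          exact run_forSub_add (E := std n (keys n W) keys_lt) (v := 25) (u := 26) (m := 27)
            (S := sc 28) (body := enter) (by decide) (by decide) (by decide)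
            mem_dom mem_dom mem_dom {2, 11, 13, 14, 29, 30, 31}
            {2, 11, 13, 14, 25, 26, 27, 29, 30, 31}
            (by decide) (by decide) (by decide) (by decide) (by decide) (act G H A)
            (hw _ (Nat.and_le_left.trans_lt hAn))
            (fun Y k => hit G W H A R X Y k) (fun Y => 8) (keys n W) _ ψ (by simp [hcψ.hact]) hb'' (by
              intro Y hY χ hχ h25 hb3
              have hcχ := hcψ.agree (hχ.mono (by decide))
              exact run_enter hWn hHn hAH hR hX hY hcχ (by rw [hχ 19 (by decide), h19'])
                (by rw [hχ 22 (by decide), h22]) h25 hb3)))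
  exact ⟨τ, h1, h2.mono (by decide), h3⟩

end Env
end RAM

/-! ### Splitting intervals and reading off the counts -/

namespace RAM

open Tm BinOp

theorem sub_eq_dif {s t : ℕ} (h : t ∈ subs s) : s - t = dif s t := by
  rw [dif, Nat.land_comm, mem_subs.1 h]

theorem dif_dif {s t : ℕ} (h : t ∈ subs s) : dif s (dif s t) = t := by
  refine testBit_ext fun i => ?_
  have := mem_subs_iff.1 h i
  rw [testBit_dif, testBit_dif]
  tauto

theorem subs_antisymm {s t : ℕ} (h : s ∈ subs t) (h' : t ∈ subs s) : s = t :=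
  le_antisymm (le_of_mem_subs h) (le_of_mem_subs h')

namespace Env

variable {n : ℕ} {G : SimpleGraph (Fin n)}

/-- The interval `k` contains `B`. -/
abbrev Inside (n k B : ℕ) : Prop := k % 2 ^ n ∈ subs B ∧ B ∈ subs (k / 2 ^ n)

/-- The total weight of the intervals that contain `B`. -/
def cover (n W : ℕ) (d : ℕ → ℕ) (B : ℕ) : ℕ := ∑ k ∈ keys n W, if Inside n k B then d k else 0

theorem inside_pair {T L B : ℕ} (hL : L < 2 ^ n) :
    Inside n (T * 2 ^ n + L) B ↔ L ∈ subs B ∧ B ∈ subs T := by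
  rw [Inside, pair_div hL, pair_mod hL]

theorem le_cover {W k B : ℕ} (d : ℕ → ℕ) (hk : k ∈ keys n W) (h : Inside n k B) :
    d k ≤ cover n W d B := by
  have := Finset.single_le_sum (f := fun k => if Inside n k B then d k else 0)
    (fun _ _ => Nat.zero_le _) hk
  rwa [if_pos h] at this

/-- The effect of one write on the covering weight, in additive form to avoid truncated subtraction.
-/
theorem cover_update {W k : ℕ} {d d' : ℕ → ℕ} (hk : k ∈ keys n W) (h : ∀ j, j ≠ k → d' j = d j)
    (B : ℕ) : cover n W d' B + (if Inside n k B then d k else 0) =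
      cover n W d B + (if Inside n k B then d' k else 0) := by
  unfold cover
  rw [← Finset.add_sum_erase _ _ hk, ← Finset.add_sum_erase (keys n W) (fun k => if Inside n k B then d k else 0) hk]
  have : ∑ j ∈ (keys n W).erase k, (if Inside n j B then d' j else 0) =
      ∑ j ∈ (keys n W).erase k, (if Inside n j B then d j else 0) :=
    Finset.sum_congr rfl fun j hj => by rw [h j (Finset.ne_of_mem_erase hj)]
  rw [this]
  ring

/-- Exchanging the summations, each valid label contributes to a single interval, and that interval
contains `B` exactly when the label matches `B`. -/
theorem cover_hits {W H A B : ℕ} (hW : W < 2 ^ n) (hH : H = RAM.dif (2 ^ n - 1) W) (hA : A ∈ subs H)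
    (hB : B ∈ subs W) : cover n W (hits G W H A) B = un G (A ||| B) := by
  classical
  rw [← sum_match hW hH hA hB, cover]
  have e : ∀ k, (if Inside n k B then hits G W H A k else 0) = ∑ R ∈ subs W,
      ∑ X ∈ subs (free G W R), ∑ Y ∈ subs (act G H A),
        if Inside n k B then hit G W H A R X Y k else 0 := by
    intro k
    split_ifs
    · rfl
    · simp
  rw [Finset.sum_congr rfl fun k _ => e k, Finset.sum_comm]
  refine Finset.sum_congr rfl fun R _ => ?_
  rw [Finset.sum_comm]
  refine Finset.sum_congr rfl fun X hX => ?_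
  rw [Finset.sum_comm]
  refine Finset.sum_congr rfl fun Y _ => ?_
  have hlon := lt_of_mem_subs (lo_mem_subs (G := G) (H := H) (A := A) (Y := Y) hX) hW
  by_cases hv : Valid G W H A R X Y
  · rw [Finset.sum_eq_single (hi G W H A R X Y * 2 ^ n + lo G W H A R X Y)]
    · have e1 : hit G W H A R X Y (hi G W H A R X Y * 2 ^ n + lo G W H A R X Y) = 1 :=
        if_pos ⟨hv, rfl⟩
      rw [e1]
      refine if_congr ?_ rfl rfl
      rw [inside_pair hlon]
      tauto
    · intro k _ hk
      have e1 : hit G W H A R X Y k = 0 := if_neg fun h => hk h.2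
      rw [e1, ite_self]
    · intro h
      exact absurd (pair_mem_keys hW (hi_mem_subs hX) (dif_eq_zero.1 hv.2.2)) h
  · rw [if_neg fun h => hv h.1]
    refine Finset.sum_eq_zero fun k _ => ?_
    have e1 : hit G W H A R X Y k = 0 := if_neg fun h => hv h.1
    rw [e1, ite_self]

/-- An entry is at most the weight covering its lower endpoint, which is a value of `un`. This
excludes overflow of the table. -/
theorem hits_le {W H A k : ℕ} (hW : W < 2 ^ n) (hH : H = RAM.dif (2 ^ n - 1) W) (hA : A ∈ subs H)
    (hk : k ∈ keys n W) : hits G W H A k ≤ 2 ^ n := by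
  obtain ⟨T, hT, L, hL, rfl⟩ := exists_of_mem_keys hk
  have hLW := subs_trans hL hT
  refine (le_cover (hits G W H A) hk (B := L) ?_).trans ?_
  · rw [inside_pair (lt_of_mem_subs hLW hW)]
    exact ⟨self_mem_subs _, hL⟩
  · rw [cover_hits hW hH hA hLW]
    exact un_le G _

/-- An entry with nonzero `M` is distributed to two smaller intervals. -/
theorem run_split {W T M : ℕ} (hWn : W < 2 ^ n) {σ : Store}
    (hT : T ∈ subs W) (hM : M ∈ subs T) (h19 : σ 19 0 = T) (h22 : σ 22 0 = M) (hM0 : M ≠ 0)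
    (hb : ∀ B ∈ subs W, B ≤ T → cover n W (σ 2) B ≤ 2 ^ n) :
    ∃ τ, (std n (keys n W) keys_lt).Run split σ τ 10 ∧ Agree {2, 13, 29, 30, 31} σ τ ∧
      (∀ B, cover n W (τ 2) B = cover n W (σ 2) B) ∧ τ 2 (T * 2 ^ n + (T - M)) = 0 ∧
      (∀ T' M', M' ∈ subs T' → T' < 2 ^ n → T < T' ∨ T' = T ∧ M < M' →
        τ 2 (T' * 2 ^ n + (T' - M')) = σ 2 (T' * 2 ^ n + (T' - M'))) := by
  obtain ⟨i, hi, hw⟩ := exists_eq_sub_and hM0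
  have hTn := lt_of_mem_subs hT hWn
  have hiT := mem_subs_iff.1 hM i hi
  have hMT := le_of_mem_subs hM
  have hwM : 2 ^ i ≤ M := le_of_mem_subs (two_pow_mem_subs hi)
  have hw0 : 0 < 2 ^ i := by positivity
  have hL : ∀ j, (T - M).testBit j = true ↔ T.testBit j = true ∧ ¬ M.testBit j = true := fun j => by
    rw [sub_eq_dif hM, testBit_dif]
  have hLi : ¬ (T - M).testBit i = true := fun h => ((hL i).1 h).2 hi
  have hLw : ∀ j, (T - M + 2 ^ i).testBit j = true ↔ (T - M).testBit j = true ∨ i = j := fun j => by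
    rw [add_comm, two_pow_add hLi, testBit_lor, testBit_two_pow_iff]
  have hTw : ∀ j, (T - 2 ^ i).testBit j = true ↔ T.testBit j = true ∧ ¬ i = j := fun j => by
    rw [sub_eq_dif (two_pow_mem_subs hiT), testBit_dif, testBit_two_pow_iff]
  have m1 : T - M ∈ subs T := mem_subs_iff.2 fun j h => ((hL j).1 h).1
  have m2 : T - M + 2 ^ i ∈ subs T := mem_subs_iff.2 fun j h => by
    rcases (hLw j).1 h with h | rfl
    · exact ((hL j).1 h).1
    · exact hiT
  have m3 : T - 2 ^ i ∈ subs W := mem_subs_iff.2 fun j h => mem_subs_iff.1 hT j ((hTw j).1 h).1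
  have m4 : T - M ∈ subs (T - 2 ^ i) := mem_subs_iff.2 fun j h =>
    (hTw j).2 ⟨((hL j).1 h).1, fun e => hLi (e ▸ h)⟩
  have k1 := pair_mem_keys hWn hT m1
  have k2 := pair_mem_keys hWn hT m2
  have k3 := pair_mem_keys hWn m3 m4
  have hl1 := lt_of_mem_subs m1 hTn
  have hl2 := lt_of_mem_subs m2 hTn
  set a := T * 2 ^ n + (T - M) with ha
  set b := T * 2 ^ n + (T - M + 2 ^ i) with hb'
  set c := (T - 2 ^ i) * 2 ^ n + (T - M) with hc'
  have hab : b ≠ a := by omega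
  -- The second half has the smaller upper bound `T - 2 ^ i`, and the first half keeps `T` but has a
  -- smaller difference. Both entries thus come later in the descending enumeration.
  have hca : c < T * 2 ^ n := by
    have : (T - 2 ^ i + 1) * 2 ^ n ≤ T * 2 ^ n := Nat.mul_le_mul_right _ (by omega)
    rw [add_mul, one_mul] at this
    omega
  have b1 : σ 2 a ≤ 2 ^ n := (le_cover _ k1 ((inside_pair hl1).2 ⟨m1, self_mem_subs _⟩)).trans
    (hb T hT le_rfl)
  have b2 : σ 2 b ≤ 2 ^ n := (le_cover _ k2 ((inside_pair hl2).2 ⟨m2, self_mem_subs _⟩)).trans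
    (hb T hT le_rfl)
  have b3 : σ 2 c ≤ 2 ^ n := (le_cover _ k3 ((inside_pair hl1).2 ⟨m4, self_mem_subs _⟩)).trans
    (hb _ m3 (by omega))
  have hkl : ∀ k ∈ keys n W, k < 2 ^ (std n (keys n W) keys_lt).b := fun k hk => by
    refine (keys_lt k hk).trans_le ?_
    rw [show (4 : ℕ) = 2 ^ 2 from rfl, ← pow_mul]
    exact Nat.pow_le_pow_right (by norm_num) (by simp only [std]; omega)
  have h4 : 1 ≤ 2 ^ n := Nat.one_le_two_pow
  refine ⟨upd (upd (upd (upd (upd (upd (upd (upd (upd σ 29 0 (T - M)) 30 0 a) 31 0 (σ 2 a)) 2 a 0) 13 0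
      (2 ^ i)) 30 0 b) 2 b (σ 2 b + σ 2 a)) 30 0 c) 2 c (σ 2 c + σ 2 a),
    step_set (by decide) rfl (by simp [h19, h22]) mem_dom (lt_word (by omega)) <|
    step_set (by decide) rfl (by simp [h19, ha]) mem_dom (hkl _ k1) <|
    step_set (by decide) rfl (by simp) mem_dom (lt_word (by omega)) <|
    step_set (by decide) (by simp) rfl k1 (lt_word (by simp)) <|
    ite_pos (by decide) (by simp [h22, hM0]) <|
    step_set (by decide) rfl (by simp [h22, hw]) mem_dom (lt_word (by omega)) <|
    step_set (by decide) rfl (by simp [h19, hb']) mem_dom (hkl _ k2) <|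
    step_set (by decide) (by simp) (by simp [hab]) k2 (lt_word (by omega)) <|
    step_set (by decide) rfl (by simp [h19, hc']) mem_dom (hkl _ k3) <|
    last_set (by decide) (by simp) (by
      have e1 : c ≠ a := by omega
      have e2 : c ≠ b := by omega
      simp [e1, e2]) k3 (lt_word (by omega)), ?_, ?_, ?_, ?_⟩
  · intro x hx
    simp only [Finset.mem_insert, Finset.mem_singleton, not_or] at hx
    funext j
    simp [hx]
  · intro B
    have u1 := cover_update (d := σ 2) (d' := fun j => if j = a then 0 else σ 2 j) k1
      (fun j hj => if_neg hj) B
    have u2 := cover_update (d := fun j => if j = a then 0 else σ 2 j)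
      (d' := fun j => if j = b then σ 2 b + σ 2 a else if j = a then 0 else σ 2 j) k2
      (fun j hj => if_neg hj) B
    have u3 := cover_update (d := fun j => if j = b then σ 2 b + σ 2 a else if j = a then 0 else σ 2 j)
      (d' := fun j => if j = c then σ 2 c + σ 2 a else
        if j = b then σ 2 b + σ 2 a else if j = a then 0 else σ 2 j) k3
      (fun j hj => if_neg hj) B
    have e1 : c ≠ a := by omega
    have e2 : c ≠ b := by omega
    simp only [if_true, if_neg hab, if_neg e1, if_neg e2] at u1 u2 u3
    have e : ∀ j, (upd (upd (upd (upd (upd (upd (upd (upd (upd σ 29 0 (T - M)) 30 0 a) 31 0 (σ 2 a)) 2 a 0)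
        13 0 (2 ^ i)) 30 0 b) 2 b (σ 2 b + σ 2 a)) 30 0 c) 2 c (σ 2 c + σ 2 a)) 2 j =
        if j = c then σ 2 c + σ 2 a else
          if j = b then σ 2 b + σ 2 a else if j = a then 0 else σ 2 j := fun j => by simp
    rw [funext e]
    -- A set in the old interval lies in exactly one half, according to whether it contains `i`.
    -- Moving the weight to both halves therefore preserves every covering weight.
    have hin : (if Inside n a B then σ 2 a else 0) =
        (if Inside n b B then σ 2 a else 0) + (if Inside n c B then σ 2 a else 0) := by
      rw [ha, hb', hc']
      simp only [inside_pair hl1, inside_pair hl2]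
      by_cases hBi : B.testBit i = true
      · have f1 : T - M + 2 ^ i ∈ subs B ↔ T - M ∈ subs B := by
          simp only [mem_subs_iff, hLw]
          exact ⟨fun h j hj => h j (.inl hj), fun h j hj => hj.elim (h j) fun e => e ▸ hBi⟩
        have f2 : ¬ B ∈ subs (T - 2 ^ i) := fun h => ((hTw i).1 (mem_subs_iff.1 h i hBi)).2 rfl
        simp [f1, f2]
      · have f1 : ¬ T - M + 2 ^ i ∈ subs B := fun h => hBi (mem_subs_iff.1 h i ((hLw i).2 (.inr rfl)))
        have f2 : B ∈ subs (T - 2 ^ i) ↔ B ∈ subs T := by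
          simp only [mem_subs_iff, hTw]
          exact ⟨fun h j hj => (h j hj).1, fun h j hj => ⟨h j hj, fun e => hBi (e ▸ hj)⟩⟩
        simp [f1, f2]
    have g : ∀ (p : Prop) [Decidable p] (x y : ℕ), (if p then x + y else 0) =
        (if p then x else 0) + (if p then y else 0) := fun p _ x y => by split_ifs <;> rfl
    simp only [g, ite_self] at u1 u2 u3
    omega
  · have e1 : a ≠ c := by omega
    simp [e1, hab.symm]
  · intro T' M' hM' hT' h
    have g1 : T' - M' < 2 ^ n := by omega
    have e1 : T' * 2 ^ n + (T' - M') ≠ c := by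
      rcases h with h | ⟨rfl, h⟩
      · have : T * 2 ^ n ≤ T' * 2 ^ n := Nat.mul_le_mul_right _ h.le
        omega
      · omega
    have g2 : T < T' → (T + 1) * 2 ^ n ≤ T' * 2 ^ n := fun h => Nat.mul_le_mul_right _ h
    have g3 := le_of_mem_subs hM'
    rw [add_mul, one_mul] at g2
    have e2 : T' * 2 ^ n + (T' - M') ≠ b := by
      rcases h with h | ⟨rfl, h⟩
      · have := g2 h; omega
      · omega
    have e3 : T' * 2 ^ n + (T' - M') ≠ a := by
      rcases h with h | ⟨rfl, h⟩
      · have := g2 h; omega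
      · omega
    simp [e1, e2, e3]

/-- Entries with `M = 0` are results. -/
theorem run_split_zero {W H A T : ℕ} (hWn : W < 2 ^ n) (hAn : A < 2 ^ n) {σ : Store}
    (hc : Ctx G W H A σ) (hT : T ∈ subs W) (h19 : σ 19 0 = T) (h22 : σ 22 0 = 0)
    (hv : σ 2 (T * 2 ^ n + T) = un G (A ||| T)) :
    ∃ τ, (std n (keys n W) keys_lt).Run split σ τ 10 ∧ Agree {2, 3, 13, 29, 30, 31} σ τ ∧
      (∀ B, B ≠ T → cover n W (τ 2) B = cover n W (σ 2) B) ∧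
      (∀ j, τ 2 j = if j = T * 2 ^ n + T then 0 else σ 2 j) ∧
      (∀ j, τ 3 j = if j = A ||| T ∨ j = RAM.dif (2 ^ n - 1) (A ||| T) then un G j else σ 3 j) := by
  have hTn := lt_of_mem_subs hT hWn
  have k1 := pair_mem_keys hWn hT (self_mem_subs T)
  have hor : A ||| T < 2 ^ n := Nat.or_lt_two_pow hAn hTn
  have hdi : RAM.dif (2 ^ n - 1) (A ||| T) < 2 ^ n := (dif_le _ _).trans_lt (by
    have := Nat.two_pow_pos n; omega)
  have hun : un G (A ||| T) < 2 ^ (std n (keys n W) keys_lt).b := lt_word (by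
    have := un_le G (A ||| T); have := Nat.two_pow_pos n; omega)
  have hkl : T * 2 ^ n + T < 2 ^ (std n (keys n W) keys_lt).b := by
    refine (keys_lt _ k1).trans_le ?_
    rw [show (4 : ℕ) = 2 ^ 2 from rfl, ← pow_mul]
    exact Nat.pow_le_pow_right (by norm_num) (by simp only [std]; omega)
  have h4 : 1 ≤ 2 ^ n := Nat.one_le_two_pow
  refine ⟨upd (upd (upd (upd (upd (upd (upd σ 29 0 T) 30 0 (T * 2 ^ n + T)) 31 0 (un G (A ||| T))) 2
      (T * 2 ^ n + T) 0) 13 0 (A ||| T)) 3 (A ||| T) (un G (A ||| T))) 3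
      (RAM.dif (2 ^ n - 1) (A ||| T)) (un G (A ||| T)),
    (step_set (k := 8) (by decide) rfl (by simp [h19, h22]) mem_dom (lt_word (by omega)) <|
    step_set (by decide) rfl (by simp [h19]) mem_dom hkl <|
    step_set (by decide) rfl (by simp [hv]) mem_dom hun <|
    step_set (by decide) (by simp) rfl k1 (lt_word (by simp)) <|
    (ite_neg (k := 3) (by decide) (by simp [h22]) <|
    step_set (by decide) rfl (by simp [h19, hc.hA]) mem_dom (lt_word (by omega)) <|
    step_set (by decide) (by simp) (by simp) (mem_dom_table hor) hun <|
    last_set (by decide) (by simp [hc.hP]) (by simp) (mem_dom_table hdi) hun).mono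
      (by omega)).mono (by omega), ?_, ?_, ?_, ?_⟩
  · intro x hx
    simp only [Finset.mem_insert, Finset.mem_singleton, not_or] at hx
    funext j
    simp [hx]
  · intro B hB
    have u1 := cover_update (d := σ 2) (d' := fun j => if j = T * 2 ^ n + T then 0 else σ 2 j) k1
      (fun j hj => if_neg hj) B
    have : ¬ Inside n (T * 2 ^ n + T) B := by
      rw [inside_pair hTn]
      exact fun h => hB (subs_antisymm h.2 h.1)
    rw [if_neg this, if_neg this] at u1
    rw [add_zero, add_zero] at u1
    rw [← u1]
    congr 1
    funext j
    simp
  · intro j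
    simp
  · intro j
    by_cases h1 : j = RAM.dif (2 ^ n - 1) (A ||| T)
    · simp [h1, un_dif_full]
    · by_cases h2 : j = A ||| T
      · simp [h2]
      · simp [h1, h2]

/-- The state when the intervals with upper bound in `P` are done. -/
structure Dist (G : SimpleGraph (Fin n)) (W H A : ℕ) (σ : Store) (P : Finset ℕ) (τ : Store) : Prop where
  agree : Agree scratch σ τ
  cover : ∀ B ∈ subs W, B ∉ P → cover n W (τ 2) B = un G (A ||| B)
  zero : ∀ T ∈ P, ∀ M ∈ subs T, τ 2 (T * 2 ^ n + (T - M)) = 0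
  res : ∀ T ∈ P, τ 3 (A ||| T) = un G (A ||| T) ∧
    τ 3 (RAM.dif (2 ^ n - 1) (A ||| T)) = un G (RAM.dif (2 ^ n - 1) (A ||| T))
  keep : ∀ j, σ 3 j = un G j → τ 3 j = un G j

theorem Dist.congr {W H A : ℕ} {σ τ υ : Store} {P : Finset ℕ} (h : Dist G W H A σ P τ)
    {S : Finset ℕ} (hS : Agree S τ υ) (h2 : 2 ∉ S) (h3 : 3 ∉ S) (hs : S ⊆ scratch) :
    Dist G W H A σ P υ where
  agree := h.agree.trans (hS.mono hs)
  cover := by rw [hS 2 h2]; exact h.cover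
  zero := by rw [hS 2 h2]; exact h.zero
  res := by rw [hS 3 h3]; exact h.res
  keep := by rw [hS 3 h3]; exact h.keep

/-- A bound for the running time of `distribute`. -/
def distTime (W : ℕ) : ℕ := ∑ T ∈ subs W, (∑ _M ∈ subs T, (10 + 4) + 3 + 4) + 3

/-- The state when moreover the intervals with upper bound `T` and difference in `R` are done. -/
structure Part (G : SimpleGraph (Fin n)) (W H A : ℕ) (σ τ : Store) (P : Finset ℕ) (T : ℕ)
    (R : Finset ℕ) (φ : Store) : Prop where
  agree : Agree {2, 3, 13, 22, 23, 24, 29, 30, 31} τ φ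
  cover : ∀ B ∈ subs W, B ∉ P → (B = T → 0 ∉ R) → cover n W (φ 2) B = un G (A ||| B)
  zero : ∀ T ∈ P, ∀ M ∈ subs T, φ 2 (T * 2 ^ n + (T - M)) = 0
  zero' : ∀ M ∈ R, φ 2 (T * 2 ^ n + (T - M)) = 0
  res : ∀ T' ∈ P, φ 3 (A ||| T') = un G (A ||| T') ∧
    φ 3 (RAM.dif (2 ^ n - 1) (A ||| T')) = un G (RAM.dif (2 ^ n - 1) (A ||| T'))
  res' : 0 ∈ R → φ 3 (A ||| T) = un G (A ||| T) ∧
    φ 3 (RAM.dif (2 ^ n - 1) (A ||| T)) = un G (RAM.dif (2 ^ n - 1) (A ||| T))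
  keep : ∀ j, σ 3 j = un G j → φ 3 j = un G j

theorem Part.congr {W H A T : ℕ} {σ τ φ υ : Store} {P R : Finset ℕ} (h : Part G W H A σ τ P T R φ)
    {S : Finset ℕ} (hS : Agree S φ υ) (h2 : 2 ∉ S) (h3 : 3 ∉ S)
    (hs : S ⊆ {2, 3, 13, 22, 23, 24, 29, 30, 31}) : Part G W H A σ τ P T R υ where
  agree := h.agree.trans (hS.mono hs)
  cover := by rw [hS 2 h2]; exact h.cover
  zero := by rw [hS 2 h2]; exact h.zero
  zero' := by rw [hS 2 h2]; exact h.zero'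
  res := by rw [hS 3 h3]; exact h.res
  res' := by rw [hS 3 h3]; exact h.res'
  keep := by rw [hS 3 h3]; exact h.keep

/-- If `M ≠ 0`, splitting preserves all covering weights and touches only entries still to come. If
`M = 0`, the entry is already the answer for `T`, and removing it affects only `B = T`. -/
theorem Part.step {W H A T M : ℕ} (hWn : W < 2 ^ n) (hAn : A < 2 ^ n) {σ τ φ : Store}
    (hT : T ∈ subs W) (hM : M ∈ subs T) (hc : Ctx G W H A φ) (h19 : φ 19 0 = T) (h22 : φ 22 0 = M)
    (h : Part G W H A σ τ ((subs W).filter (T < ·)) T ((subs T).filter (M < ·)) φ) :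
    ∃ υ, (std n (keys n W) keys_lt).Run split φ υ 10 ∧ Agree {2, 3, 13, 29, 30, 31} φ υ ∧
      Part G W H A σ τ ((subs W).filter (T < ·)) T (insert M ((subs T).filter (M < ·))) υ := by
  have hTn := lt_of_mem_subs hT hWn
  have hnot : ∀ B, B ≤ T → B ∉ (subs W).filter (T < ·) := fun B hB h => by
    have := (Finset.mem_filter.1 h).2; omega
  have hnot' : 0 ∉ (subs T).filter (M < ·) := fun h => by
    have := (Finset.mem_filter.1 h).2; omega
  have hcov : ∀ B ∈ subs W, B ≤ T → Env.cover n W (φ 2) B = un G (A ||| B) := fun B hB hBT =>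
    h.cover B hB (hnot B hBT) fun _ => hnot'
  by_cases hM0 : M = 0
  · subst hM0
    have hv : φ 2 (T * 2 ^ n + T) = un G (A ||| T) := by
      -- An interval containing `T` has upper bound at least `T`. Those with a larger upper bound,
      -- or with upper bound `T` and nonzero difference, are already cleared, so only [T, T]
      -- contributes.
      rw [← hcov T hT le_rfl, Env.cover,
        Finset.sum_eq_single_of_mem _ (pair_mem_keys hWn hT (self_mem_subs T)), if_pos]
      · exact (inside_pair hTn).2 ⟨self_mem_subs T, self_mem_subs T⟩
      · intro k hk hne
        split_ifs with hin
        · obtain ⟨T', hT', L, hL, rfl⟩ := exists_of_mem_keys hk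
          have hLT := le_of_mem_subs hL
          have hLM : T' - L ∈ subs T' := by
            rw [sub_eq_dif hL]; exact dif_mem_subs _ _
          obtain ⟨g1, g2⟩ := (inside_pair (lt_of_mem_subs (subs_trans hL hT') hWn)).1 hin
          have hle := le_of_mem_subs g2
          have e : T' - (T' - L) = L := by omega
          by_cases hTT : T' = T
          · subst hTT
            have := h.zero' (T' - L) (Finset.mem_filter.2 ⟨hLM, by
              by_contra h0
              exact hne (by rw [show L = T' by omega])⟩)
            rwa [e] at this
          · have := h.zero T' (Finset.mem_filter.2 ⟨hT', by omega⟩) (T' - L) hLM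
            rwa [e] at this
        · rfl
    obtain ⟨υ, p1, p2, p3, p4, p5⟩ := run_split_zero hWn hAn hc hT h19 h22 hv
    refine ⟨υ, p1, p2, h.agree.trans (p2.mono (by decide)), ?_, ?_, ?_, ?_, ?_, ?_⟩
    · intro B hB hBP hBT
      have hne : B ≠ T := fun e => hBT e (Finset.mem_insert_self _ _)
      rw [p3 B hne]
      exact h.cover B hB hBP fun e => absurd e hne
    · intro T' hT' M' hM'
      rw [p4, h.zero T' hT' M' hM', ite_self]
    · intro M' hM'
      rw [p4]
      rcases Finset.mem_insert.1 hM' with rfl | hM'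
      · rw [Nat.sub_zero, if_pos rfl]
      · rw [h.zero' M' hM', ite_self]
    · intro T' hT'
      rw [p5, p5, (h.res T' hT').1, (h.res T' hT').2, ite_self, ite_self]
      exact ⟨rfl, rfl⟩
    · intro _
      rw [p5, p5, if_pos (.inl rfl), if_pos (.inr rfl)]
      exact ⟨rfl, rfl⟩
    · intro j hj
      rw [p5, h.keep j hj, ite_self]
  · obtain ⟨υ, p1, p2, p3, p4, p5⟩ := run_split hWn hT hM h19 h22 hM0 fun B hB hBT => by
      rw [hcov B hB hBT]; exact un_le G _
    have e3 : υ 3 = φ 3 := p2 3 (by decide)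
    refine ⟨υ, p1, p2.mono (by decide), h.agree.trans (p2.mono (by decide)), ?_, ?_, ?_, ?_, ?_, ?_⟩
    · intro B hB hBP hBT
      rw [p3]
      exact h.cover B hB hBP fun _ => hnot'
    · intro T' hT' M' hM'
      obtain ⟨q1, q2⟩ := Finset.mem_filter.1 hT'
      rw [p5 T' M' hM' (lt_of_mem_subs q1 hWn) (.inl q2)]
      exact h.zero T' hT' M' hM'
    · intro M' hM'
      rcases Finset.mem_insert.1 hM' with rfl | hM'
      · exact p4
      · obtain ⟨q1, q2⟩ := Finset.mem_filter.1 hM'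
        rw [p5 T M' q1 hTn (.inr ⟨rfl, q2⟩)]
        exact h.zero' M' hM'
    · rw [e3]; exact h.res
    · intro h0
      rcases Finset.mem_insert.1 h0 with h0 | h0
      · exact absurd h0.symm hM0
      · exact absurd h0 hnot'
    · rw [e3]; exact h.keep

theorem run_distribute {W H A : ℕ} (hWn : W < 2 ^ n) (hAn : A < 2 ^ n) {σ : Store}
    (hc : Ctx G W H A σ) (h0 : ∀ B ∈ subs W, cover n W (σ 2) B = un G (A ||| B)) :
    ∃ τ, (std n (keys n W) keys_lt).Run distribute σ τ (distTime W) ∧ Dist G W H A σ (subs W) τ := by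
  have hw : ∀ v, v < 2 ^ n → v + 1 < 2 ^ (std n (keys n W) keys_lt).b := fun v hv =>
    lt_word (by omega)
  refine run_forSub (E := std n (keys n W) keys_lt) (v := 19) (u := 20) (m := 21)
    (S := sc 8) (body := forSub 22 23 24 (sc 19) split) (by decide) (by decide) (by decide)
    mem_dom mem_dom mem_dom W (hw W hWn) (fun P τ => Dist G W H A σ P τ)
    (fun T => ∑ _M ∈ subs T, (10 + 4) + 3) σ (by simp [hc.hW]) ?_ ?_ ?_
  · intro T hT τ h h19 h21
    have hTn := lt_of_mem_subs hT hWn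
    obtain ⟨φ, g1, g2⟩ := run_forSub (E := std n (keys n W) keys_lt) (v := 22) (u := 23) (m := 24)
      (S := sc 19) (body := split) (by decide) (by decide) (by decide)
      mem_dom mem_dom mem_dom T (hw T hTn)
      (fun R φ => Part G W H A σ τ ((subs W).filter (T < ·)) T R φ)
      (fun _ => 10) τ (by simp [h19]) (by
        intro M hM φ hp h22 h24
        obtain ⟨υ, q1, q2, q3⟩ := hp.step hWn hAn hT hM
          (hc.agree (h.agree.trans (hp.agree.mono (by decide))))
          (by rw [hp.agree 19 (by decide), h19]) h22
        exact ⟨υ, q1, by rw [q2 22 (by decide), h22], by rw [q2 24 (by decide), h24], fun χ hχ =>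
          q3.congr hχ (by decide) (by decide) (by decide)⟩)
      (fun υ hυ => ⟨hυ.mono (by decide), by
          rw [hυ 2 (by decide)]; exact fun B hB hBP _ => h.cover B hB hBP, by
          rw [hυ 2 (by decide)]; exact h.zero, fun _ h => absurd h (Finset.notMem_empty _), by
          rw [hυ 3 (by decide)]; exact h.res, fun h => absurd h (Finset.notMem_empty _), by
          rw [hυ 3 (by decide)]; exact h.keep⟩)
      (fun D φ υ hp hυ => hp.congr hυ (by decide) (by decide) (by decide))
    refine ⟨φ, g1, by rw [g2.agree 19 (by decide), h19], by rw [g2.agree 21 (by decide), h21],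
      fun υ hυ => Dist.congr ⟨h.agree.trans (g2.agree.mono (by decide)), ?_, ?_, ?_, g2.keep⟩ hυ
        (by decide) (by decide) (by decide)⟩
    · intro B hB hBP
      rw [Finset.mem_insert, not_or] at hBP
      exact g2.cover B hB hBP.2 fun e => absurd e hBP.1
    · intro T' hT'
      rcases Finset.mem_insert.1 hT' with rfl | hT'
      · exact g2.zero'
      · exact g2.zero T' hT'
    · intro T' hT'
      rcases Finset.mem_insert.1 hT' with rfl | hT'
      · exact g2.res' (zero_mem_subs _)
      · exact g2.res T' hT'
  · intro υ hυ
    refine ⟨hυ.mono (by decide), ?_, fun T hT => absurd hT (Finset.notMem_empty _),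
      fun T hT => absurd hT (Finset.notMem_empty _), ?_⟩
    · rw [hυ 2 (by decide)]; exact fun B hB _ => h0 B hB
    · rw [hυ 3 (by decide)]; exact fun _ h => h
  · exact fun P τ υ h hυ => h.congr hυ (by decide) (by decide) (by decide)

/-- Whether the cuts with left side `A` in `H` are processed. -/
noncomputable def SmallSide (G : SimpleGraph (Fin n)) (H A : ℕ) : Prop :=
  pop (act G H A) ≤ pop (act G H (RAM.dif H A))

open Classical in
/-- A bound for the running time of the body of the loop of `count`. -/
noncomputable def bodyTime (G : SimpleGraph (Fin n)) (W H A : ℕ) : ℕ :=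
  if SmallSide G H A then collectTime G W H A + distTime W + 4 else 5

/-- The table of intervals is zero before each `A` and is emptied again by the distribution, so it
can be reused. Each result is also stored for the complementary cut, which pays for skipping the
sides `A` with the larger active part. -/
theorem run_count {W : ℕ} (hWn : W < 2 ^ n) {σ : Store} (ht : Tab G σ) (h7 : σ 7 0 = 2 ^ n)
    (h8 : σ 8 0 = W) (h2 : ∀ k ∈ keys n W, σ 2 k = 0) :
    ∃ τ, (std n (keys n W) keys_lt).Run count σ τ
        (∑ A ∈ subs (RAM.dif (2 ^ n - 1) W), (bodyTime G W (RAM.dif (2 ^ n - 1) W) A + 4) + 4) ∧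
      (∀ s < 2 ^ n, τ 3 s = un G s) ∧ Agree (scratch ∪ {9, 10, 16, 17, 18, 28}) σ τ := by
  set H := RAM.dif (2 ^ n - 1) W with hH
  have h1 := Nat.two_pow_pos n
  have hHn : H < 2 ^ n := (dif_le _ _).trans_lt (by omega)
  set S := scratch ∪ {9, 10, 16, 17, 18, 28} with hS
  obtain ⟨τ, g1, g2, g3, g4, g5⟩ := run_forSub (E := std n (keys n W) keys_lt) (v := 16) (u := 17)
    (m := 18) (S := sc 9) (body := .seq (set 10 (lit 0) (Tm.dif (sc 9) (sc 16)))
      (.seq (set 28 (lit 0) (bin land (sc 16) (get 0 (sc 10))))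
      (.seq (set 14 (lit 0) (bin land (sc 10) (get 0 (sc 16))))
      (.cond (bin lt (get 1 (sc 14)) (get 1 (sc 28))).toExpr .skip (.seq collect distribute)))))
    (by decide) (by decide) (by decide) mem_dom mem_dom mem_dom H (lt_word (by omega))
    (fun P τ => Agree S σ τ ∧ τ 9 0 = H ∧ (∀ k ∈ keys n W, τ 2 k = 0) ∧
      ∀ A ∈ P, SmallSide G H A → ∀ B ∈ subs W, τ 3 (A ||| B) = un G (A ||| B) ∧
        τ 3 (RAM.dif (2 ^ n - 1) (A ||| B)) = un G (RAM.dif (2 ^ n - 1) (A ||| B)))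
    (fun A => bodyTime G W H A) (upd σ 9 0 H) (by simp) (by
      rintro A hA τ ⟨h3, h4, h5, h6⟩ h16 h18
      have hAn := lt_of_mem_subs hA hHn
      have hBn : RAM.dif H A < 2 ^ n := (dif_le _ _).trans_lt hHn
      have ea : ∀ a ∉ S, τ a = σ a := h3
      have ta := ht A hAn
      have tb := ht _ hBn
      have e0 := ea 0 (by decide)
      set φ := upd (upd (upd τ 10 0 (RAM.dif H A)) 28 0 (act G H A)) 14 0 (act G H (RAM.dif H A)) with hφ
      have hag : Agree {10, 28, 14} τ φ :=
        (((Agree.refl _ _).upd (by decide) _ _).upd (by decide) _ _).upd (by decide) _ _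
      have hact : act G H A < 2 ^ n := Nat.and_le_left.trans_lt hAn
      have hact' : act G H (RAM.dif H A) < 2 ^ n := Nat.and_le_left.trans_lt hBn
      have start : ∀ {p υ k}, (std n (keys n W) keys_lt).Run p φ υ k →
          (std n (keys n W) keys_lt).Run (.seq (set 10 (lit 0) (Tm.dif (sc 9) (sc 16)))
            (.seq (set 28 (lit 0) (bin land (sc 16) (get 0 (sc 10))))
            (.seq (set 14 (lit 0) (bin land (sc 10) (get 0 (sc 16)))) p))) τ υ (k + 1 + 1 + 1) := fun h =>
        step_set (by decide) rfl (by simp [h4, h16]) mem_dom (lt_word (by omega)) <|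
        step_set (by decide) rfl (by simp [h16, e0, tb.1, act]) mem_dom (lt_word (by omega)) <|
        step_set (by decide) rfl (by simp [h16, e0, ta.1, act, dif_dif hA]) mem_dom (lt_word (by omega)) h
      have hctx : Ctx G W H A φ := by
        refine ⟨fun s hs => ?_, ?_, ?_, ?_, ?_, ?_, ?_⟩
        · rw [hag 0 (by decide), hag 1 (by decide), ea 0 (by decide), ea 1 (by decide)]
          exact ht s hs
        · rw [hag 7 (by decide), ea 7 (by decide), h7]
        · rw [hag 8 (by decide), ea 8 (by decide), h8]
        · rw [hag 9 (by decide), h4]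
        · rw [hag 16 (by decide), h16]
        · simp [hφ]
        · simp [hφ]
      have hcond : (bin lt (get 1 (sc 14)) (get 1 (sc 28))).ev (std n (keys n W) keys_lt).n φ = 0 ↔
          SmallSide G H A := by
        simp only [Tm.ev, Tm.sc, apply_lt_eq_zero]
        have e14 : φ 14 0 = act G H (RAM.dif H A) := by simp [hφ]
        rw [hctx.hact, e14, (hctx.tab _ hact).2, (hctx.tab _ hact').2, SmallSide]
      by_cases hs : SmallSide G H A
      · have hz : ∀ k ∈ keys n W, φ 2 k = 0 := by rw [hag 2 (by decide)]; exact h5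
        obtain ⟨χ, c1, c2, c3⟩ := run_collect hWn hHn hA hctx (fun k hk => by
          rw [hz k hk, zero_add]
          exact (lt_word (K := keys n W) (hK := keys_lt) (by have := hits_le (G := G) hWn hH hA hk; omega)))
        obtain ⟨υ, d1, d2⟩ := run_distribute hWn hAn (hctx.agree (c2.mono (by decide))) (fun B hB => by
          rw [← cover_hits hWn hH hA hB]
          exact Finset.sum_congr rfl fun k hk => by rw [c3, hz k hk, zero_add])
        refine ⟨υ, ?_, ?_, ?_, fun ω hω => ⟨?_, ?_, ?_, ?_⟩⟩
        · rw [bodyTime, if_pos hs]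
          exact start (ite_neg (by decide) (hcond.2 hs) (c1.seq d1))
        · rw [d2.agree 16 (by decide), c2 16 (by decide), hag 16 (by decide), h16]
        · rw [d2.agree 18 (by decide), c2 18 (by decide), hag 18 (by decide), h18]
        · exact h3.trans ((hag.mono (by decide)).trans ((c2.mono (by decide)).trans
            ((d2.agree.mono (by decide)).trans (hω.mono (by decide)))))
        · rw [hω 9 (by decide), d2.agree 9 (by decide), c2 9 (by decide), hag 9 (by decide), h4]
        · intro k hk
          obtain ⟨T, hT, L, hL, rfl⟩ := exists_of_mem_keys hk
          have hLM : T - L ∈ subs T := by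
            rw [sub_eq_dif hL]; exact dif_mem_subs _ _
          have := d2.zero T hT _ hLM
          have hLT := le_of_mem_subs hL
          rw [show T - (T - L) = L by omega] at this
          rw [hω 2 (by decide), this]
        · intro A' hA' hs' B hB
          have e3 : χ 3 = τ 3 := by rw [c2 3 (by decide), hag 3 (by decide)]
          rw [hω 3 (by decide)]
          rcases Finset.mem_insert.1 hA' with rfl | hA'
          · exact d2.res B hB
          · have := h6 A' hA' hs' B hB
            rw [← e3] at this
            exact ⟨d2.keep _ this.1, d2.keep _ this.2⟩
      · refine ⟨φ, ?_, ?_, ?_, fun ω hω => ⟨?_, ?_, ?_, ?_⟩⟩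
        · rw [bodyTime, if_neg hs]
          exact start (ite_pos (by decide) (mt hcond.1 hs) (run_skip φ))
        · rw [hag 16 (by decide), h16]
        · rw [hag 18 (by decide), h18]
        · exact h3.trans ((hag.mono (by decide)).trans (hω.mono (by decide)))
        · rw [hω 9 (by decide), hag 9 (by decide), h4]
        · rw [hω 2 (by decide), hag 2 (by decide)]; exact h5
        · intro A' hA' hs' B hB
          rw [hω 3 (by decide), hag 3 (by decide)]
          rcases Finset.mem_insert.1 hA' with rfl | hA'
          · exact absurd hs' hs
          · exact h6 A' hA' hs' B hB)
    (by
      intro υ hυ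
      refine ⟨((Agree.refl _ _).upd (by decide) _ _).trans (hυ.mono (by decide)), ?_, ?_, fun A hA =>
        absurd hA (Finset.notMem_empty _)⟩
      · rw [hυ 9 (by decide)]; simp
      · rw [hυ 2 (by decide)]; simpa using h2)
    (by
      rintro P τ υ ⟨h3, h4, h5, h6⟩ h
      refine ⟨h3.trans (h.mono (by decide)), ?_, ?_, ?_⟩
      · rw [h 9 (by decide), h4]
      · rw [h 2 (by decide)]; exact h5
      · rw [h 3 (by decide)]; exact h6)
  refine ⟨τ, (step_set (by decide) rfl (by simp [h7, h8, hH]) mem_dom (lt_word (by omega)) g1).mono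
    (by omega), fun s hs => ?_, g2⟩
  have hsW : s &&& W ∈ subs W := mem_subs_iff.2 fun i h => (testBit_land.1 h).2
  have hsH : s &&& H ∈ subs H := mem_subs_iff.2 fun i h => (testBit_land.1 h).2
  have hHb : ∀ i, H.testBit i = true ↔ i < n ∧ ¬ W.testBit i = true := fun i => by
    rw [hH, testBit_dif, testBit_full]
  have hsn := lt_two_pow_iff.1 hs
  have hWb := lt_two_pow_iff.1 hWn
  -- Of `s ∩ H` and its complement in `H`, one has the smaller active part. In the second case `s`
  -- is filled in as the complement of the processed cut.
  rcases Nat.le_total (pop (act G H (s &&& H))) (pop (act G H (RAM.dif H (s &&& H)))) with h | h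
  · have := (g5 _ hsH h _ hsW).1
    have e : s &&& H ||| s &&& W = s := testBit_ext fun i => by
      rw [testBit_lor, testBit_land, testBit_land, hHb]
      have := hsn i
      tauto
    rwa [e] at this
  · have := (g5 _ (dif_mem_subs H (s &&& H)) (by rw [SmallSide, dif_dif hsH]; exact h) _
      (dif_mem_subs W (s &&& W))).2
    have e : RAM.dif (2 ^ n - 1) (RAM.dif H (s &&& H) ||| RAM.dif W (s &&& W)) = s :=
      testBit_ext fun i => by
        simp only [testBit_dif, testBit_lor, testBit_land, testBit_full, hHb]
        have := hsn i
        have := hWb i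
        tauto
    rwa [e] at this

end Env
end RAM

/-! ### Dynamic programming over sets of vertices -/

namespace RAM

open Tm BinOp

/-- `p`, `c`, `r` give the optimal value for the set `A`, the last vertex of an optimal
ordering, and the remaining set. -/
structure Best {n : ℕ} (G : SimpleGraph (Fin n)) (p c r : ℕ → ℕ) (A : ℕ) : Prop where
  mem : A.testBit (c A) = true
  rest : r A = A - 2 ^ c A
  val : p A = max (un G A) (p (A - 2 ^ c A))
  le : ∀ i, A.testBit i = true → p (A - 2 ^ c A) ≤ p (A - 2 ^ i)

/-- Optimality at `A` refers only to values at numbers up to `A`, so later entries do not disturb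
it. -/
theorem Best.congr {n : ℕ} {G : SimpleGraph (Fin n)} {p c r p' c' r' : ℕ → ℕ} {A : ℕ}
    (h : Best G p c r A) (hp : ∀ B ≤ A, p' B = p B) (hc : c' A = c A) (hr : r' A = r A) :
    Best G p' c' r' A where
  mem := by rw [hc]; exact h.mem
  rest := by rw [hc, hr]; exact h.rest
  val := by rw [hc, hp _ le_rfl, hp _ (Nat.sub_le _ _)]; exact h.val
  le := fun i hi => by rw [hc, hp _ (Nat.sub_le _ _), hp _ (Nat.sub_le _ _)]; exact h.le i hi

/-- Optimal values for all sets. -/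
structure Opt {n : ℕ} (G : SimpleGraph (Fin n)) (p c r : ℕ → ℕ) : Prop where
  zero : p 0 = 0
  best : ∀ A < 2 ^ n, A ≠ 0 → Best G p c r A

namespace Env

variable {n : ℕ} {G : SimpleGraph (Fin n)} {K : Finset ℕ} {hK : ∀ k ∈ K, k < 4 ^ n}

/-- The value `2 ^ n + 1` stands for infinity: it exceeds all tabulated values, so the first vertex
of `A` that is met replaces it. -/
theorem run_relax {A j : ℕ} (hj : j < n) (hA : A < 2 ^ n) {σ : Store}
    (hle : ∀ B < A, σ 4 B ≤ 2 ^ n)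
    (h15 : σ 15 0 = A) (h11 : σ 11 0 = j) (h12 : σ 12 0 = 2 ^ j)
    (h : (σ 28 0 = 2 ^ n + 1 ∧ ∀ i < j, ¬ A.testBit i = true) ∨ ∃ c, A.testBit c = true ∧
      σ 28 0 = σ 4 (A - 2 ^ c) ∧ σ 29 0 = c ∧ σ 30 0 = A - 2 ^ c ∧
        ∀ i < j, A.testBit i = true → σ 4 (A - 2 ^ c) ≤ σ 4 (A - 2 ^ i)) :
    ∃ τ, (std n K hK).Run relax σ τ 5 ∧ Agree {28, 29, 30} σ τ ∧
    ((τ 28 0 = 2 ^ n + 1 ∧ ∀ i < j + 1, ¬ A.testBit i = true) ∨ ∃ c, A.testBit c = true ∧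
      τ 28 0 = σ 4 (A - 2 ^ c) ∧ τ 29 0 = c ∧ τ 30 0 = A - 2 ^ c ∧
        ∀ i < j + 1, A.testBit i = true → σ 4 (A - 2 ^ c) ≤ σ 4 (A - 2 ^ i)) := by
  have hn := @Nat.lt_two_pow_self n
  have hbit : (bin land (sc 15) (sc 12)).ev (std n K hK).n σ ≠ 0 ↔ A.testBit j = true := by
    simp only [Tm.ev, Tm.sc, BinOp.apply, h15, h12]
    exact and_two_pow_ne_zero
  by_cases hb : A.testBit j = true
  · have hpos : A - 2 ^ j < A := by
      have := le_of_mem_subs (two_pow_mem_subs hb)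
      have := Nat.two_pow_pos j
      omega
    have hlt : (bin lt (get 4 (bin sub (sc 15) (sc 12))) (sc 28)).ev (std n K hK).n σ = 0 ↔
        σ 28 0 ≤ σ 4 (A - 2 ^ j) := by
      simp only [Tm.ev, Tm.sc, apply_lt_eq_zero]
      simp only [BinOp.apply, h15, h12]
    by_cases hl : σ 28 0 ≤ σ 4 (A - 2 ^ j)
    · refine ⟨σ, (ite_pos (by decide) (hbit.2 hb) (ite_neg (by decide) (hlt.2 hl)
        (run_skip σ))).mono (by omega), Agree.refl _ _, .inr ?_⟩
      rcases h with ⟨h1, -⟩ | ⟨c, h1, h2, h3, h4, h5⟩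
      · have := hle _ hpos; omega
      · refine ⟨c, h1, h2, h3, h4, fun i hi hbi => ?_⟩
        rcases Nat.lt_succ_iff_lt_or_eq.1 hi with hi | rfl
        · exact h5 i hi hbi
        · omega
    · refine ⟨upd (upd (upd σ 28 0 (σ 4 (A - 2 ^ j))) 29 0 j) 30 0 (A - 2 ^ j),
        ite_pos (by decide) (hbit.2 hb) (ite_pos (by decide) (mt hlt.1 hl)
        (step_set (by decide) rfl (by simp [h15, h12]) mem_dom
          (lt_word (by have := hle _ hpos; omega)) <|
        step_set (by decide) rfl (by simp [h11]) mem_dom (lt_word (by omega)) <|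
        last_set (by decide) rfl (by simp [h15, h12]) mem_dom (lt_word (by omega)))),
        (((Agree.refl _ _).upd (by decide) _ _).upd (by decide) _ _).upd (by decide) _ _,
        .inr ⟨j, hb, by simp, by simp, by simp, fun i hi hbi => ?_⟩⟩
      rcases Nat.lt_succ_iff_lt_or_eq.1 hi with hi | rfl
      · rcases h with ⟨-, h1⟩ | ⟨c, h1, h2, h3, h4, h5⟩
        · exact absurd hbi (h1 i hi)
        · have := h5 i hi hbi
          omega
      · exact le_rfl
  · refine ⟨σ, (ite_neg (by decide) (not_not.1 (mt hbit.1 hb)) (run_skip σ)).mono (by omega),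
      Agree.refl _ _, ?_⟩
    rcases h with ⟨h1, h2⟩ | ⟨c, h1, h2, h3, h4, h5⟩
    · refine .inl ⟨h1, fun i hi => ?_⟩
      rcases Nat.lt_succ_iff_lt_or_eq.1 hi with hi | rfl
      · exact h2 i hi
      · exact hb
    · refine .inr ⟨c, h1, h2, h3, h4, fun i hi hbi => ?_⟩
      rcases Nat.lt_succ_iff_lt_or_eq.1 hi with hi | rfl
      · exact h5 i hi hbi
      · exact absurd hbi hb

/-- Increasing order of bitsets is compatible with removing elements, so all `A - 2 ^ i` are
tabulated before `A`. The empty set keeps its initial value 0. -/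
theorem run_optimize {σ : Store} (h7 : σ 7 0 = 2 ^ n) (h3 : ∀ s < 2 ^ n, σ 3 s = un G s)
    (h4 : σ 4 0 = 0) : ∃ τ, (std n K hK).Run optimize σ τ (2 ^ n * (n * 8 + 12) + 2) ∧
      Opt G (τ 4) (τ 5) (τ 6) ∧ Agree {4, 5, 6, 11, 12, 15, 28, 29, 30} σ τ := by
  have hn := @Nat.lt_two_pow_self n
  obtain ⟨τ, g1, g2, g3, g4, g5⟩ := run_forRange (E := std n K hK) (s := 15) (bound := sc 7)
    (body := .cond (sc 15).toExpr
      (.seq (set 28 (lit 0) (bin add (sc 7) (lit 1)))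
      (.seq (forBits 11 12 relax)
      (.seq (.cond (bin lt (get 3 (sc 15)) (sc 28)).toExpr
        (set 4 (sc 15) (sc 28)) (set 4 (sc 15) (get 3 (sc 15))))
      (.seq (set 5 (sc 15) (sc 29)) (set 6 (sc 15) (sc 30)))))) .skip)
    (by decide) mem_dom (2 ^ n) (lt_word (by omega))
    (fun A τ => Agree {4, 5, 6, 11, 12, 15, 28, 29, 30} σ τ ∧ τ 4 0 = 0 ∧
      (∀ B < A, τ 4 B ≤ 2 ^ n) ∧ ∀ B < A, B ≠ 0 → Best G (τ 4) (τ 5) (τ 6) B) (n * 8 + 10)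
    (fun A τ h => by simp [h.1 7 (by decide), h7]) (by
      rintro A hA τ ⟨ha, hz, hle, hbest⟩ h15
      by_cases hA0 : A = 0
      · subst hA0
        refine ⟨τ, (ite_neg (by decide) (by simpa using h15) (run_skip τ)).mono (by omega), h15,
          fun υ hυ => ⟨ha.trans (hυ.mono (by decide)), by rw [hυ 4 (by decide), hz], ?_, ?_⟩⟩
        · intro B hB
          obtain rfl : B = 0 := by omega
          rw [hυ 4 (by decide), hz]; omega
        · intro B hB hB0
          omega
      · set φ := upd τ 28 0 (2 ^ n + 1) with hφ
        have hφ' : Agree {28} τ φ := (Agree.refl _ _).upd (by decide) _ _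
        obtain ⟨ψ, p1, ⟨p2, p3⟩, -⟩ := run_forBits (E := std n K hK) (i := 11) (p := 12)
          (body := relax) (by decide) (by decide) std_lt mem_dom mem_dom
          (fun j ψ => Agree {11, 12, 28, 29, 30} τ ψ ∧
            ((ψ 28 0 = 2 ^ n + 1 ∧ ∀ i < j, ¬ A.testBit i = true) ∨ ∃ c, A.testBit c = true ∧
              ψ 28 0 = τ 4 (A - 2 ^ c) ∧ ψ 29 0 = c ∧ ψ 30 0 = A - 2 ^ c ∧
              ∀ i < j, A.testBit i = true → τ 4 (A - 2 ^ c) ≤ τ 4 (A - 2 ^ i))) 5 (by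
            rintro j hj ψ ⟨q1, q2⟩ q11 q12
            have e4 : ψ 4 = τ 4 := q1 4 (by decide)
            obtain ⟨χ, r1, r2, r3⟩ := run_relax (K := K) (hK := hK) hj hA (σ := ψ)
              (by rw [e4]; exact hle) (by rw [q1 15 (by decide), h15]) q11 q12 (by rw [e4]; exact q2)
            refine ⟨χ, r1, by rw [r2 11 (by decide), q11], by rw [r2 12 (by decide), q12], fun ω hω =>
              ⟨q1.trans ((r2.mono (by decide)).trans (hω.mono (by decide))), ?_⟩⟩
            rw [hω 28 (by decide), hω 29 (by decide), hω 30 (by decide), ← e4]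
            exact r3) φ
          (fun ψ hψ => ⟨(hφ'.mono (by decide)).trans (hψ.mono (by decide)), .inl ⟨by
            rw [hψ 28 (by decide)]; simp [hφ], fun i hi => absurd hi (by omega)⟩⟩)
        obtain ⟨c, c1, c2, c3, c4, c5⟩ : ∃ c, A.testBit c = true ∧
            ψ 28 0 = τ 4 (A - 2 ^ c) ∧ ψ 29 0 = c ∧ ψ 30 0 = A - 2 ^ c ∧
            ∀ i < n, A.testBit i = true → τ 4 (A - 2 ^ c) ≤ τ 4 (A - 2 ^ i) := by
          refine p3.resolve_left fun h => hA0 (eq_zero_iff.2 fun i hi => ?_)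
          exact h.2 i (lt_two_pow_iff.1 hA i hi) hi
        have hpos : A - 2 ^ c < A := by
          have := le_of_mem_subs (two_pow_mem_subs c1)
          have := Nat.two_pow_pos c
          omega
        have hcn := lt_two_pow_iff.1 hA c c1
        have hbl := hle _ hpos
        have hul := un_le G A
        have e3 : ψ 3 A = un G A := by rw [p2 3 (by decide), ha 3 (by decide), h3 A hA]
        have e15 : ψ 15 0 = A := by rw [p2 15 (by decide), h15]
        have e4 : ψ 4 = τ 4 := p2 4 (by decide)
        have e5 : ψ 5 = τ 5 := p2 5 (by decide)
        have e6 : ψ 6 = τ 6 := p2 6 (by decide)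
        have hmax : max (un G A) (τ 4 (A - 2 ^ c)) < 2 ^ (std n K hK).b :=
          lt_word (by have := max_le hul hbl; omega)
        have hcond : (bin lt (get 3 (sc 15)) (sc 28)).ev (std n K hK).n ψ = 0 ↔
            τ 4 (A - 2 ^ c) ≤ un G A := by
          simp only [Tm.ev, Tm.sc, apply_lt_eq_zero]
          rw [e15, e3, c2]
        have hrun : (std n K hK).Run (.cond (bin lt (get 3 (sc 15)) (sc 28)).toExpr
            (set 4 (sc 15) (sc 28)) (set 4 (sc 15) (get 3 (sc 15)))) ψ
            (upd ψ 4 A (max (un G A) (τ 4 (A - 2 ^ c)))) 2 := by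
          refine run_ite (by decide) (fun h => ?_) (fun h => ?_)
          · exact last_set (by decide) (by simp [e15]) (by
              have := mt hcond.2 h
              simp [c2]; omega) (mem_dom_table hA) hmax
          · exact last_set (by decide) (by simp [e15]) (by
              have := hcond.1 h
              simp [e15, e3, this]) (mem_dom_table hA) hmax
        refine ⟨upd (upd (upd ψ 4 A (max (un G A) (τ 4 (A - 2 ^ c)))) 5 A c) 6 A (A - 2 ^ c),
          (ite_pos (by decide) (by simpa [h15] using hA0)
          (step_set (by decide) rfl (by simp [ha 7 (by decide), h7]) mem_dom (lt_word (by omega)) <|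
          p1.seq <| hrun.seq <|
          step_set (by decide) (by simp [e15]) (by simp [c3]) (mem_dom_table hA) (lt_word (by omega)) <|
          last_set (by decide) (by simp [e15]) (by simp [c4]) (mem_dom_table hA)
            (lt_word (by omega)))).mono (by simp only [std_n]; omega), by simp [e15], fun υ hυ => ?_⟩
        have u4 : υ 4 = fun B => if B = A then max (un G A) (τ 4 (A - 2 ^ c)) else τ 4 B := by
          rw [hυ 4 (by decide)]; funext B; simp [e4]
        have u5 : υ 5 = fun B => if B = A then c else τ 5 B := by
          rw [hυ 5 (by decide)]; funext B; simp [e5]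
        have u6 : υ 6 = fun B => if B = A then A - 2 ^ c else τ 6 B := by
          rw [hυ 6 (by decide)]; funext B; simp [e6]
        refine ⟨ha.trans ((p2.mono (by decide)).trans ((((Agree.refl _ _).upd (by decide) _ _).upd
          (by decide) _ _ |>.upd (by decide) _ _).trans (hυ.mono (by decide)))), ?_, ?_, ?_⟩
        · rw [u4]; simpa [Ne.symm hA0] using hz
        · intro B hB
          rw [u4]
          by_cases hBA : B = A
          · simp [hBA, hul, hbl]
          · simp only [if_neg hBA]; exact hle B (by omega)
        · intro B hB hB0
          by_cases hBA : B = A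
          · subst hBA
            have hne : ∀ i, B.testBit i = true → B - 2 ^ i ≠ B := fun i hi => by
              have := le_of_mem_subs (two_pow_mem_subs hi)
              have := Nat.two_pow_pos i
              omega
            refine ⟨?_, ?_, ?_, fun i hi => ?_⟩
            · simp [u5, c1]
            · simp [u5, u6]
            · simp [u4, u5, hne c c1]
            · simp only [u4, u5, if_true, if_neg (hne c c1), if_neg (hne i hi)]
              exact c5 i (lt_two_pow_iff.1 hA i hi) hi
          · refine (hbest B (by omega) hB0).congr (fun C hC => ?_) ?_ ?_
            · have : C ≠ A := by omega
              simp [u4, this]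
            · simp [u5, hBA]
            · simp [u6, hBA]) σ
    (fun υ hυ => ⟨hυ.mono (by decide), by rw [hυ 4 (by decide), h4], fun B hB => by omega,
      fun B hB => by omega⟩)
  exact ⟨τ, g1, ⟨g3, g5⟩, g2⟩

end Env
end RAM

/-! ### Reading off an optimal ordering -/

namespace RAM

open Tm BinOp

theorem pop_full (n : ℕ) : pop (2 ^ n - 1) = n := by
  have : bitsOf (2 ^ n - 1) = Finset.range n := by
    ext i
    rw [mem_bitsOf, testBit_full, Finset.mem_range]
  rw [pop, this, Finset.card_range]

theorem pop_sub {s i : ℕ} (h : s.testBit i = true) : pop (s - 2 ^ i) + 1 = pop s := by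
  have h' : ¬ (s - 2 ^ i).testBit i = true := fun h' => ((testBit_sub_two_pow h i).1 h').2 rfl
  have hle := le_of_mem_subs (two_pow_mem_subs h)
  have := pop_add h'
  rw [show 2 ^ i + (s - 2 ^ i) = s by omega] at this
  exact this.symm

theorem ne_zero_of_pop {s : ℕ} (h : 0 < pop s) : s ≠ 0 := by
  rintro rfl
  rw [pop_zero] at h
  omega

variable {n : ℕ} {G : SimpleGraph (Fin n)}

/-- Each application of `r` removes exactly one vertex; hence the iterates stay nonempty for all `j
< n`. -/
theorem Opt.iterate {p c r : ℕ → ℕ} (h : Opt G p c r) {j : ℕ} (hj : j ≤ n) :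
    r^[j] (2 ^ n - 1) < 2 ^ n ∧ pop (r^[j] (2 ^ n - 1)) = n - j := by
  induction j with
  | zero => exact ⟨by have := Nat.two_pow_pos n; rw [Function.iterate_zero, id]; omega, pop_full n⟩
  | succ j ih =>
    obtain ⟨h1, h2⟩ := ih (by omega)
    have hb := h.best _ h1 (ne_zero_of_pop (by omega))
    rw [Function.iterate_succ_apply', hb.rest]
    have := pop_sub hb.mem
    exact ⟨(Nat.sub_le _ _).trans_lt h1, by omega⟩

theorem Opt.iterate_ne_zero {p c r : ℕ → ℕ} (h : Opt G p c r) {j : ℕ} (hj : j < n) :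
    r^[j] (2 ^ n - 1) ≠ 0 := by
  obtain ⟨-, h2⟩ := h.iterate hj.le
  exact ne_zero_of_pop (by omega)

theorem Opt.choice_lt {p c r : ℕ → ℕ} (h : Opt G p c r) {j : ℕ} (hj : j < n) :
    c (r^[j] (2 ^ n - 1)) < n :=
  lt_two_pow_iff.1 (h.iterate hj.le).1 _ (h.best _ (h.iterate hj.le).1 (h.iterate_ne_zero hj)).mem

namespace Env

variable {K : Finset ℕ} {hK : ∀ k ∈ K, k < 4 ^ n}

/-- The vertex removed from the `j`-th iterate has position `n - 1 - j` and goes to that memory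
cell, which is index `n - 2 - j` of array 32. Position 0 is left over: its cell still holds `n`, on
which all addresses depend. -/
theorem run_output (hn0 : 1 ≤ n) {σ : Store} (h7 : σ 7 0 = 2 ^ n)
    (h : Opt G (σ 4) (σ 5) (σ 6)) : ∃ τ, (std n K hK).Run output σ τ (n * 4 + 3) ∧
      τ 5 (τ 15 0) = σ 5 ((σ 6)^[n - 1] (2 ^ n - 1)) ∧
      ∀ i < n - 1, τ 32 i = σ 5 ((σ 6)^[n - 2 - i] (2 ^ n - 1)) := by
  have hn := @Nat.lt_two_pow_self n
  obtain ⟨τ, g1, g2, g3, g4, g5⟩ := run_iter (E := std n K hK) (e := sc 11)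
    (body := .seq (set 32 (bin sub (sc 11) (lit 1)) (get 5 (sc 15)))
    (.seq (set 15 (lit 0) (get 6 (sc 15)))
    (set 11 (lit 0) (bin sub (sc 11) (lit 1))))) (by decide) (n - 1)
    (fun j τ => Agree {32, 15, 11} σ τ ∧ τ 15 0 = (σ 6)^[j] (2 ^ n - 1) ∧ τ 11 0 = n - 1 - j ∧
      ∀ i, n - 1 - j ≤ i → i < n - 1 → τ 32 i = σ 5 ((σ 6)^[n - 2 - i] (2 ^ n - 1))) (fun _ => 3)
    (by
      rintro j hj τ ⟨h1, h2, h3, h4⟩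
      refine ⟨by simp [h3]; omega, ?_⟩
      have hc := h.choice_lt (j := j) (by omega)
      have e5 : τ 5 = σ 5 := h1 5 (by decide)
      have e6 : τ 6 = σ 6 := h1 6 (by decide)
      have hit := h.iterate (j := j + 1) (by omega)
      have hit' : σ 6 ((σ 6)^[j] (2 ^ n - 1)) = (σ 6)^[j + 1] (2 ^ n - 1) :=
        (Function.iterate_succ_apply' _ _ _).symm
      refine ⟨upd (upd (upd τ 32 (n - 1 - j - 1) (σ 5 ((σ 6)^[j] (2 ^ n - 1)))) 15 0
        ((σ 6)^[j + 1] (2 ^ n - 1))) 11 0 (n - 1 - j - 1),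
        step_set (by decide) (by simp [h3]) (by simp [h2, e5])
          (show _ ∈ doms n K 32 by simp [doms]; omega) (lt_word (by omega)) <|
        step_set (by decide) rfl (by simp [h2, e6, hit']) mem_dom (lt_word (by omega)) <|
        last_set (by decide) rfl (by simp [h3]) mem_dom (lt_word (by omega)), ?_, by simp, by
          simp; omega, ?_⟩
      · exact ((h1.upd (by decide) _ _).upd (by decide) _ _).upd (by decide) _ _
      · intro i hi hi'
        by_cases he : i = n - 1 - j - 1
        · subst he
          simp [show n - 2 - (n - 1 - j - 1) = j by omega]
        · simpa [he] using h4 i (by omega) hi')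
    (by rintro τ ⟨-, -, h3, -⟩; simp [h3]) (upd (upd σ 15 0 (2 ^ n - 1)) 11 0 (n - 1))
    ⟨((Agree.refl _ _).upd (by decide) _ _).upd (by decide) _ _, by simp, by simp,
      fun i hi hi' => by omega⟩
  refine ⟨τ, (step_set (by decide) rfl (by simp [h7]) mem_dom (lt_word (by omega)) <|
    step_set (by decide) rfl (by simp) mem_dom (lt_word (by omega)) g1).mono ?_, ?_, ?_⟩
  · simp only [Finset.sum_const, Finset.card_range, smul_eq_mul]
    omega
  · rw [g3, g2 5 (by decide)]
  · intro i hi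
    exact g5 i (by omega) hi

end Env
end RAM

/-! ### Caterpillars and the optimality of the ordering -/

open RAM

namespace BooleanWidth

variable {n : ℕ} {G : SimpleGraph (Fin n)}

theorem boolDim_vset (s : ℕ) : boolDim G (vset n s) = Real.logb 2 (un G s) := rfl

theorem one_le_un (s : ℕ) : 1 ≤ un G s := by
  rw [Nat.one_le_iff_ne_zero]
  intro h
  rw [un, Set.ncard_eq_zero (Set.toFinite _)] at h
  have : nbhd G ∅ ∩ (vset n s)ᶜ ∈ UN G (vset n s) := ⟨∅, Set.empty_subset _, rfl⟩
  rw [h] at this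
  exact this

/-- The bitset of the labels of a list of vertices. -/
def code : List (Fin n) → ℕ
  | [] => 0
  | v :: l => 2 ^ (v : ℕ) ||| code l

theorem testBit_code {l : List (Fin n)} {i : ℕ} :
    (code l).testBit i = true ↔ ∃ v ∈ l, (v : ℕ) = i := by
  induction l with
  | nil => simp [code]
  | cons v l ih => rw [code, testBit_lor, testBit_two_pow_iff, ih]; simp

theorem vset_code (l : List (Fin n)) : vset n (code l) = {v | v ∈ l} := by
  ext v
  rw [mem_vset, testBit_code]
  simp only [Set.mem_ofPred_eq]
  exact ⟨fun ⟨w, hw, h⟩ => Fin.ext h ▸ hw, fun h => ⟨v, h, rfl⟩⟩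

theorem code_lt (l : List (Fin n)) : code l < 2 ^ n := by
  rw [lt_two_pow_iff]
  intro i hi
  obtain ⟨v, -, rfl⟩ := testBit_code.1 hi
  exact v.2

theorem code_append_singleton_sub {l : List (Fin n)} {v : Fin n} (hv : v ∉ l) :
    code (l ++ [v]) - 2 ^ (v : ℕ) = code l := by
  have hb : (code (l ++ [v])).testBit v = true := testBit_code.2 ⟨v, by simp, rfl⟩
  refine testBit_ext fun i => ?_
  rw [testBit_sub_two_pow hb, testBit_code, testBit_code]
  constructor
  · rintro ⟨⟨w, hw, rfl⟩, hne⟩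
    rw [List.mem_append, List.mem_singleton] at hw
    exact ⟨w, hw.resolve_right fun h => hne (by rw [h]), rfl⟩
  · rintro ⟨w, hw, rfl⟩
    exact ⟨⟨w, List.mem_append_left _ hw, rfl⟩, fun h => hv (Fin.ext h ▸ hw)⟩

namespace DecTree

theorem boolDim_le_boolWidth (T : DecTree (Fin n)) : boolDim G T.verts ≤ T.boolWidth G := by
  cases T with
  | leaf v => exact le_rfl
  | node l r => exact le_max_left _ _

/-- Leaf cuts are common to all decompositions, so they never make an ordering worse than another
tree. -/
theorem singleton_le_boolWidth {T : DecTree (Fin n)} {v : Fin n} (hv : v ∈ T.leaves) :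
    boolDim G {v} ≤ T.boolWidth G := by
  induction T with
  | leaf w =>
    rw [leaves, List.mem_singleton] at hv
    subst hv
    rw [boolWidth, verts, leaves]
    simp
  | node l r hl hr =>
    rw [leaves, List.mem_append] at hv
    rw [boolWidth]
    rcases hv with h | h
    · exact (hl h).trans ((le_max_left _ _).trans (le_max_right _ _))
    · exact (hr h).trans ((le_max_right _ _).trans (le_max_right _ _))

theorem leaves_ne_nil (T : DecTree (Fin n)) : T.leaves ≠ [] := by
  induction T with
  | leaf v => simp [leaves]
  | node l r hl hr => simp [leaves, hl]

theorem code_congr {l l' : List (Fin n)} (h : ∀ v, v ∈ l ↔ v ∈ l') : code l = code l' :=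
  testBit_ext fun i => by simp only [testBit_code, h]

theorem code_ne_zero {l : List (Fin n)} (h : l ≠ []) : code l ≠ 0 := by
  intro h0
  obtain ⟨v, hv⟩ := List.exists_mem_of_ne_nil l h
  exact eq_zero_iff.1 h0 v (testBit_code.2 ⟨v, hv, rfl⟩)

/-- One step of the recursion: p at the leaf set is the larger of the cut at the root, which is at
most the width, and a minimum that is at most the value after deleting `v`. -/
theorem opt_le_of_append {p c r : ℕ → ℕ} (ho : Opt G p c r) {T : DecTree (Fin n)} {v : Fin n}
    {l : List (Fin n)} (hl : ∀ w, w ∈ T.leaves ↔ w ∈ l ++ [v]) (hv : v ∉ l)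
    {x : ℝ} (hT : T.boolWidth G ≤ x)
    (h : Real.logb 2 (p (code l)) ≤ x) : Real.logb 2 (p (code T.leaves)) ≤ x := by
  have hb := ho.best (code T.leaves) (code_lt _) (code_ne_zero (leaves_ne_nil T))
  have hd := boolDim_le_boolWidth (G := G) T
  rw [verts, ← vset_code, boolDim_vset] at hd
  have hle := hb.le v (testBit_code.2 ⟨v, (hl v).2 (by simp), rfl⟩)
  rw [show code T.leaves - 2 ^ (v : ℕ) = code l by
    rw [code_congr hl, code_append_singleton_sub hv]] at hle
  rw [hb.val]
  rcases le_total (un G (code T.leaves)) (p (code T.leaves - 2 ^ c (code T.leaves))) with h1 | h1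
  · rw [max_eq_right h1]
    refine le_trans ?_ h
    refine Real.logb_le_logb_of_le (by norm_num) ?_ (by exact_mod_cast hle)
    exact_mod_cast (one_le_un _).trans h1
  · rw [max_eq_left h1]
    exact hd.trans hT

/-- Induction on the tree: an internal node has a leaf child, on either side, and that leaf is the
vertex to be deleted. -/
theorem opt_le_boolWidth {p c r : ℕ → ℕ} (ho : Opt G p c r) {T : DecTree (Fin n)}
    (hT : T.leaves.Nodup) (hc : T.IsCaterpillar) :
    Real.logb 2 (p (code T.leaves)) ≤ T.boolWidth G := by
  induction T with
  | leaf v =>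
    refine opt_le_of_append (l := []) (v := v) ho (by simp [leaves]) (by simp) le_rfl ?_
    -- The value at the empty set is 0, and its logarithm is 0 by convention; this is harmless since
    -- boolean dimensions are nonnegative.
    rw [code, ho.zero, Nat.cast_zero, Real.logb_zero]
    refine le_trans ?_ (boolDim_le_boolWidth _)
    rw [verts, ← vset_code, boolDim_vset]
    exact Real.logb_nonneg (by norm_num) (by exact_mod_cast one_le_un _)
  | node l r hl hr =>
    obtain ⟨h1, h2, h3⟩ := hc
    rw [leaves, List.nodup_append] at hT
    obtain ⟨n1, n2, n3⟩ := hT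
    have wl : l.boolWidth G ≤ (node l r).boolWidth G := (le_max_left _ _).trans (le_max_right _ _)
    have wr : r.boolWidth G ≤ (node l r).boolWidth G := (le_max_right _ _).trans (le_max_right _ _)
    rcases h1 with h1 | h1
    · cases l with
      | node _ _ => exact h1.elim
      | leaf v =>
        exact opt_le_of_append (l := r.leaves) (v := v) ho
          (by simp [leaves, or_comm]) (fun h => n3 v (by simp [leaves]) v h rfl) le_rfl
          ((hr n2 h3).trans wr)
    · cases r with
      | node _ _ => exact h1.elim
      | leaf v =>
        exact opt_le_of_append (l := l.leaves) (v := v) ho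
          (by simp [leaves]) (fun h => n3 v h v (by simp [leaves]) rfl) le_rfl
          ((hl n1 h2).trans wl)

/-- Stated for an arbitrary accumulator so that the induction goes through: the nodes added are
single leaves and nodes whose leaves are those of `T` followed by a prefix of `l`. -/
theorem foldl_spec (G : SimpleGraph (Fin n)) (l : List (Fin n)) : ∀ T : DecTree (Fin n),
    (l.foldl (fun T u => node T (leaf u)) T).leaves = T.leaves ++ l ∧
    (T.IsCaterpillar → (l.foldl (fun T u => node T (leaf u)) T).IsCaterpillar) ∧
    ∀ x, T.boolWidth G ≤ x → (∀ v ∈ l, boolDim G {v} ≤ x) →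
      (∀ k ≤ l.length, boolDim G {v | v ∈ T.leaves ++ l.take k} ≤ x) →
      (l.foldl (fun T u => node T (leaf u)) T).boolWidth G ≤ x := by
  induction l with
  | nil => exact fun T => ⟨by simp, fun h => h, fun x h _ _ => h⟩
  | cons u l ih =>
    intro T
    obtain ⟨h1, h2, h3⟩ := ih (node T (leaf u))
    refine ⟨?_, fun h => h2 ⟨.inr trivial, h, trivial⟩, fun x hx hl hk => h3 x ?_ ?_ ?_⟩
    · rw [List.foldl_cons, h1]; simp [leaves]
    · rw [boolWidth, boolWidth, verts, verts]
      refine max_le ?_ (max_le hx ?_)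
      · simpa [leaves] using hk 1 (by simp)
      · simpa [leaves] using hl u (by simp)
    · exact fun v hv => hl v (List.mem_cons_of_mem _ hv)
    · intro k hkl
      have := hk (k + 1) (by simpa using hkl)
      simpa [leaves] using this

theorem leaves_ofOrdering (π : List (Fin n)) (hπ : π ≠ []) : (ofOrdering π hπ).leaves = π := by
  obtain ⟨v, l, rfl⟩ := List.exists_cons_of_ne_nil hπ
  rw [ofOrdering, (foldl_spec ⊥ l _).1]
  rfl

theorem isCaterpillar_ofOrdering (π : List (Fin n)) (hπ : π ≠ []) :
    (ofOrdering π hπ).IsCaterpillar := by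
  obtain ⟨v, l, rfl⟩ := List.exists_cons_of_ne_nil hπ
  rw [ofOrdering]
  exact (foldl_spec ⊥ l _).2.1 trivial

theorem boolWidth_ofOrdering_le {π : List (Fin n)} (hπ : π ≠ []) {x : ℝ}
    (h1 : ∀ v ∈ π, boolDim G {v} ≤ x)
    (h2 : ∀ k < π.length, boolDim G {v | v ∈ π.take (k + 1)} ≤ x) : (ofOrdering π hπ).boolWidth G ≤ x := by
  obtain ⟨v, l, rfl⟩ := List.exists_cons_of_ne_nil hπ
  rw [ofOrdering]
  refine (foldl_spec G l _).2.2 x ?_ (fun u hu => h1 u (List.mem_cons_of_mem _ hu)) fun k hk => ?_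
  · have := h1 v (by simp)
    simpa [boolWidth, verts, leaves] using this
  · have := h2 k (by simpa using Nat.lt_succ_iff.2 hk)
    simpa [leaves] using this

end DecTree

/-- The ordering read off from the table of optimal values. -/
theorem exists_optimal_ordering {p c r : ℕ → ℕ} (ho : Opt G p c r) (hn : 1 ≤ n) :
    ∃ (π : List (Fin n)) (hπ : π ≠ []), π.length = n ∧
      (∀ (i : ℕ) (hi : i < π.length), (π[i] : ℕ) = c (r^[n - 1 - i] (2 ^ n - 1))) ∧
      (DecTree.ofOrdering π hπ).IsLinearDecomposition ∧
      ∀ T : DecTree (Fin n), T.IsLinearDecomposition →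
        (DecTree.ofOrdering π hπ).boolWidth G ≤ T.boolWidth G := by
  set a : ℕ → ℕ := fun j => r^[j] (2 ^ n - 1) with ha
  set f : ℕ → Fin n := fun i => ⟨c (a (n - 1 - i)), ho.choice_lt (by omega)⟩ with hf
  set π : List (Fin n) := (List.range n).map f with hπd
  have hlen : π.length = n := by simp [hπd]
  have hπ : π ≠ [] := by
    rw [← List.length_pos_iff, hlen]; omega
  have hb : ∀ k < n, Best G p c r (a (n - 1 - k)) := fun k hk =>
    ho.best _ (ho.iterate (by omega)).1 (ho.iterate_ne_zero (by omega))
  -- The table yields the last vertex first, so position `k` is the choice at the iterate `n - 1 -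
  -- k`, and the first `k` vertices form the iterate `n - k`.
  have ha' : ∀ k < n, a (n - k) = a (n - 1 - k) - 2 ^ (f k : ℕ) := by
    intro k hk
    have e : n - k = (n - 1 - k) + 1 := by omega
    rw [ha, e]
    simp only
    rw [Function.iterate_succ_apply', (hb k hk).rest]
  have ha0 : a n = 0 := by
    have := (ho.iterate (le_refl n)).2
    by_contra h
    rw [Nat.sub_self, pop, Finset.card_eq_zero] at this
    have hs := sum_bitsOf (r^[n] (2 ^ n - 1))
    rw [this, Finset.sum_empty] at hs
    exact h hs.symm
  have htake : ∀ k, π.take (k + 1) = ((List.range n).take (k + 1)).map f := fun k => by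
    rw [hπd, List.map_take]
  have hcode : ∀ k ≤ n, code (π.take k) = a (n - k) ∧ (π.take k).Nodup := by
    intro k
    induction k with
    | zero => intro _; simp [code, ha0]
    | succ k ih =>
      intro hk
      obtain ⟨h1, h2⟩ := ih (by omega)
      have hk' : k < π.length := by omega
      have e : π[k] = f k := by simp [hπd]
      have hbk := (hb k (by omega)).mem
      have hmem := ha' k (by omega)
      have hnot : f k ∉ π.take k := by
        intro h
        have : (code (π.take k)).testBit (f k) = true := testBit_code.2 ⟨_, h, rfl⟩
        rw [h1, hmem, testBit_sub_two_pow hbk] at this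
        exact this.2 rfl
      rw [List.take_succ_eq_append_getElem hk', e]
      constructor
      · have h3 := code_append_singleton_sub hnot
        rw [h1, hmem] at h3
        have h4 := le_of_mem_subs (two_pow_mem_subs hbk)
        have h5 : 2 ^ (f k : ℕ) ≤ code (π.take k ++ [f k]) :=
          le_of_mem_subs (two_pow_mem_subs (testBit_code.2 ⟨f k, by simp, rfl⟩))
        rw [show n - (k + 1) = n - 1 - k by omega]
        have h4' : 2 ^ (f k : ℕ) ≤ a (n - 1 - k) := h4
        omega
      · rw [List.nodup_append]
        exact ⟨h2, by simp, fun x hx y hy => by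
          rw [List.mem_singleton] at hy
          rintro rfl
          exact hnot (hy ▸ hx)⟩
  have hfull : code π = 2 ^ n - 1 ∧ π.Nodup := by
    have := hcode n le_rfl
    rwa [List.take_of_length_le hlen.le, Nat.sub_self] at this
  have hall : ∀ v : Fin n, v ∈ π := by
    intro v
    have : (code π).testBit v = true := by rw [hfull.1, testBit_full]; exact v.2
    obtain ⟨w, hw, h⟩ := testBit_code.1 this
    exact Fin.ext h ▸ hw
  -- Along the chain of remaining sets p only decreases, and it dominates `un` at each of them.
  have hun : ∀ j < n, un G (a j) ≤ p (2 ^ n - 1) := by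
    have hp : ∀ j ≤ n, p (a j) ≤ p (2 ^ n - 1) := by
      intro j
      induction j with
      | zero => intro _; exact le_rfl
      | succ j ih =>
        intro hj
        have hbj := hb (n - 1 - j) (by omega)
        rw [show n - 1 - (n - 1 - j) = j by omega] at hbj
        refine le_trans ?_ (ih (by omega))
        rw [hbj.val]
        have : a (j + 1) = a j - 2 ^ c (a j) := by
          rw [← hbj.rest]; exact Function.iterate_succ_apply' _ _ _
        rw [this]
        exact le_max_right _ _
    intro j hj
    have hbj := hb (n - 1 - j) (by omega)
    rw [show n - 1 - (n - 1 - j) = j by omega] at hbj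
    refine le_trans ?_ (hp j hj.le)
    rw [hbj.val]
    exact le_max_left _ _
  refine ⟨π, hπ, hlen, fun i hi => by simp [hπd, hf, ha], ⟨⟨?_, fun v => ?_⟩, ?_⟩, fun T hT => ?_⟩
  · rw [DecTree.leaves_ofOrdering]; exact hfull.2
  · rw [DecTree.leaves_ofOrdering]; exact hall v
  · exact DecTree.isCaterpillar_ofOrdering π hπ
  · have hopt := DecTree.opt_le_boolWidth ho hT.1.1 hT.2
    have hcT : code T.leaves = 2 ^ n - 1 := by
      rw [← hfull.1]
      exact DecTree.code_congr fun v => ⟨fun _ => hall v, fun _ => hT.1.2 v⟩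
    rw [hcT] at hopt
    refine DecTree.boolWidth_ofOrdering_le hπ
      (fun v _ => DecTree.singleton_le_boolWidth (hT.1.2 v)) fun k hk => ?_
    rw [← vset_code, boolDim_vset, (hcode (k + 1) (by omega)).1]
    refine le_trans (Real.logb_le_logb_of_le (by norm_num) ?_ ?_) hopt
    · exact_mod_cast one_le_un _
    · exact_mod_cast hun _ (by omega)

end BooleanWidth

/-! ### Bounds for the number of steps and the space -/

namespace RAM

open Env

theorem pop_le_pop {s t : ℕ} (h : s ∈ subs t) : pop s ≤ pop t :=
  Finset.card_le_card (mem_subs_iff_bitsOf.1 h)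

/-- The subsets of `W ∪ {i}` are the subsets of `W` with and without `i`. -/
theorem sum_subs_lor {i W : ℕ} (hi : ¬ W.testBit i = true) (f : ℕ → ℕ) :
    ∑ R ∈ subs (W ||| 2 ^ i), f R = ∑ R ∈ subs W, (f R + f (R ||| 2 ^ i)) := by
  have hW : ∀ j, (W ||| 2 ^ i).testBit j = true ↔ W.testBit j = true ∨ i = j := fun j => by
    rw [testBit_lor, testBit_two_pow_iff]
  have hnot : ∀ R ∈ subs W, ¬ R.testBit i = true := fun R hR h => hi (mem_subs_iff.1 hR i h)
  have e : subs (W ||| 2 ^ i) = subs W ∪ (subs W).image (· ||| 2 ^ i) := by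
    ext R
    rw [Finset.mem_union, Finset.mem_image]
    constructor
    · intro h
      by_cases hR : R.testBit i = true
      · refine .inr ⟨dif R (2 ^ i), mem_subs_iff.2 fun j hj => ?_, testBit_ext fun j => ?_⟩
        · rw [testBit_dif, testBit_two_pow_iff] at hj
          exact ((hW j).1 (mem_subs_iff.1 h j hj.1)).resolve_right hj.2
        · rw [testBit_lor, testBit_dif, testBit_two_pow_iff]
          constructor
          · rintro (h | rfl)
            · exact h.1
            · exact hR
          · intro h
            by_cases e : i = j
            · exact .inr e
            · exact .inl ⟨h, e⟩
      · refine .inl (mem_subs_iff.2 fun j hj => ((hW j).1 (mem_subs_iff.1 h j hj)).resolve_right ?_)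
        rintro rfl
        exact hR hj
    · rintro (h | ⟨R', h, rfl⟩)
      · exact mem_subs_iff.2 fun j hj => (hW j).2 (.inl (mem_subs_iff.1 h j hj))
      · refine mem_subs_iff.2 fun j hj => (hW j).2 ?_
        rw [testBit_lor, testBit_two_pow_iff] at hj
        exact hj.imp_left (mem_subs_iff.1 h j)
  have hd : Disjoint (subs W) ((subs W).image (· ||| 2 ^ i)) := by
    rw [Finset.disjoint_left]
    intro R hR hR'
    obtain ⟨R', -, rfl⟩ := Finset.mem_image.1 hR'
    exact hnot _ hR (testBit_lor.2 (.inr (testBit_two_pow_iff.2 rfl)))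
  rw [e, Finset.sum_union hd, Finset.sum_image, Finset.sum_add_distrib]
  intro R hR R' hR' h
  have h1 := hnot R hR
  have h2 := hnot R' hR'
  refine testBit_ext fun j => ?_
  have : (R ||| 2 ^ i).testBit j = true ↔ (R' ||| 2 ^ i).testBit j = true := by
    simp only at h; rw [h]
  rw [testBit_lor, testBit_lor, testBit_two_pow_iff] at this
  by_cases e : i = j
  · subst e; simp [h1, h2]
  · simpa [e] using this

variable {n : ℕ} {G : SimpleGraph (Fin n)}

theorem lor_lor_eq {W i j : ℕ} (hij : i ≠ j) (hi : ¬ W.testBit i = true) (hj : ¬ W.testBit j = true) :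
    ¬ (W ||| 2 ^ i).testBit j = true ∧ W + 2 ^ i + 2 ^ j = W ||| 2 ^ i ||| 2 ^ j := by
  have h : ¬ (W ||| 2 ^ i).testBit j = true := by
    rw [testBit_lor, testBit_two_pow_iff]; tauto
  refine ⟨h, ?_⟩
  rw [add_comm W, two_pow_add hi, add_comm _ (2 ^ j), two_pow_add h]

theorem Matched.pop_eq {W m : ℕ} (h : Matched G W m) : pop W = 2 * m := by
  induction h with
  | zero => rfl
  | @step W m i j h hij hi hj ih =>
    have hne : i ≠ j := by
      rintro rfl; exact not_adj_self G i hij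
    have h2 := lor_lor_eq hne hi hj
    rw [h2.2, ← two_pow_add h2.1, pop_add h2.1, ← two_pow_add hi, pop_add hi, ih]
    ring

/-- Induction over the edges of the matching, each of which multiplies the sum by at most 7. -/
theorem Matched.sum_le {W m : ℕ} (h : Matched G W m) :
    ∑ R ∈ subs W, 2 ^ pop (free G W R) ≤ 7 ^ m := by
  induction h with
  | zero =>
    have : subs 0 = {0} := by
      ext s; simp [mem_subs, eq_comm]
    rw [this, Finset.sum_singleton, free, dif, Nat.zero_sub, pop_zero, pow_zero, pow_zero]
  | @step W m i j h hij hi hj ih =>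
    have hne : i ≠ j := by
      rintro rfl; exact not_adj_self G i hij
    obtain ⟨h1, h2⟩ := lor_lor_eq hne hi hj
    have hWb : ∀ k, (W ||| 2 ^ i ||| 2 ^ j).testBit k = true ↔ (W.testBit k = true ∨ i = k) ∨ j = k :=
      fun k => by rw [testBit_lor, testBit_lor, testBit_two_pow_iff, testBit_two_pow_iff]
    have hf : ∀ W R k, (free G W R).testBit k = true ↔ W.testBit k = true ∧ ¬ (R.testBit k = true ∨
        ∃ l, R.testBit l = true ∧ adj G l k) := fun W R k => by
      rw [free, testBit_dif, testBit_lor, testBit_nb]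
    -- no neighbor of the new edge remains if one of its ends is chosen
    have key : ∀ R R', (∀ k, R.testBit k = true → R'.testBit k = true) →
        (R'.testBit i = true ∨ R'.testBit j = true) →
        2 ^ pop (free G (W ||| 2 ^ i ||| 2 ^ j) R') ≤ 2 ^ pop (free G W R) := by
      intro R R' hRR hor
      refine Nat.pow_le_pow_right (by norm_num) (pop_le_pop (mem_subs_iff.2 fun k hk => ?_))
      rw [hf, hWb] at hk
      rw [hf]
      obtain ⟨hk1, hk2⟩ := hk
      refine ⟨?_, fun h => hk2 (h.imp (hRR k) fun ⟨l, h, h'⟩ => ⟨l, hRR l h, h'⟩)⟩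
      rcases hk1 with (hk1 | rfl) | rfl
      · exact hk1
      · rcases hor with hor | hor
        · exact absurd (.inl hor) hk2
        · exact absurd (.inr ⟨j, hor, hij.symm⟩) hk2
      · rcases hor with hor | hor
        · exact absurd (.inr ⟨i, hor, hij⟩) hk2
        · exact absurd (.inl hor) hk2
    have key' : ∀ R, 2 ^ pop (free G (W ||| 2 ^ i ||| 2 ^ j) R) ≤ 4 * 2 ^ pop (free G W R) := by
      intro R
      have hsub : bitsOf (free G (W ||| 2 ^ i ||| 2 ^ j) R) ⊆ bitsOf (free G W R) ∪ {i, j} := by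
        intro k hk
        rw [mem_bitsOf, hf, hWb] at hk
        rw [Finset.mem_union, mem_bitsOf, hf, Finset.mem_insert, Finset.mem_singleton]
        have := hk.2
        rcases hk.1 with (h | h) | h
        · exact .inl ⟨h, hk.2⟩
        · exact .inr (.inl h.symm)
        · exact .inr (.inr h.symm)
      have hcard : pop (free G (W ||| 2 ^ i ||| 2 ^ j) R) ≤ pop (free G W R) + 2 :=
        (Finset.card_le_card hsub).trans ((Finset.card_union_le _ _).trans
          (Nat.add_le_add_left Finset.card_le_two _))
      calc _ ≤ 2 ^ (pop (free G W R) + 2) := Nat.pow_le_pow_right (by norm_num) hcard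
        _ = _ := by ring
    rw [h2, sum_subs_lor h1, sum_subs_lor hi]
    have hlor : ∀ R t k : ℕ, R.testBit k = true → (R ||| t).testBit k = true := fun R t k h =>
      testBit_lor.2 (.inl h)
    have hself : ∀ R i : ℕ, (R ||| 2 ^ i).testBit i = true := fun R i =>
      testBit_lor.2 (.inr (testBit_two_pow_iff.2 rfl))
    -- 4 + 1 + 1 + 1: if neither end of the new edge is in `R`, up to two free vertices are gained;
    -- in the three other cases both ends are blocked.
    calc _ ≤ ∑ R ∈ subs W, 7 * 2 ^ pop (free G W R) := by
          refine Finset.sum_le_sum fun R _ => ?_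
          have k1 := key' R
          have k2 := key R (R ||| 2 ^ j) (hlor R _) (.inr (hself R j))
          have k3 := key R (R ||| 2 ^ i) (hlor R _) (.inl (hself R i))
          have k4 := key R (R ||| 2 ^ i ||| 2 ^ j) (fun k h => hlor _ _ k (hlor R _ k h))
            (.inr (hself _ j))
          omega
      _ = 7 * ∑ R ∈ subs W, 2 ^ pop (free G W R) := by rw [Finset.mul_sum]
      _ ≤ _ := by rw [pow_succ']; exact Nat.mul_le_mul_left _ ih

theorem pop_dif {s t : ℕ} (h : t ∈ subs s) : pop (dif s t) + pop t = pop s := by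
  have e : bitsOf (dif s t) = bitsOf s \ bitsOf t := by
    ext i
    rw [Finset.mem_sdiff, mem_bitsOf, mem_bitsOf, mem_bitsOf, testBit_dif]
  rw [pop, e]
  exact Finset.card_sdiff_add_card_eq_card (mem_subs_iff_bitsOf.1 h)

theorem distTime_le {W m : ℕ} (h : Matched G W m) : distTime W ≤ 24 * 9 ^ m := by
  have h1 : ∑ T ∈ subs W, 2 ^ pop T = 9 ^ m := by
    rw [sum_two_pow_pop, h.pop_eq, pow_mul]; norm_num
  have h2 := Nat.one_le_pow m 9 (by norm_num)
  calc distTime W ≤ ∑ T ∈ subs W, 21 * 2 ^ pop T + 3 := by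
        unfold distTime
        refine Nat.add_le_add_right (Finset.sum_le_sum fun T _ => ?_) _
        rw [Finset.sum_const, card_subs, smul_eq_mul]
        have := Nat.one_le_two_pow (n := pop T)
        omega
    _ ≤ _ := by rw [← Finset.mul_sum, h1]; omega

theorem collectTime_le {W H A m : ℕ} (h : Matched G W m) :
    collectTime G W H A ≤ 29 * (7 ^ m * 2 ^ pop (act G H A)) := by
  have h1 := h.sum_le
  have h2 := Nat.one_le_pow m 7 (by norm_num)
  have h3 := Nat.one_le_two_pow (n := pop (act G H A))
  calc collectTime G W H A
      ≤ ∑ R ∈ subs W, 26 * 2 ^ pop (act G H A) * 2 ^ pop (free G W R) + 3 := by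
        unfold collectTime
        refine Nat.add_le_add_right (Finset.sum_le_sum fun R _ => ?_) _
        rw [Finset.sum_const, Finset.sum_const, card_subs, card_subs, smul_eq_mul, smul_eq_mul]
        have := Nat.one_le_two_pow (n := pop (free G W R))
        nlinarith
    _ ≤ 26 * 2 ^ pop (act G H A) * 7 ^ m + 3 := by
        rw [← Finset.mul_sum]
        exact Nat.add_le_add_right (Nat.mul_le_mul_left _ h1) _
    _ ≤ _ := by nlinarith

/-- The active parts of `A` and of its complement are disjoint subsets of `H`, so the smaller has at
most half the elements. -/
theorem Env.SmallSide.pop_le {H A : ℕ} (hA : A ∈ subs H) (h : SmallSide G H A) : 2 * pop (act G H A) ≤ pop H := by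
  have h1 := pop_le_pop (land_mem_subs_left A (nb G (dif H A)))
  have h2 := pop_le_pop (land_mem_subs_left (dif H A) (nb G (dif H (dif H A))))
  have h3 := pop_dif hA
  unfold SmallSide at h
  unfold act at h ⊢
  omega

/-- If the matching is maximal, `H` spans no edges, and so no vertex of `A` has a neighbor in `H` at
all. -/
theorem act_eq_zero {W H A : ℕ} (hW : ∀ i j, adj G i j → W.testBit i = true ∨ W.testBit j = true)
    (hH : H = dif (2 ^ n - 1) W) (hA : A ∈ subs H) : act G H A = 0 := by
  have hHb : ∀ i, H.testBit i = true → ¬ W.testBit i = true := fun i h => by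
    rw [hH, testBit_dif] at h; exact h.2
  refine eq_zero_iff.2 fun i hi => ?_
  rw [act, testBit_land, testBit_nb] at hi
  obtain ⟨h1, j, h2, h3⟩ := hi
  rw [testBit_dif] at h2
  rcases hW j i h3 with h | h
  · exact hHb j h2.1 h
  · exact hHb i (mem_subs_iff.1 hA i h1) h

/-- The number of steps of `count`, where `y` is a bound for the number of choices of `Y`. -/
theorem countTime_le {W m : ℕ} (h : Matched G W m) (hm : 2 * m ≤ n)
    (hmax : 5 * n < 16 * m + 16 ∨ ∀ i j, adj G i j → W.testBit i = true ∨ W.testBit j = true) :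
    ∃ y, (y = 1 ∨ 5 * n < 16 * m + 16 ∧ y ^ 2 ≤ 2 ^ (n - 2 * m)) ∧
      ∑ A ∈ subs (dif (2 ^ n - 1) W), (bodyTime G W (dif (2 ^ n - 1) W) A + 4) + 4 ≤
        2 ^ (n - 2 * m) * (29 * (7 ^ m * y) + 36 * 9 ^ m) := by
  set H := dif (2 ^ n - 1) W with hH
  have hpop : pop H = n - 2 * m := by
    have := pop_dif (mem_subs_full.2 h.lt)
    rw [pop_full, h.pop_eq, ← hH] at this
    omega
  have hbody : ∀ A ∈ subs H, bodyTime G W H A ≤ 29 * (7 ^ m * 2 ^ ((n - 2 * m) / 2)) + 28 * 9 ^ m := by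
    intro A hA
    have h9 := Nat.one_le_pow m 9 (by norm_num)
    unfold bodyTime
    split_ifs with hs
    · have h1 := collectTime_le (H := H) (A := A) h
      have h2 := distTime_le h
      have h3 := hs.pop_le hA
      have h4 : 2 ^ pop (act G H A) ≤ 2 ^ ((n - 2 * m) / 2) :=
        Nat.pow_le_pow_right (by norm_num) (by omega)
      have h5 := Nat.mul_le_mul_left (7 ^ m) h4
      omega
    · omega
  have total : ∀ y, (∀ A ∈ subs H, bodyTime G W H A ≤ 29 * (7 ^ m * y) + 28 * 9 ^ m) →
      ∑ A ∈ subs H, (bodyTime G W H A + 4) + 4 ≤ 2 ^ (n - 2 * m) * (29 * (7 ^ m * y) + 36 * 9 ^ m) := by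
    intro y hy
    have h9 := Nat.one_le_pow m 9 (by norm_num)
    have h2 := Nat.one_le_two_pow (n := n - 2 * m)
    calc _ ≤ ∑ A ∈ subs H, (29 * (7 ^ m * y) + 32 * 9 ^ m) + 4 := by
          refine Nat.add_le_add_right (Finset.sum_le_sum fun A hA => ?_) _
          have := hy A hA
          omega
      _ = 2 ^ (n - 2 * m) * (29 * (7 ^ m * y) + 32 * 9 ^ m) + 4 := by
          rw [Finset.sum_const, card_subs, hpop, smul_eq_mul]
      _ ≤ _ := by nlinarith
  rcases hmax with hmax | hmax
  · refine ⟨2 ^ ((n - 2 * m) / 2), .inr ⟨hmax, ?_⟩, total _ hbody⟩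
    rw [← pow_mul]
    exact Nat.pow_le_pow_right (by norm_num) (by omega)
  · refine ⟨1, .inl rfl, total 1 fun A hA => ?_⟩
    have h9 := Nat.one_le_pow m 9 (by norm_num)
    unfold bodyTime
    split_ifs
    · have h1 := collectTime_le (H := H) (A := A) h
      have h2 := distTime_le h
      rw [act_eq_zero hmax hH hA, pop_zero, pow_zero] at h1
      omega
    · omega

theorem card_keys_le {W m : ℕ} (h : Matched G W m) (hm : 16 * m ≤ 5 * n) :
    (keys n W).card ≤ 2 ^ n := by
  have h1 : (keys n W).card ≤ 9 ^ m := by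
    have hsub : keys n W ⊆ (subs W).biUnion fun T => (subs T).image (T * 2 ^ n + ·) := by
      intro k hk
      obtain ⟨T, hT, L, hL, rfl⟩ := exists_of_mem_keys hk
      exact Finset.mem_biUnion.2 ⟨T, hT, Finset.mem_image.2 ⟨L, hL, rfl⟩⟩
    calc _ ≤ ∑ T ∈ subs W, ((subs T).image (T * 2 ^ n + ·)).card :=
          (Finset.card_le_card hsub).trans Finset.card_biUnion_le
      _ ≤ ∑ T ∈ subs W, 2 ^ pop T := Finset.sum_le_sum fun T _ => by
          rw [← card_subs]; exact Finset.card_image_le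
      _ = 9 ^ m := by rw [sum_two_pow_pop, h.pop_eq, pow_mul]; norm_num
  refine h1.trans (le_of_pow_le_pow_left₀ (n := 16) (by norm_num) (by positivity) ?_)
  calc (9 ^ m) ^ 16 = 9 ^ (16 * m) := by rw [← pow_mul, mul_comm]
    _ ≤ 9 ^ (5 * n) := Nat.pow_le_pow_right (by norm_num) hm
    _ = (9 ^ 5) ^ n := by rw [pow_mul]
    -- This uses 9^5 = 59049 < 65536 = 2^16, the reason for the cap 5/16.
    _ ≤ (2 ^ 16) ^ n := Nat.pow_le_pow_left (by norm_num) n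
    _ = (2 ^ n) ^ 16 := by rw [← pow_mul, ← pow_mul, mul_comm]

theorem space_le {K : Finset ℕ} {hK : ∀ k ∈ K, k < 4 ^ n} (hn : 1 ≤ n) (hc : K.card ≤ 2 ^ n) :
    (std n K hK).space ≤ 3000000 * (n * 2 ^ n) := by
  have h2 := Nat.one_le_two_pow (n := n)
  have hlt := @Nat.lt_two_pow_self n
  have hdom : ∀ a, (doms n K a).card ≤ 2 ^ n := by
    intro a
    unfold doms
    split_ifs
    · exact hc
    · rw [Finset.card_range]
    · rw [Finset.card_range]; omega
    · rw [Finset.card_singleton]; exact h2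
  have h1 : (std n K hK).addrs.card ≤ 34 * 2 ^ n := by
    unfold addrs
    refine (Finset.card_insert_le _ _).trans ?_
    have : ((Finset.range 33).biUnion fun a => ((std n K hK).dom a).image (addr n a)).card
        ≤ ∑ a ∈ Finset.range 33, 2 ^ n :=
      Finset.card_biUnion_le.trans (Finset.sum_le_sum fun a _ => Finset.card_image_le.trans (hdom a))
    rw [Finset.sum_const, Finset.card_range, smul_eq_mul] at this
    simp only [std_n] at this ⊢
    omega
  have h3 : (std n K hK).space = (std n K hK).addrs.card * (2 * (2 * n + 20)) +
      5 * 20000 * (2 * n + 20 + 1) := rfl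
  have h4 : n ≤ n * 2 ^ n := Nat.le_mul_of_pos_right n (by omega)
  rw [h3]
  calc _ ≤ 34 * 2 ^ n * (44 * n) + 5 * 20000 * (23 * n) := by
        refine Nat.add_le_add (Nat.mul_le_mul h1 (by omega)) (Nat.mul_le_mul_left _ (by omega))
    _ = 1496 * (n * 2 ^ n) + 2300000 * n := by ring
    _ ≤ _ := by omega

end RAM

namespace RAM

open Tm BinOp Env

/-! ### Numerical bounds -/

theorem two_pow_sub_mul {n m : ℕ} (hm : 2 * m ≤ n) (a : ℝ) :
    (2 : ℝ) ^ (n - 2 * m) * a ^ m = 2 ^ n * (a / 4) ^ m := by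
  have h : (2 : ℝ) ^ n = 2 ^ (n - 2 * m) * 4 ^ m := by
    rw [show (4 : ℝ) = 2 ^ 2 by norm_num, ← pow_mul, ← pow_add]
    congr 1
    omega
  rw [h, div_pow, mul_assoc, mul_div_cancel₀]
  positivity

/-- As `a / 4 ≥ 1`, the left-hand side grows with `m`, so the cap is the worst case; sixteenth
powers clear the fraction 5/16. -/
theorem two_pow_sub_mul_le {n m : ℕ} (hm : 16 * m ≤ 5 * n) {a : ℝ} (ha : 4 ≤ a) (ha' : a ≤ 9) :
    (2 : ℝ) ^ (n - 2 * m) * a ^ m ≤ 2.72 ^ n := by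
  rw [two_pow_sub_mul (by omega)]
  refine le_of_pow_le_pow_left₀ (n := 16) (by norm_num) (by positivity) ?_
  calc ((2 : ℝ) ^ n * (a / 4) ^ m) ^ 16 = (2 ^ 16) ^ n * (a / 4) ^ (16 * m) := by
        rw [mul_pow, ← pow_mul, ← pow_mul, ← pow_mul, mul_comm n, mul_comm m]
    _ ≤ (2 ^ 16) ^ n * (a / 4) ^ (5 * n) := by
        gcongr
        linarith
    _ ≤ (2 ^ 16) ^ n * (9 / 4) ^ (5 * n) := by gcongr
    _ = (2 ^ 16 * (9 / 4) ^ 5) ^ n := by rw [pow_mul, mul_pow]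
    _ ≤ (2.72 ^ 16) ^ n := by gcongr; norm_num
    _ = _ := by rw [← pow_mul, ← pow_mul, mul_comm]

/-- Here the bound decreases with `m`, so it needs a matching close to the cap. The power 32
combines the square in the bound for `y` with the factor 16 in front of `m`. -/
theorem two_pow_sub_mul_seven_le {n m y : ℕ} (hm : 2 * m ≤ n) (hm' : 5 * n < 16 * m + 16)
    (hy : y ^ 2 ≤ 2 ^ (n - 2 * m)) : (2 : ℝ) ^ (n - 2 * m) * (7 ^ m * y) ≤ 2 * 2.72 ^ n := by
  have hy' : (y : ℝ) ^ 2 ≤ 2 ^ (n - 2 * m) := by exact_mod_cast hy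
  refine le_of_pow_le_pow_left₀ (n := 32) (by norm_num) (by positivity) ?_
  have h1 : ((2 : ℝ) ^ (n - 2 * m) * (7 ^ m * y)) ^ 2 ≤ 8 ^ n * (49 / 64) ^ m := by
    calc ((2 : ℝ) ^ (n - 2 * m) * (7 ^ m * y)) ^ 2
        = (2 ^ (n - 2 * m)) ^ 2 * (7 ^ m) ^ 2 * (y : ℝ) ^ 2 := by ring
      _ ≤ (2 ^ (n - 2 * m)) ^ 2 * (7 ^ m) ^ 2 * 2 ^ (n - 2 * m) := by gcongr
      _ = (2 ^ (n - 2 * m) * 7 ^ m) ^ 2 * (2 ^ (n - 2 * m) * 1 ^ m) := by rw [one_pow]; ring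
      _ = (2 ^ n * (7 / 4) ^ m) ^ 2 * (2 ^ n * (1 / 4) ^ m) := by
          rw [two_pow_sub_mul hm, two_pow_sub_mul hm]
      _ = (2 ^ n) ^ 3 * (((7 / 4) ^ 2) ^ m * (1 / 4) ^ m) := by
          rw [← pow_mul (7 / 4 : ℝ), mul_comm 2 m, pow_mul]; ring
      _ = 8 ^ n * (49 / 64) ^ m := by
          rw [← mul_pow, ← pow_mul, mul_comm n, pow_mul]; norm_num
  -- Falling short of the cap by less than one edge costs the constant `(64 / 49) ^ 16`, which is
  -- below the `2 ^ 32` provided by the factor 2.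
  have h2 : (49 / 64 : ℝ) ^ (16 * m) ≤ ((49 / 64) ^ 5) ^ n * (64 / 49) ^ 16 := by
    have : (49 / 64 : ℝ) ^ (16 * m + 16) ≤ (49 / 64) ^ (5 * n) :=
      pow_le_pow_of_le_one (by norm_num) (by norm_num) hm'.le
    rw [pow_add] at this
    rw [← pow_mul]
    have e : (49 / 64 : ℝ) ^ (16 * m) = (49 / 64) ^ (16 * m) * (49 / 64) ^ 16 * (64 / 49) ^ 16 := by
      rw [mul_assoc, ← mul_pow]; norm_num
    rw [e]
    gcongr
  calc ((2 : ℝ) ^ (n - 2 * m) * (7 ^ m * y)) ^ 32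
      = (((2 : ℝ) ^ (n - 2 * m) * (7 ^ m * y)) ^ 2) ^ 16 := by rw [← pow_mul]
    _ ≤ (8 ^ n * (49 / 64) ^ m) ^ 16 := by gcongr
    _ = (8 ^ 16) ^ n * (49 / 64) ^ (16 * m) := by
        rw [mul_pow, ← pow_mul, ← pow_mul, ← pow_mul, mul_comm n, mul_comm m]
    _ ≤ (8 ^ 16) ^ n * (((49 / 64) ^ 5) ^ n * (64 / 49) ^ 16) := by gcongr
    _ = (8 ^ 16 * (49 / 64) ^ 5) ^ n * (64 / 49) ^ 16 := by rw [mul_pow]; ring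
    _ ≤ (2.72 ^ 32) ^ n * 2 ^ 32 := by
        gcongr
        · norm_num
        · norm_num
    _ = _ := by rw [mul_pow, ← pow_mul, ← pow_mul, mul_comm n, mul_comm]

theorem exists_cube_mul_pow_le : ∃ C : ℝ, 0 ≤ C ∧ ∀ n : ℕ, (n : ℝ) ^ 3 * 2.72 ^ n ≤ C * 2.7284 ^ n := by
  have h := tendsto_pow_const_mul_const_pow_of_abs_lt_one 3
    (r := (2.72 / 2.7284 : ℝ)) (by rw [abs_of_pos] <;> norm_num)
  obtain ⟨C, hC⟩ := h.bddAbove_range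
  have hC' : ∀ n : ℕ, (n : ℝ) ^ 3 * (2.72 / 2.7284) ^ n ≤ C := fun n => hC ⟨n, rfl⟩
  refine ⟨C, by simpa using hC' 0, fun n => ?_⟩
  have := hC' n
  rwa [div_pow, ← mul_div_assoc, div_le_iff₀ (by positivity)] at this

/-! ### The whole program -/

namespace Env

/-- Computes the tables of all bitsets and the matching. -/
def prepare : Program := .seq tables (.seq (set 7 (lit 0) (sc 12)) matching)

/-- Computes and writes an optimal ordering, except for its first vertex. -/
def solve : Program := .seq count (.seq optimize output)

/-- Writes the first vertex. -/
def finish : Program := .write (.const 0) (get 5 (sc 15)).toExpr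

def main : Program := .seq prepare (.seq solve finish)

variable {n : ℕ} {G : SimpleGraph (Fin n)}

theorem row_eq (G : SimpleGraph (Fin n)) (i : Fin n) : row G i = nb G (2 ^ (i : ℕ)) := by
  classical
  refine testBit_ext fun j => ?_
  have e : row G i = ∑ k ∈ ((Finset.univ.filter fun k => G.Adj i k).image fun k : Fin n => (k : ℕ)), 2 ^ k := by
    rw [Finset.sum_image fun x _ y _ h => Fin.ext h, Finset.sum_filter, row]
  rw [e, testBit_sum_two_pow, nb_testBit]
  simp only [Finset.mem_image, Finset.mem_filter, Finset.mem_univ, true_and, adj]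
  constructor
  · rintro ⟨k, hk, rfl⟩
    exact ⟨i.2, k.2, hk⟩
  · rintro ⟨hi, hj, h⟩
    exact ⟨⟨j, hj⟩, h, rfl⟩

/-- The store at the beginning. -/
noncomputable def start (G : SimpleGraph (Fin n)) : Store := fun a i =>
  if a = 32 ∧ i < n then nb G (2 ^ i) else 0

theorem input_apply (G : SimpleGraph (Fin n)) (x : ℕ) : input G x = cell n (start G) x := by
  rw [input, Finsupp.add_apply, Finsupp.finsetSum_apply]
  simp only [Finsupp.single_apply]
  unfold cell start
  by_cases h0 : x = 0
  · subst h0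
    simp
  · rw [if_neg (Ne.symm h0), if_neg h0, zero_add]
    by_cases hx : x ≤ n
    · rw [if_pos hx, if_pos ⟨rfl, by omega⟩,
        Finset.sum_eq_single_of_mem (⟨x - 1, by omega⟩ : Fin n) (Finset.mem_univ _), if_pos, row_eq]
      · simp only; omega
      · intro k _ hk
        rw [if_neg]
        intro h
        apply hk
        apply Fin.ext
        simp only
        omega
    · rw [if_neg hx, if_neg (by omega)]
      refine Finset.sum_eq_zero fun k _ => if_neg ?_
      have := k.2
      omega

theorem rep_start (G : SimpleGraph (Fin n)) :
    (std n ∅ (fun _ h => absurd h (Finset.notMem_empty _))).Rep (input G) (start G) := by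
  refine ⟨input_apply G, fun a ha i => ?_⟩
  have h1 := Nat.two_pow_pos n
  unfold start
  split_ifs with h
  · obtain ⟨rfl, h⟩ := h
    exact ⟨lt_word (by have := nb_lt (G := G) (2 ^ i); omega), fun _ => by
      show i ∈ doms n ∅ 32
      simpa [doms] using h⟩
  · exact ⟨by positivity, fun h => absurd rfl h⟩

/-- Changes the environment in the course of the run: the admissible table cells depend on `W`,
which is known only after the matching is computed. -/
theorem Rep.std_mono {K K' : Finset ℕ} {hK : ∀ k ∈ K, k < 4 ^ n} {hK' : ∀ k ∈ K', k < 4 ^ n}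
    (h : K ⊆ K') {M : Mem} {σ : Store} (hM : (std n K hK).Rep M σ) : (std n K' hK').Rep M σ := by
  refine ⟨hM.1, fun a ha i => ⟨(hM.2 a ha i).1, fun h0 => ?_⟩⟩
  have h1 : i ∈ doms n K a := (hM.2 a ha i).2 h0
  show i ∈ doms n K' a
  unfold doms at h1 ⊢
  split_ifs at h1 ⊢ <;> first | exact h h1 | exact h1

theorem run_prepare {K : Finset ℕ} {hK : ∀ k ∈ K, k < 4 ^ n} :
    ∃ τ W m, (std n K hK).Run prepare (start G) τ
        (n * (2 ^ n * 4 + 5) + 3 + (1 + (n * (n * 6 + 6) + 3))) ∧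
      Tab G τ ∧ τ 7 0 = 2 ^ n ∧ τ 8 0 = W ∧ (∀ a, a = 2 ∨ a = 4 → ∀ i, τ a i = 0) ∧
      Matched G W m ∧ 16 * m ≤ 5 * n ∧
      (5 * n < 16 * m + 16 ∨ ∀ i j, adj G i j → W.testBit i = true ∨ W.testBit j = true) := by
  have h1 := Nat.two_pow_pos n
  obtain ⟨τ, a1, a2, a3, a4⟩ := run_tables (K := K) (hK := hK) (G := G) (start G)
    (fun i hi => if_pos ⟨rfl, hi⟩) rfl rfl
  set φ := upd τ 7 0 (2 ^ n) with hφ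
  have hag : Agree {7} τ φ := (Agree.refl _ _).upd (by decide) _ _
  have ht : Tab G φ := fun s hs => by
    rw [hag 0 (by decide), hag 1 (by decide)]; exact a2 s hs
  have hs := last_set (E := std n K hK) (a := 7) (e := lit 0) (f := sc 12) (σ := τ) (i := 0)
    (v := 2 ^ n) (by decide) rfl (by simp [a3]) mem_dom (lt_word (by omega))
  obtain ⟨υ, W, m, b1, b2, b3, b4, b5, b6⟩ := run_matching (K := K) (hK := hK) φ ht
    (by rw [hag 8 (by decide), a4 8 (by decide)]; rfl) (by rw [hag 10 (by decide), a4 10 (by decide)]; rfl)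
  refine ⟨υ, W, m, a1.seq (hs.seq b1), fun s hs => ?_, ?_, b3, ?_, b4, b5, b6⟩
  · rw [b2 0 (by decide), b2 1 (by decide)]; exact ht s hs
  · rw [b2 7 (by decide)]; simp [hφ]
  · rintro a (rfl | rfl) i
    · rw [b2 2 (by decide), hag 2 (by decide), a4 2 (by decide)]; rfl
    · rw [b2 4 (by decide), hag 4 (by decide), a4 4 (by decide)]; rfl

theorem run_solve (hn : 1 ≤ n) {W : ℕ} (hWn : W < 2 ^ n) {σ : Store} (ht : Tab G σ)
    (h7 : σ 7 0 = 2 ^ n) (h8 : σ 8 0 = W) (h0 : ∀ a, a = 2 ∨ a = 4 → ∀ i, σ a i = 0) :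
    ∃ τ p c r, (std n (keys n W) keys_lt).Run solve σ τ
        (∑ A ∈ subs (RAM.dif (2 ^ n - 1) W), (bodyTime G W (RAM.dif (2 ^ n - 1) W) A + 4) + 4 +
          (2 ^ n * (n * 8 + 12) + 2 + (n * 4 + 3))) ∧
      Opt G p c r ∧ τ 5 (τ 15 0) = c (r^[n - 1] (2 ^ n - 1)) ∧
      ∀ i < n - 1, τ 32 i = c (r^[n - 2 - i] (2 ^ n - 1)) := by
  obtain ⟨τ, a1, a2, a3⟩ := run_count hWn ht h7 h8 fun k _ => h0 2 (.inl rfl) k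
  obtain ⟨υ, b1, b2, b3⟩ := run_optimize (K := keys n W) (hK := keys_lt) (σ := τ)
    (by rw [a3 7 (by decide), h7]) a2 (by rw [a3 4 (by decide)]; exact h0 4 (.inr rfl) 0)
  obtain ⟨φ, c1, c2, c3⟩ := run_output (K := keys n W) (hK := keys_lt) (σ := υ) hn
    (by rw [b3 7 (by decide), a3 7 (by decide), h7]) b2
  exact ⟨φ, υ 4, υ 5, υ 6, a1.seq (b1.seq c1), b2, c2, c3⟩

/-- The last write destroys the number of vertices in cell `0`, so the memory no longer represents a
store; its size is bounded directly instead. -/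
theorem exec_finish {E : Env} {M : Mem} {σ : Store} (hM : E.Rep M σ) {v : ℕ}
    (hv : σ 5 (σ 15 0) = v) : ∃ t s, Exec finish M (M.update 0 v) t s ∧ t ≤ E.unit ∧ s ≤ E.space := by
  have hval : ((get 5 (sc 15)).toExpr).val M = v := by
    rw [Tm.val_toExpr hM.1 _ (by decide)]; exact hv
  have hvb : v < 2 ^ E.b := by rw [← hv]; exact (hM.2 5 (by norm_num) _).1
  have hw := Exec.write (.const 0) (get 5 (sc 15)).toExpr M
  rw [hval] at hw
  change Exec finish M (M.update 0 v) _ (max M.bits (Mem.bits (M.update 0 v)) + _ + _) at hw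
  have h1 : ((get 5 (sc 15)).toExpr).cost M ≤ maxWeight * (E.b + 1) := hM.cost_le (by decide) (by decide)
  have h2 := size_le_of_lt hvb
  have h3 := hM.bits_le
  have h4 : (Mem.bits (M.update 0 v)) ≤ E.addrs.card * (2 * E.b) := by
    refine Env.bits_le (fun x => ?_) (fun x hx => ?_)
    · rw [Finsupp.coe_update, Function.update_apply]
      split_ifs
      · exact hvb
      · rw [hM.1]; exact cell_lt hM.2 x
    · rw [Finsupp.coe_update, Function.update_apply] at hx
      split_ifs at hx with h
      · rw [h]; exact Finset.mem_insert_self _ _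
      · rw [hM.1] at hx; exact mem_addrs_of_cell hM.2 hx
  have h5 : E.unit = 5 * (maxWeight * (E.b + 1)) := by rw [unit, mul_assoc]
  have h6 : E.b + 1 ≤ maxWeight * (E.b + 1) := Nat.le_mul_of_pos_left _ (by norm_num [maxWeight])
  refine ⟨_, _, hw, ?_, ?_⟩
  · simp only [Expr.cost, Expr.val, Nat.size_zero]
    omega
  · simp only [Expr.cost, Nat.size_zero]
    rw [space]
    have := max_le h3 h4
    omega

/-- The program computes an optimal ordering. -/
theorem exec_main (hn : 1 ≤ n) (G : SimpleGraph (Fin n)) :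
    ∃ N t s p c r, Exec main (input G) N t s ∧ Opt G p c r ∧
      (∀ i < n, N i = c (r^[n - 1 - i] (2 ^ n - 1))) ∧
      (t : ℝ) ≤ 460000000 * ((n : ℝ) ^ 3 * 2.72 ^ n) ∧ s ≤ 3000000 * (n * 2 ^ n) := by
  obtain ⟨σ, W, m, a1, a2, a3, a4, a5, a6, a7, a8⟩ := run_prepare (n := n) (G := G) (K := ∅)
    (hK := fun _ h => absurd h (Finset.notMem_empty _))
  obtain ⟨τ, p, c, r, b1, b2, b3, b4⟩ := run_solve hn a6.lt a2 a3 a4 a5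
  obtain ⟨M, t1, s1, e1, r1, ht1, hs1⟩ := a1 _ (rep_start G)
  obtain ⟨M', t2, s2, e2, r2, ht2, hs2⟩ := b1 M (r1.std_mono (Finset.empty_subset _))
  obtain ⟨t3, s3, e3, ht3, hs3⟩ := exec_finish r2 b3
  refine ⟨_, _, _, p, c, r, .seq e1 (.seq e2 e3), b2, fun i hi => ?_, ?_, ?_⟩
  · rw [Finsupp.coe_update, Function.update_apply]
    split_ifs with h
    · rw [h, Nat.sub_zero]
    · rw [r2.1]
      have e : (std n (keys n W) keys_lt).n = n := rfl
      rw [e, cell, if_neg h, if_pos hi.le, b4 (i - 1) (by omega)]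
      rw [show n - 2 - (i - 1) = n - 1 - i by omega]
  · have hunit : ∀ (K : Finset ℕ) hK, (std n K hK).unit ≤ 2300000 * n := fun K hK => by
      show 5 * 20000 * (2 * n + 20 + 1) ≤ _
      omega
    obtain ⟨y, hy, hcount⟩ := countTime_le a6 (by omega) a8
    have hnR : (1 : ℝ) ≤ n := by exact_mod_cast hn
    set Q : ℝ := 2.72 ^ n with hQ
    have hQ1 : 1 ≤ Q := one_le_pow₀ (by norm_num)
    have hQ2 : (2 : ℝ) ^ n ≤ Q := pow_le_pow_left₀ (by norm_num) (by norm_num) n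
    have h9 : (2 : ℝ) ^ (n - 2 * m) * 9 ^ m ≤ Q := two_pow_sub_mul_le a7 (by norm_num) (by norm_num)
    have h7 : (2 : ℝ) ^ (n - 2 * m) * (7 ^ m * y) ≤ 2 * Q := by
      rcases hy with rfl | ⟨hy1, hy2⟩
      · have := two_pow_sub_mul_le a7 (a := 7) (by norm_num) (by norm_num)
        rw [Nat.cast_one, mul_one]
        linarith
      · exact two_pow_sub_mul_seven_le (by omega) hy1 hy2
    -- 94 = 29 · 2 + 36.
    have hcountR : ((2 ^ (n - 2 * m) * (29 * (7 ^ m * y) + 36 * 9 ^ m) : ℕ) : ℝ) ≤ 94 * Q := by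
      push_cast
      linarith
    have ht : t1 + (t2 + t3) ≤ (n * (2 ^ n * 4 + 5) + 3 + (1 + (n * (n * 6 + 6) + 3)) +
        (2 ^ (n - 2 * m) * (29 * (7 ^ m * y) + 36 * 9 ^ m) +
          (2 ^ n * (n * 8 + 12) + 2 + (n * 4 + 3))) + 1) * (2300000 * n) := by
      have g1 := ht1.trans (Nat.mul_le_mul_left _ (hunit _ _))
      have g2 := ht2.trans (Nat.mul_le_mul (Nat.add_le_add_right hcount _) (hunit _ _))
      have g3 := ht3.trans (hunit _ _)
      rw [add_mul, add_mul _ _ (2300000 * n), one_mul]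
      omega
    have ht' : ((t1 + (t2 + t3) : ℕ) : ℝ) ≤ (n * (2 ^ n * 4 + 5) + 3 + (1 + (n * (n * 6 + 6) + 3)) +
        (94 * Q + (2 ^ n * (n * 8 + 12) + 2 + (n * 4 + 3))) + 1) * (2300000 * n) := by
      refine (Nat.cast_le.2 ht).trans ?_
      rw [Nat.cast_mul]
      push_cast at hcountR ⊢
      gcongr
    refine ht'.trans ?_
    -- The dominant terms are `n * 2 ^ n` and `Q`, both at most `n ^ 2 * Q`; the cost of a step
    -- contributes the third factor `n`.
    have hk : (n * (2 ^ n * 4 + 5) + 3 + (1 + (n * (n * 6 + 6) + 3)) +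
        (94 * Q + (2 ^ n * (n * 8 + 12) + 2 + (n * 4 + 3))) + 1 : ℝ) ≤ 200 * (n ^ 2 * Q) := by
      have q0 : (0 : ℝ) ≤ n := by linarith
      have q1 : (n : ℝ) ≤ n ^ 2 := by nlinarith
      have q2 : (n : ℝ) * 2 ^ n ≤ n ^ 2 * Q := mul_le_mul q1 hQ2 (by positivity) (by positivity)
      have q3 : (n : ℝ) ^ 2 ≤ n ^ 2 * Q := le_mul_of_one_le_right (by positivity) hQ1
      have q4 : Q ≤ n ^ 2 * Q := le_mul_of_one_le_left (by linarith) (by nlinarith)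
      nlinarith
    calc _ ≤ 200 * ((n : ℝ) ^ 2 * Q) * (2300000 * n) := by gcongr
      _ = _ := by ring
  · have k1 := space_le (K := keys n W) (hK := keys_lt) hn (card_keys_le a6 a7)
    have k2 := space_le (n := n) (K := ∅) (hK := fun _ h => absurd h (Finset.notMem_empty _)) hn (by simp)
    exact max_le (hs1.trans k2) (max_le (hs2.trans k1) (hs3.trans k1))

end Env
end RAM

theorem mainTheorem7 :
    ∃ (p : RAM.Program) (C : ℝ), ∀ (n : ℕ), 1 ≤ n → ∀ (G : SimpleGraph (Fin n)),
      ∃ (N : RAM.Mem) (t s : ℕ),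
        RAM.Exec p (RAM.input G) N t s ∧
        (t : ℝ) ≤ C * (2.7284 : ℝ) ^ n ∧
        (s : ℝ) ≤ C * ((n : ℝ) * 2 ^ n) ∧
        ∃ (π : List (Fin n)) (hπ : π ≠ []),
          (∀ (i : ℕ) (hi : i < π.length), N i = (π[i] : ℕ)) ∧
          (BooleanWidth.DecTree.ofOrdering π hπ).IsLinearDecomposition ∧
          ∀ T : BooleanWidth.DecTree (Fin n), T.IsLinearDecomposition →
            (BooleanWidth.DecTree.ofOrdering π hπ).boolWidth G ≤ T.boolWidth G := by
  obtain ⟨C, hC0, hC⟩ := RAM.exists_cube_mul_pow_le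
  refine ⟨RAM.Env.main, max (460000000 * C) 3000000, fun n hn G => ?_⟩
  obtain ⟨N, t, s, p, c, r, h1, h2, h3, h4, h5⟩ := RAM.Env.exec_main hn G
  obtain ⟨π, hπ, hlen, g1, g2, g3⟩ := BooleanWidth.exists_optimal_ordering h2 hn
  refine ⟨N, t, s, h1, ?_, ?_, π, hπ, fun i hi => ?_, g2, g3⟩
  · have := hC n
    have hpos : (0 : ℝ) ≤ 2.7284 ^ n := by positivity
    calc (t : ℝ) ≤ 460000000 * ((n : ℝ) ^ 3 * 2.72 ^ n) := h4
      _ ≤ 460000000 * (C * 2.7284 ^ n) := by gcongr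
      _ = 460000000 * C * 2.7284 ^ n := by ring
      _ ≤ _ := by gcongr; exact le_max_left _ _
  · have h : (s : ℝ) ≤ 3000000 * ((n : ℝ) * 2 ^ n) := by exact_mod_cast h5
    refine h.trans ?_
    gcongr
    exact le_max_right _ _
  · rw [h3 i (by omega), g1 i hi]
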